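/- **Setting.** Let $n\ge 2$. Indices $a,b,c$ run from $1$ to $n$, repeated indices are summed, subscripts denote derivatives, $^*$ is complex conjugation, and $\partial_\psi,\partial_{\psi^*}$ are the Wirtinger derivatives. Everything is local and smooth ($C^\infty$). Let $\mathscr N$ be the class of equations $$i\psi_t+G\,\psi_{aa}+F=0$$ for a complex function $\psi$ of real variables $(t,x)=(t,x_1,\dots,x_n)$, where $G,F$ are smooth complex-valued functions of $(t,x,\psi,\psi^*,\nabla\psi,\nabla\psi^*)$ on a nonempty open domain and $G$ vanishes nowhere. Let $\mathscr N_0$ (resp. $\bar{\mathscr N}_0$) be the subclass of equations with $G^*\neq-G$ (resp. $G^*=-G$) at every point of the domain. A *point transformation* is a diffeomorphism $\varphi\colon\ \tilde t=T,\ \tilde x_a=X^a,\ \tilde\psi=\Psi$ between open subsets of the space of $(t,x,\psi)$, where $T,X^a$ (real) and $\Psi$ (complex) are functions of $(t,x,\psi,\psi^*)$. It maps one equation to another if its second prolongation maps the set of $2$-jets satisfying the first equation to the set of those satisfying the second. An *admissible transformation* of a class is a triple (equation of the class, point transformation between the domains in $(t,x,\psi)$ mapping the first equation to the second, equation of the class).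 The *equivalence group* $G^\sim$ of a class consists of the point transformations $\Phi$ in the space of $(t,x,\psi,\psi^*,\nabla\psi,\nabla\psi^*,G,G^*,F,F^*)$ with $G\ne0$ (local in $(t,x,\psi)$, defined for all values of $\nabla\psi$, $G\neq0$, $F$) that project to a point transformation $\varphi$ of $(t,x,\psi)$, act on $\nabla\psi$ by the prolongation of $\varphi$, and send the arbitrary elements $(G,F)$ of each equation of the class whose domain lies over that of $\varphi$ to those of an equation of the class to which $\varphi$ maps the initial equation. A class is *normalized* if each of its admissible transformations is induced by an element of its equivalence group. Consider the following conditions, in which $H$ is a positive smooth real-valued function with $H_\psi=H_{\psi^*}=0$ (i.e. locally a function of $(t,x)$): (A) $T_\psi=T_{\psi^*}=0,\quad T_a=0,\quad T_t\ne0,\quad X^a_\psi=X^a_{\psi^*}=0,\quad X^b_aX^c_a=H\delta_{bc}$; (B) $\tilde G=\dfrac{H}{T_t}G$ where $\Psi_\psi\ne0$, and $\tilde G=-\dfrac{H}{T_t}G^*$ where $\Psi_{\psi^*}\neq0$; (C) $\displaystyle \tilde F=\frac{\Psi_\psi}{T_t}F-\frac{\Psi_{\psi^*}}{T_t}F^*-\Big(\hat\Delta\Psi+\frac{n-2}{2}\frac{H_a}{H}\mathrm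 D_a\Psi\Big)\frac{\tilde G}{H}-\frac{i}{T_t}\Big(\Psi_t-X^b_t\frac{X^b_a}{H}\mathrm D_a\Psi\Big)$, where $\mathrm D_a\Psi=\Psi_a+\psi_a\Psi_\psi+\psi^*_a\Psi_{\psi^*}$ and $\hat\Delta=\partial_{aa}+2\psi_a\partial_{a\psi}+2\psi^*_a\partial_{a\psi^*}+\psi_a\psi_a\partial_{\psi\psi}+2\psi_a\psi^*_a\partial_{\psi\psi^*}+\psi^*_a\psi^*_a\partial_{\psi^*\psi^*}$. **Statement.** 1. The class $\mathscr N$ is not normalized. Its equivalence group $G^\sim_{\mathscr N}$ consists of the transformations $\Phi$ whose components satisfy (A), $\Psi_\psi\Psi_{\psi^*}=0$, (B) and (C) for some $H$; every point transformation $\varphi$ satisfying (A) for some $H$ and $\Psi_\psi\Psi_{\psi^*}=0$ is the projection of an element of $G^\sim_{\mathscr N}$. 2. $\mathscr N_0$ and $\bar{\mathscr N}_0$ are disjoint subclasses of $\mathscr N$ that partition $\mathscr N$ locally: the domain of each equation of $\mathscr N$ contains disjoint open subsets $U_0$ and $U_1$ with dense union such that the equation restricted to $U_0$ (if nonempty)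 belongs to $\mathscr N_0$ and restricted to $U_1$ (if nonempty) belongs to $\bar{\mathscr N}_0$. 3. The classes $\mathscr N_0$ and $\bar{\mathscr N}_0$ are normalized, and no point transformation maps an equation of one of them to an equation of the other one. 4. $G^\sim_{\mathscr N_0}=G^\sim_{\mathscr N}$. 5. The equivalence group $G^\sim_{\bar{\mathscr N}_0}$ consists of the transformations $\Phi$ whose components satisfy (A) for some $H$ and, at the points with $G^*=-G$, also (B) and (C); every point transformation $\varphi$ satisfying (A) for some $H$ is the projection of an element of $G^\sim_{\bar{\mathscr N}_0}$. -/

import Mathlib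

open Set Filter Topology ComplexConjugate
open scoped ContDiff

noncomputable section

namespace GenSchr

/-- The space of independent variables `(t, x)`. -/
abbrev IndepVar (n : ℕ) : Type := ℝ × (Fin n → ℝ)

/-- The space with coordinates `((t, x), ψ)`; the coordinate `ψ*` is the conjugate of `ψ`. -/
abbrev VarSpace (n : ℕ) : Type := IndepVar n × ℂ

/-- The space with coordinates `(((t, x), ψ), ∇ψ)`, on which `G` and `F` are defined. -/
abbrev JetSpace (n : ℕ) : Type := VarSpace n × (Fin n → ℂ)

/-- The space with coordinates `((((t, x), ψ), ∇ψ), (G, F))`. -/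
abbrev TotalSpace (n : ℕ) : Type := JetSpace n × (ℂ × ℂ)

variable {n : ℕ}

/-! ### Derivatives of functions of `(t, x)` -/

/-- `f_t` for a function `f` of `(t, x)`. -/
def timeDeriv (f : IndepVar n → ℂ) (q : IndepVar n) : ℂ := fderiv ℝ f q (1, 0)

/-- `f_a` for a function `f` of `(t, x)`. -/
def spaceDeriv (a : Fin n) (f : IndepVar n → ℂ) (q : IndepVar n) : ℂ :=
  fderiv ℝ f q (0, Pi.single a 1)

/-- The point `(t, x, ψ, ∇ψ)` of the jet space given by `ψ = f` at `q = (t, x)`. -/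
def jet (f : IndepVar n → ℂ) (q : IndepVar n) : JetSpace n :=
  ((q, f q), fun a => spaceDeriv a f q)

/-! ### Equations -/

/-- The data of an equation `i ψ_t + G ψ_aa + F = 0`: the functions `G`, `F` of
`(t, x, ψ, ψ*, ∇ψ, ∇ψ*)` and their domain. Values outside the domain are irrelevant. -/
structure Eqn (n : ℕ) where
  dom : Set (JetSpace n)
  G : JetSpace n → ℂ
  F : JetSpace n → ℂ

namespace Eqn

/-- The projection of the domain to the space of `(t, x, ψ)`. -/
def base (θ : Eqn n) : Set (VarSpace n) := Prod.fst '' θ.dom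

/-- The graph of the arbitrary elements `(G, F)` over the domain. -/
def graph (θ : Eqn n) : Set (TotalSpace n) := (fun j => (j, (θ.G j, θ.F j))) '' θ.dom

/-- The same equation considered on another (smaller) domain. -/
def restrict (θ : Eqn n) (U : Set (JetSpace n)) : Eqn n := ⟨U, θ.G, θ.F⟩

/-- The 2-jet of `f` at `q` belongs to the equation. -/
def SolvedAt (θ : Eqn n) (f : IndepVar n → ℂ) (q : IndepVar n) : Prop :=
  jet f q ∈ θ.dom ∧
    Complex.I * timeDeriv f q + θ.G (jet f q) * ∑ a, spaceDeriv a (spaceDeriv a f) q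
      + θ.F (jet f q) = 0

end Eqn

/-- The class `𝒩`. -/
def classN (n : ℕ) : Set (Eqn n) :=
  {θ | IsOpen θ.dom ∧ θ.dom.Nonempty ∧ ContDiffOn ℝ ∞ θ.G θ.dom ∧ ContDiffOn ℝ ∞ θ.F θ.dom ∧
    ∀ j ∈ θ.dom, θ.G j ≠ 0}

/-- The subclass `𝒩₀` of `𝒩` singled out by `G* ≠ -G`. -/
def classN0 (n : ℕ) : Set (Eqn n) := {θ ∈ classN n | ∀ j ∈ θ.dom, conj (θ.G j) ≠ -θ.G j}

/-- The subclass `𝒩̄₀` of `𝒩` singled out by `G* = -G`. -/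
def classN0bar (n : ℕ) : Set (Eqn n) := {θ ∈ classN n | ∀ j ∈ θ.dom, conj (θ.G j) = -θ.G j}

/-! ### Point transformations and admissible transformations -/

/-- A (local) point transformation in the space of `(t, x, ψ, ψ*)`: a smooth diffeomorphism
between open subsets. -/
structure PointTransf (n : ℕ) where
  map : OpenPartialHomeomorph (VarSpace n) (VarSpace n)
  smooth : ContDiffOn ℝ ∞ map map.source
  smooth_symm : ContDiffOn ℝ ∞ map.symm map.target

namespace PointTransf

/-- `φ` maps the germ at `q` of the graph of `f` into the graph of `f'`, with `q` going to `q'`.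
If `f` and `f'` are smooth, then the jets of `f'` at `q'` are the images of those of `f` at `q`
under the prolongations of `φ`. -/
def MapsGerm (φ : PointTransf n) (f : IndepVar n → ℂ) (q : IndepVar n)
    (f' : IndepVar n → ℂ) (q' : IndepVar n) : Prop :=
  ContDiffAt ℝ ∞ f q ∧ ContDiffAt ℝ ∞ f' q' ∧ (q, f q) ∈ φ.map.source ∧
    φ.map (q, f q) = (q', f' q') ∧
    ∀ᶠ r in 𝓝 q, (φ.map (r, f r)).2 = f' (φ.map (r, f r)).1

/-- `φ` is defined over the domain of `θ` and maps the equation `θ` to the equation `θ'`: the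
second prolongation of `φ` maps the set of 2-jets satisfying `θ` to that of `θ'`. -/
def MapsEqn (φ : PointTransf n) (θ θ' : Eqn n) : Prop :=
  θ.base ⊆ φ.map.source ∧ φ.map '' θ.base = θ'.base ∧
    ∀ f q f' q', φ.MapsGerm f q f' q' → (q, f q) ∈ θ.base →
      (θ.SolvedAt f q ↔ θ'.SolvedAt f' q')

/-- `(θ, φ, θ')` is an admissible transformation: `φ` is a point transformation between the domains
of the equations `θ` and `θ'` mapping `θ` to `θ'`. -/
def IsAdmissible (φ : PointTransf n) (θ θ' : Eqn n) : Prop :=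
  φ.map.source = θ.base ∧ φ.MapsEqn θ θ'

end PointTransf

/-! ### Equivalence groups and normalization -/

/-- A point transformation in the space of `(t, x, ψ, ψ*, ∇ψ, ∇ψ*, G, G*, F, F*)` with `G ≠ 0`
that is projectable to the space of `(t, x, ψ, ψ*)` and to the space of
`(t, x, ψ, ψ*, ∇ψ, ∇ψ*)`, the second projection being the prolongation of the first one.
It is local in `(t, x, ψ)`, and defined for all values of `∇ψ`, `G ≠ 0` and `F`. -/
structure TotalTransf (n : ℕ) where
  base : PointTransf n
  map : OpenPartialHomeomorph (TotalSpace n) (TotalSpace n)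
  smooth : ContDiffOn ℝ ∞ map map.source
  smooth_symm : ContDiffOn ℝ ∞ map.symm map.target
  source_eq : map.source = {e | e.1.1 ∈ base.map.source ∧ e.2.1 ≠ 0}
  target_eq : map.target = {e | e.1.1 ∈ base.map.target ∧ e.2.1 ≠ 0}
  proj_base : ∀ e ∈ map.source, (map e).1.1 = base.map e.1.1
  proj_jet : ∀ e ∈ map.source, ∀ e' ∈ map.source, e.1 = e'.1 → (map e).1 = (map e').1
  prolong : ∀ f q f' q', base.MapsGerm f q f' q' →
    ∀ G F : ℂ, G ≠ 0 → (map (jet f q, (G, F))).1 = jet f' q'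

/-- `Φ` maps the arbitrary elements of `θ` to those of `θ'`. -/
def TotalTransf.MapsArb (Φ : TotalTransf n) (θ θ' : Eqn n) : Prop :=
  Φ.map '' θ.graph = θ'.graph

/-- The equivalence group of a class `C`: the transformations mapping each equation from the class
(with domain over the domain of the transformation) to an equation from the class. -/
def equivGroup (C : Set (Eqn n)) : Set (TotalTransf n) :=
  {Φ | ∀ θ ∈ C, θ.base ⊆ Φ.base.map.source →
    ∃ θ' ∈ C, Φ.MapsArb θ θ' ∧ Φ.base.MapsEqn θ θ'}

/-- A class is normalized if each of its admissible transformations is induced by an element of its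
equivalence group. -/
def IsNormalized (C : Set (Eqn n)) : Prop :=
  ∀ θ ∈ C, ∀ θ' ∈ C, ∀ φ : PointTransf n, φ.IsAdmissible θ θ' →
    ∃ Φ ∈ equivGroup C, Φ.base = φ ∧ Φ.MapsArb θ θ'

/-! ### Derivatives of functions of `(t, x, ψ, ψ*)` -/

/-- `∂_t` -/
def dt (f : VarSpace n → ℂ) (z : VarSpace n) : ℂ := fderiv ℝ f z ((1, 0), 0)

/-- `∂_a` -/
def dx (a : Fin n) (f : VarSpace n → ℂ) (z : VarSpace n) : ℂ :=
  fderiv ℝ f z ((0, Pi.single a 1), 0)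

/-- `∂_ψ` -/
def dpsi (f : VarSpace n → ℂ) (z : VarSpace n) : ℂ :=
  (fderiv ℝ f z (0, 1) - Complex.I * fderiv ℝ f z (0, Complex.I)) / 2

/-- `∂_{ψ*}` -/
def dpsiConj (f : VarSpace n → ℂ) (z : VarSpace n) : ℂ :=
  (fderiv ℝ f z (0, 1) + Complex.I * fderiv ℝ f z (0, Complex.I)) / 2

/-- The total derivative `D_a f = f_a + ψ_a f_ψ + ψ*_a f_{ψ*}`. -/
def totalDx (a : Fin n) (f : VarSpace n → ℂ) (j : JetSpace n) : ℂ :=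
  dx a f j.1 + j.2 a * dpsi f j.1 + conj (j.2 a) * dpsiConj f j.1

/-- The operator `Δ̂ = ∂_aa + 2 ψ_a ∂_{aψ} + 2 ψ*_a ∂_{aψ*} + ψ_a ψ_a ∂_{ψψ}
+ 2 ψ_a ψ*_a ∂_{ψψ*} + ψ*_a ψ*_a ∂_{ψ*ψ*}`. -/
def hatLaplacian (f : VarSpace n → ℂ) (j : JetSpace n) : ℂ :=
  ∑ a, (dx a (dx a f) j.1 + 2 * j.2 a * dx a (dpsi f) j.1
    + 2 * conj (j.2 a) * dx a (dpsiConj f) j.1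
    + j.2 a ^ 2 * dpsi (dpsi f) j.1
    + 2 * j.2 a * conj (j.2 a) * dpsi (dpsiConj f) j.1
    + conj (j.2 a) ^ 2 * dpsiConj (dpsiConj f) j.1)

namespace PointTransf

/-- The `t`-component. -/
def T (φ : PointTransf n) (z : VarSpace n) : ℂ := ((φ.map z).1.1 : ℝ)

/-- The `x_a`-component. -/
def X (φ : PointTransf n) (a : Fin n) (z : VarSpace n) : ℂ := ((φ.map z).1.2 a : ℝ)

/-- The `ψ`-component. -/
def Psi (φ : PointTransf n) (z : VarSpace n) : ℂ := (φ.map z).2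

/-- The equations `T_ψ = T_{ψ*} = 0`, `T_a = 0`, `X^a_ψ = X^a_{ψ*} = 0`, `X^b_a X^c_a = H δ_bc`
with `T_t ≠ 0` and a positive smooth real-valued `H` with `H_ψ = H_{ψ*} = 0`. -/
def ConformalEqs (φ : PointTransf n) (H : VarSpace n → ℝ) : Prop :=
  ContDiffOn ℝ ∞ H φ.map.source ∧
  ∀ z ∈ φ.map.source,
    0 < H z ∧ dpsi (fun w => (H w : ℂ)) z = 0 ∧ dpsiConj (fun w => (H w : ℂ)) z = 0 ∧
    dpsi φ.T z = 0 ∧ dpsiConj φ.T z = 0 ∧ (∀ a, dx a φ.T z = 0) ∧ dt φ.T z ≠ 0 ∧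
    (∀ a, dpsi (φ.X a) z = 0 ∧ dpsiConj (φ.X a) z = 0) ∧
    ∀ b c, ∑ a, dx a (φ.X b) z * dx a (φ.X c) z = if b = c then (H z : ℂ) else 0

/-- The equation `Ψ_ψ Ψ_{ψ*} = 0`. -/
def IsUnmixed (φ : PointTransf n) : Prop :=
  ∀ z ∈ φ.map.source, dpsi φ.Psi z * dpsiConj φ.Psi z = 0

end PointTransf

/-- At the point `e`, the `G`-component of `Φ` is `(H / T_t) G` if `Ψ_ψ ≠ 0` and
`(H / T_t) (-G*)` if `Ψ_{ψ*} ≠ 0`. -/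
def TotalTransf.GFormAt (Φ : TotalTransf n) (H : VarSpace n → ℝ) (e : TotalSpace n) : Prop :=
  (dpsi Φ.base.Psi e.1.1 ≠ 0 → (Φ.map e).2.1 = H e.1.1 / dt Φ.base.T e.1.1 * e.2.1) ∧
  (dpsiConj Φ.base.Psi e.1.1 ≠ 0 → (Φ.map e).2.1 = H e.1.1 / dt Φ.base.T e.1.1 * (-conj e.2.1))

/-- At the point `e`, the `F`-component of `Φ` is
`(Ψ_ψ / T_t) F - (Ψ_{ψ*} / T_t) F* - (Δ̂Ψ + (n - 2)/2 (H_a / H) D_aΨ) G̃ / H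
  - (i / T_t) (Ψ_t - X^b_t (X^b_a / H) D_aΨ)`, where `G̃` is the `G`-component. -/
def TotalTransf.FFormAt (Φ : TotalTransf n) (H : VarSpace n → ℝ) (e : TotalSpace n) : Prop :=
  (Φ.map e).2.2 =
    dpsi Φ.base.Psi e.1.1 / dt Φ.base.T e.1.1 * e.2.2
      - dpsiConj Φ.base.Psi e.1.1 / dt Φ.base.T e.1.1 * conj e.2.2
      - (hatLaplacian Φ.base.Psi e.1
          + ((n : ℂ) - 2) / 2 *
            ∑ a, dx a (fun w => (H w : ℂ)) e.1.1 / H e.1.1 * totalDx a Φ.base.Psi e.1)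
        * ((Φ.map e).2.1 / H e.1.1)
      - Complex.I / dt Φ.base.T e.1.1 *
        (dt Φ.base.Psi e.1.1
          - ∑ b, ∑ a, dt (Φ.base.X b) e.1.1 * (dx a (Φ.base.X b) e.1.1 / H e.1.1)
              * totalDx a Φ.base.Psi e.1)

end GenSchr

end

noncomputable section

namespace GenSchr

variable {n : ℕ}

/-! ### Second-order calculus and prescribed 2-jets -/

section Calculus
variable {E F G : Type*} [NormedAddCommGroup E] [NormedSpace ℝ E] [NormedAddCommGroup F]
  [NormedSpace ℝ F] [NormedAddCommGroup G] [NormedSpace ℝ G]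

/-! Everything rests on testing a mapping of equations on functions with a freely chosen 2-jet at
one point (quadratic polynomials), together with their images, which the inverse function theorem
provides wherever the new independent variables restrict to a local diffeomorphism along the graph.

Conformality. Take two test functions with the same 1-jet whose Hessians differ by the pullback of
`α ⊗ α - β ⊗ β`, where the covectors `α`, `β` have equal spatial length. Their images have the same
1-jet and the same Laplacian, so both images solve the target equation or neither does. As `G ≠ 0`,
the Laplacians of the originals must agree: equality of spatial lengths is preserved by pullback
(`sum_sq_graphDiff_eq`). This holds for generic, hence by continuity for all, admissible values of
`∇ψ`. Being quadratic in `∇ψ`, the identity splits: its second differences remove `ψ` from `T` and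
`X` (this needs `n ≥ 2`), and what is left says that `T` depends only on `t` and `X` is conformal in
`x` (`MapsEqn.exists_conformalAt`).

Arbitrary elements. For a conformal transformation the chain rule expresses the transformed
left-hand side through the old derivatives (`ConformalEqs.residual_eq`); the term with `(n - 2) / 2`
comes from the Laplacian of a conformal map. For an initial solution `ψ_t` is determined by the
Laplacian `S`, and `S` is free, so the coefficients of `S`, `S*` and 1 vanish separately. This gives
(B) and (C), collected in `ArbRel` (`MapsEqn.arbRel`). Conversely, (B) and (C) make the new
left-hand side the image of the old one under an injective real-linear map (`ConformalEqs.mapsEqn`).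

The dichotomy. If `Ψ_ψ` and `Ψ_{ψ*}` are both nonzero at a point, the two formulas for the new `G`
coincide only when `G = -G*`. Hence mixing is impossible in `𝒩₀`, whereas it imposes no restriction
in `𝒩̄₀`. The factor `H / T_t` is real, so the condition `G* = -G` is preserved and the subclasses
do not communicate. Equations with constant `G`, `F` have graphs through every relevant point of the
total space, which turns the relation for one equation into a formula for an equivalence
transformation; for `𝒩₀` the imaginary values of `G` are reached as limits. Finally, `𝒩` is not
normalized because `2ψ + ψ*` acts on `i ψ_t + i ψ_aa = 0`, although no mixing transformation belongs
to the equivalence group of `𝒩`. -/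

lemma _root_.ContDiffAt.eventually_differentiableAt {f : E → F} {x : E} (hf : ContDiffAt ℝ 2 f x) :
    ∀ᶠ y in 𝓝 x, DifferentiableAt ℝ f y := by
  filter_upwards [hf.eventually (by simp)] with y hy
  exact hy.differentiableAt (by simp)

lemma _root_.ContDiffAt.differentiableAt_fderiv {f : E → F} {x : E} (hf : ContDiffAt ℝ 2 f x) :
    DifferentiableAt ℝ (fderiv ℝ f) x :=
  (hf.fderiv_right (m := 1) (by norm_num)).differentiableAt (by simp)

lemma fderiv_fderiv_comp {g : F → G} {h : E → F} {x : E} (hg : ContDiffAt ℝ 2 g (h x))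
    (hh : ContDiffAt ℝ 2 h x) (u v : E) :
    fderiv ℝ (fderiv ℝ (g ∘ h)) x u v =
      fderiv ℝ (fderiv ℝ g) (h x) (fderiv ℝ h x u) (fderiv ℝ h x v)
        + fderiv ℝ g (h x) (fderiv ℝ (fderiv ℝ h) x u v) := by
  have hev : fderiv ℝ (g ∘ h) =ᶠ[𝓝 x] fun y => (fderiv ℝ g (h y)).comp (fderiv ℝ h y) := by
    filter_upwards [hh.eventually_differentiableAt,
      hh.continuousAt.eventually hg.eventually_differentiableAt] with y h1 h2
    exact fderiv_comp y h2 h1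
  have h1 : HasFDerivAt (fun y => fderiv ℝ g (h y))
      ((fderiv ℝ (fderiv ℝ g) (h x)).comp (fderiv ℝ h x)) x :=
    hg.differentiableAt_fderiv.hasFDerivAt.comp x
      (hh.differentiableAt (by simp)).hasFDerivAt
  have h2 := h1.clm_comp hh.differentiableAt_fderiv.hasFDerivAt
  rw [hev.fderiv_eq, h2.fderiv]
  simp [add_comm]

lemma fderiv_fderiv_clm_comp (A : F →L[ℝ] G) {h : E → F} {x : E}
    (hh : ContDiffAt ℝ 2 h x) (u v : E) :
    fderiv ℝ (fderiv ℝ (fun y => A (h y))) x u v = A (fderiv ℝ (fderiv ℝ h) x u v) := by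
  have hc : (fderiv ℝ fun y => A y) = fun _ => A := by
    funext y; exact A.fderiv
  have := fderiv_fderiv_comp (g := fun y => A y) (h := h) (x := x) A.contDiff.contDiffAt hh u v
  rw [hc] at this
  simpa [Function.comp_def] using this

lemma fderiv_clm_comp_apply (A : F →L[ℝ] G) {h : E → F} {x : E}
    (hh : DifferentiableAt ℝ h x) (u : E) :
    fderiv ℝ (fun y => A (h y)) x u = A (fderiv ℝ h x u) := by
  have := (A.hasFDerivAt.comp x hh.hasFDerivAt).fderiv
  simp only [Function.comp_def] at this
  rw [this]; rfl

lemma fderiv_fderiv_apply {f : E → F} {x : E} (hf : ContDiffAt ℝ 2 f x) (u v : E) :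
    fderiv ℝ (fun y => fderiv ℝ f y v) x u = fderiv ℝ (fderiv ℝ f) x u v := by
  have := (hf.differentiableAt_fderiv.hasFDerivAt.clm_apply (hasFDerivAt_const v x)).fderiv
  rw [this]; simp

lemma fderiv_fderiv_symm {f : E → F} {x : E} (hf : ContDiffAt ℝ 2 f x) (u v : E) :
    fderiv ℝ (fderiv ℝ f) x u v = fderiv ℝ (fderiv ℝ f) x v u :=
  (hf.isSymmSndFDerivAt (by simp)) u v

/-- The quadratic polynomial with a prescribed `2`-jet at `q`. -/
def quadratic (c : F) (l : E →L[ℝ] F) (B : E →L[ℝ] E →L[ℝ] F) (q r : E) : F :=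
  c + l (r - q) + (1 / 2 : ℝ) • B (r - q) (r - q)

variable (c : F) (l : E →L[ℝ] F) (B : E →L[ℝ] E →L[ℝ] F) (q : E)

lemma quadratic_self : quadratic c l B q q = c := by simp [quadratic]

lemma contDiff_quadratic {m : WithTop ℕ∞} : ContDiff ℝ m (quadratic c l B q) := by
  have h0 : ContDiff ℝ m fun r : E => r - q := contDiff_id.sub contDiff_const
  exact (contDiff_const.add (l.contDiff.comp h0)).add
    (((B.contDiff.comp h0).clm_apply h0).const_smul _)

lemma fderiv_quadratic (hB : ∀ u v, B u v = B v u) :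
    fderiv ℝ (quadratic c l B q) = fun r => l + B (r - q) := by
  funext r
  have h0 : HasFDerivAt (fun r : E => r - q) (ContinuousLinearMap.id ℝ E) r :=
    (hasFDerivAt_id r).sub_const q
  have h1 := (B.hasFDerivAt.comp r h0).clm_apply h0
  have h2 := ((l.hasFDerivAt.comp r h0).const_add c).add (h1.const_smul (1 / 2 : ℝ))
  have h3 : fderiv ℝ (quadratic c l B q) r = _ := h2.fderiv
  rw [h3]
  ext v
  have h4 : B v (r - q) = B (r - q) v := hB _ _
  simp only [add_apply, smul_apply,
    ContinuousLinearMap.comp_apply, ContinuousLinearMap.flip_apply, ContinuousLinearMap.id_apply,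
    Function.comp_apply, h4]
  rw [← two_smul ℝ (B (r - q) v), smul_smul]
  norm_num

lemma fderiv_quadratic_self (hB : ∀ u v, B u v = B v u) :
    fderiv ℝ (quadratic c l B q) q = l := by
  rw [fderiv_quadratic c l B q hB]; simp

lemma fderiv_fderiv_quadratic (hB : ∀ u v, B u v = B v u) :
    fderiv ℝ (fderiv ℝ (quadratic c l B q)) q = B := by
  rw [fderiv_quadratic c l B q hB]
  have h0 : HasFDerivAt (fun r : E => r - q) (ContinuousLinearMap.id ℝ E) q :=
    (hasFDerivAt_id q).sub_const q
  have := ((B.hasFDerivAt.comp q h0).const_add l).fderiv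
  simp only [Function.comp_def] at this
  rw [this]; ext; simp

end Calculus

/-- Injectivity of generic perturbations: if `A` and `C` together span the target, a perturbation of
`A` by a multiple of a suitable map factoring through `C` is bijective. -/
lemma exists_perturbation_bijective {E V : Type*} [AddCommGroup E] [Module ℝ E]
    [FiniteDimensional ℝ E] [AddCommGroup V] [Module ℝ V] (A : E →ₗ[ℝ] E) (C : V →ₗ[ℝ] E)
    (h : LinearMap.range A ⊔ LinearMap.range C = ⊤) :
    ∃ l : E →ₗ[ℝ] V, ∀ ε : ℝ, ε ≠ 0 → Function.Bijective (A + ε • (C ∘ₗ l)) := by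
  -- A complement of the range of `A` can be chosen inside the range of `C`, by modularity. Its
  -- dimension is that of `ker A`, so the perturbation can send `ker A` isomorphically onto it.
  obtain ⟨Q, hQC, hQ⟩ : ∃ Q ≤ LinearMap.range C, IsCompl (LinearMap.range A) Q := by
    obtain ⟨Q, h1, h2⟩ := IsModularLattice.exists_disjoint_and_sup_eq
      (inf_le_right : LinearMap.range A ⊓ LinearMap.range C ≤ LinearMap.range C)
    have hQC : Q ≤ LinearMap.range C := h2 ▸ le_sup_right
    refine ⟨Q, hQC, disjoint_iff.2 ?_, codisjoint_iff.2 ?_⟩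
    · rw [← disjoint_iff.1 h1, inf_assoc, inf_eq_right.2 hQC]
    · rw [← h, ← h2, ← sup_assoc, sup_inf_self]
  have hfin : Module.finrank ℝ (LinearMap.ker A) = Module.finrank ℝ Q := by
    have h1 := LinearMap.finrank_range_add_finrank_ker A
    have h2 := Submodule.finrank_add_eq_of_isCompl hQ
    omega
  let e : LinearMap.ker A ≃ₗ[ℝ] Q := LinearEquiv.ofFinrankEq _ _ hfin
  obtain ⟨π, hπ⟩ := (LinearMap.ker A).subtype.exists_leftInverse_of_injective (by simp)
  obtain ⟨s, hs⟩ := C.rangeRestrict.exists_rightInverse_of_surjective (by simp)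
  have hs' : ∀ y, C (s y) = y := fun y => congrArg Subtype.val (LinearMap.congr_fun hs y)
  refine ⟨s ∘ₗ Submodule.inclusion hQC ∘ₗ e.toLinearMap ∘ₗ π, fun ε hε => ?_⟩
  set B := A + ε • (C ∘ₗ s ∘ₗ Submodule.inclusion hQC ∘ₗ e.toLinearMap ∘ₗ π) with hB
  have hBv : ∀ v, B v = A v + ε • (e (π v) : E) := by
    intro v; simp [hB, hs']
  have hinj : Function.Injective B := by
    rw [injective_iff_map_eq_zero]
    intro v hv
    rw [hBv] at hv
    have h1 : A v ∈ Q := by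
      rw [eq_neg_of_add_eq_zero_left hv]
      exact Q.neg_mem (Q.smul_mem _ (e (π v)).2)
    have h2 : A v = 0 := Submodule.disjoint_def.1 hQ.disjoint _ ⟨v, rfl⟩ h1
    rw [h2, zero_add, smul_eq_zero, or_iff_right hε] at hv
    have h3 : π v = 0 := by simpa using hv
    have h4 : π v = ⟨v, h2⟩ := LinearMap.congr_fun hπ ⟨v, h2⟩
    rw [h4] at h3
    exact congrArg Subtype.val h3
  exact ⟨hinj, LinearMap.injective_iff_surjective.1 hinj⟩

/-- The direction of the coordinate `t`. -/
def timeVec : IndepVar n := (1, 0)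

/-- The direction of the coordinate `x_a`. -/
def spaceVec (a : Fin n) : IndepVar n := (0, Pi.single a 1)

lemma sum_spaceVec (v : IndepVar n) :
    v = v.1 • timeVec + ∑ a, v.2 a • spaceVec a := by
  ext a
  · simp [timeVec, spaceVec, Prod.fst_sum]
  · simp [timeVec, spaceVec, Prod.snd_sum, Finset.sum_apply, Pi.single_apply]

lemma spaceDeriv_spaceDeriv {f : IndepVar n → ℂ} {q : IndepVar n} (hf : ContDiffAt ℝ 2 f q)
    (a : Fin n) :
    spaceDeriv a (spaceDeriv a f) q = fderiv ℝ (fderiv ℝ f) q (spaceVec a) (spaceVec a) :=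
  fderiv_fderiv_apply hf _ _

/-! ### Wirtinger derivatives -/

lemma fderiv_vertical (f : VarSpace n → ℂ) (z : VarSpace n) (w : ℂ) :
    fderiv ℝ f z (0, w) = dpsi f z * w + dpsiConj f z * conj w := by
  have h : ((0, w) : VarSpace n) = w.re • (0, 1) + w.im • (0, Complex.I) := by
    ext <;> simp
  rw [h, map_add, map_smul, map_smul, dpsi, dpsiConj]
  conv_rhs => rw [← Complex.re_add_im w]
  simp only [Complex.real_smul, map_add, map_mul, Complex.conj_ofReal, Complex.conj_I]
  linear_combination ((w.im : ℂ) * fderiv ℝ f z (0, Complex.I)) * Complex.I_sq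

lemma dpsi_eq_zero_and_dpsiConj_eq_zero_iff {f : VarSpace n → ℂ} {z : VarSpace n} :
    (dpsi f z = 0 ∧ dpsiConj f z = 0) ↔ ∀ w, fderiv ℝ f z (0, w) = 0 := by
  constructor
  · rintro ⟨h1, h2⟩ w
    simp [fderiv_vertical, h1, h2]
  · intro h
    simp [dpsi, dpsiConj, h]

lemma totalDx_eq (a : Fin n) (f : VarSpace n → ℂ) (j : JetSpace n) :
    totalDx a f j = fderiv ℝ f j.1 (spaceVec a, j.2 a) := by
  have h : ((spaceVec a, j.2 a) : VarSpace n) = (spaceVec a, 0) + (0, j.2 a) := by simp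
  rw [h, map_add, fderiv_vertical, totalDx, dx, spaceVec]
  ring

section
variable {f : VarSpace n → ℂ} {z : VarSpace n}

lemma fderiv_dx (hf : ContDiffAt ℝ 2 f z) (a : Fin n) (u : VarSpace n) :
    fderiv ℝ (dx a f) z u = fderiv ℝ (fderiv ℝ f) z u (spaceVec a, 0) :=
  fderiv_fderiv_apply hf _ _

lemma fderiv_dpsi (hf : ContDiffAt ℝ 2 f z) (u : VarSpace n) :
    fderiv ℝ (dpsi f) z u =
      (fderiv ℝ (fderiv ℝ f) z u (0, 1) - Complex.I * fderiv ℝ (fderiv ℝ f) z u (0, Complex.I))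
        / 2 := by
  have h := hf.differentiableAt_fderiv.hasFDerivAt
  have h1 := h.clm_apply (hasFDerivAt_const ((0, 1) : VarSpace n) z)
  have h2 := h.clm_apply (hasFDerivAt_const ((0, Complex.I) : VarSpace n) z)
  have h3 := (h1.sub (h2.const_mul Complex.I)).mul_const (2⁻¹ : ℂ)
  have h4 : fderiv ℝ (dpsi f) z = _ := h3.fderiv
  rw [h4]; simp; ring

lemma fderiv_dpsiConj (hf : ContDiffAt ℝ 2 f z) (u : VarSpace n) :
    fderiv ℝ (dpsiConj f) z u =
      (fderiv ℝ (fderiv ℝ f) z u (0, 1) + Complex.I * fderiv ℝ (fderiv ℝ f) z u (0, Complex.I))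
        / 2 := by
  have h := hf.differentiableAt_fderiv.hasFDerivAt
  have h1 := h.clm_apply (hasFDerivAt_const ((0, 1) : VarSpace n) z)
  have h2 := h.clm_apply (hasFDerivAt_const ((0, Complex.I) : VarSpace n) z)
  have h3 := (h1.add (h2.const_mul Complex.I)).mul_const (2⁻¹ : ℂ)
  have h4 : fderiv ℝ (dpsiConj f) z = _ := h3.fderiv
  rw [h4]; simp; ring

/-- The operator is the sum of the pure second derivatives along the lifted directions `(e_a, ψ_a)`:
splitting `ψ_a` into real and imaginary parts and using symmetry of the Hessian turns these into
Wirtinger derivatives. -/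
lemma hatLaplacian_eq (hf : ContDiffAt ℝ 2 f z) (p : Fin n → ℂ) :
    hatLaplacian f (z, p) =
      ∑ a, fderiv ℝ (fderiv ℝ f) z (spaceVec a, p a) (spaceVec a, p a) := by
  refine Finset.sum_congr rfl fun a _ => ?_
  have hx : ∀ g : VarSpace n → ℂ, dx a g z = fderiv ℝ g z (spaceVec a, 0) := fun g => rfl
  have h : ((spaceVec a, p a) : VarSpace n) =
      (spaceVec a, 0) + ((p a).re • (0, 1) + (p a).im • (0, Complex.I)) := by
    ext <;> simp
  have s1 := fderiv_fderiv_symm hf (spaceVec a, 0) (0, 1)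
  have s2 := fderiv_fderiv_symm hf (spaceVec a, 0) (0, Complex.I)
  have s3 := fderiv_fderiv_symm hf (0, Complex.I) (0, 1)
  rw [h]
  simp only [hx, fderiv_dx hf, fderiv_dpsi hf, fderiv_dpsiConj hf, dpsi, dpsiConj, map_add,
    map_smul, add_apply, smul_apply, Complex.real_smul, s1, s2, s3]
  conv_lhs => rw [← Complex.re_add_im (p a)]
  simp only [map_add, map_mul, Complex.conj_ofReal, Complex.conj_I]
  ring_nf
  simp only [Complex.I_sq, Complex.I_pow_four]
  ring

end

/-! ### Jets of transformed functions -/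

namespace PointTransf
variable (φ : PointTransf n)

lemma contDiffAt {z : VarSpace n} (hz : z ∈ φ.map.source) {m : ℕ∞} : ContDiffAt ℝ m φ.map z :=
  (φ.smooth.contDiffAt (φ.map.open_source.mem_nhds hz)).of_le (by exact_mod_cast le_top)

lemma contDiffAt_two {z : VarSpace n} (hz : z ∈ φ.map.source) : ContDiffAt ℝ 2 φ.map z :=
  φ.contDiffAt (m := 2) hz

lemma differentiableAt {z : VarSpace n} (hz : z ∈ φ.map.source) : DifferentiableAt ℝ φ.map z :=
  (φ.contDiffAt_two hz).differentiableAt (by simp)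

lemma fderiv_bijective {z : VarSpace n} (hz : z ∈ φ.map.source) :
    Function.Bijective (fderiv ℝ φ.map z) := by
  have hz' := φ.map.map_source hz
  have hs : DifferentiableAt ℝ φ.map.symm (φ.map z) :=
    ((φ.smooth_symm.contDiffAt (φ.map.open_target.mem_nhds hz')).differentiableAt (by simp))
  have h1 : HasFDerivAt (φ.map.symm ∘ φ.map) _ z :=
    hs.hasFDerivAt.comp z (φ.differentiableAt hz).hasFDerivAt
  have h1' : HasFDerivAt (φ.map.symm ∘ φ.map) (ContinuousLinearMap.id ℝ _) z :=
    (hasFDerivAt_id z).congr_of_eventuallyEq <| by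
      filter_upwards [φ.map.open_source.mem_nhds hz] with y hy using φ.map.left_inv hy
  have e1 := h1.unique h1'
  have hinj : Function.Injective (fderiv ℝ φ.map z) :=
    Function.LeftInverse.injective (g := fderiv ℝ φ.map.symm (φ.map z))
      fun v => DFunLike.congr_fun e1 v
  exact ⟨hinj, LinearMap.injective_iff_surjective (f := (fderiv ℝ φ.map z).toLinearMap).1 hinj⟩

variable {φ} {f f' : IndepVar n → ℂ} {q q' : IndepVar n}

lemma _root_.ContDiffAt.two {E F : Type*} [NormedAddCommGroup E] [NormedSpace ℝ E]
    [NormedAddCommGroup F] [NormedSpace ℝ F] {f : E → F} {q : E} (h : ContDiffAt ℝ ∞ f q) :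
    ContDiffAt ℝ 2 f q := contDiffAt_infty.1 h 2

lemma fderiv_graph {f : IndepVar n → ℂ} {q : IndepVar n} (hf : DifferentiableAt ℝ f q)
    (v : IndepVar n) : fderiv ℝ (fun r => (r, f r)) q v = (v, fderiv ℝ f q v) := by
  have := ((hasFDerivAt_id q).prodMk hf.hasFDerivAt).fderiv
  simp only [id] at this
  rw [this]; rfl

lemma contDiffAt_graph {f : IndepVar n → ℂ} {q : IndepVar n} {m : WithTop ℕ∞}
    (hf : ContDiffAt ℝ m f q) : ContDiffAt ℝ m (fun r => (r, f r)) q :=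
  contDiffAt_id.prodMk hf

lemma fderiv_fderiv_graph {f : IndepVar n → ℂ} {q : IndepVar n} (hf : ContDiffAt ℝ 2 f q)
    (u v : IndepVar n) : fderiv ℝ (fderiv ℝ (fun r => (r, f r))) q u v =
      (0, fderiv ℝ (fderiv ℝ f) q u v) := by
  have h := contDiffAt_graph hf
  ext1
  · have h1 := fderiv_fderiv_clm_comp (ContinuousLinearMap.fst ℝ (IndepVar n) ℂ) h u v
    have hc : fderiv ℝ (fun r : IndepVar n => r) = fun _ => ContinuousLinearMap.id ℝ _ := by
      funext y; exact fderiv_fun_id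
    simp only [ContinuousLinearMap.coe_fst', hc] at h1
    rw [← h1]; simp
  · exact (fderiv_fderiv_clm_comp (ContinuousLinearMap.snd ℝ (IndepVar n) ℂ) h u v).symm

lemma contDiffAt_map_graph {m : ℕ∞} (hf : ContDiffAt ℝ m f q) (hq : (q, f q) ∈ φ.map.source) :
    ContDiffAt ℝ m (fun r => φ.map (r, f r)) q :=
  ContDiffAt.comp q (φ.contDiffAt hq) (contDiffAt_graph hf)

lemma fderiv_map_graph (hf : DifferentiableAt ℝ f q) (hq : (q, f q) ∈ φ.map.source)
    (v : IndepVar n) : fderiv ℝ (fun r => φ.map (r, f r)) q v =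
      fderiv ℝ φ.map (q, f q) (v, fderiv ℝ f q v) := by
  have hd : DifferentiableAt ℝ (fun r => (r, f r)) q := differentiableAt_id.prodMk hf
  have h := fderiv_comp q (g := φ.map) (φ.differentiableAt hq) hd
  simp only [Function.comp_def] at h
  rw [h, ContinuousLinearMap.comp_apply, fderiv_graph hf]

lemma fderiv_fderiv_map_graph (hf : ContDiffAt ℝ 2 f q) (hq : (q, f q) ∈ φ.map.source)
    (u v : IndepVar n) : fderiv ℝ (fderiv ℝ (fun r => φ.map (r, f r))) q u v =
      fderiv ℝ (fderiv ℝ φ.map) (q, f q) (u, fderiv ℝ f q u) (v, fderiv ℝ f q v)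
        + fderiv ℝ φ.map (q, f q) (0, fderiv ℝ (fderiv ℝ f) q u v) := by
  have h := fderiv_fderiv_comp (g := φ.map) (h := fun r => (r, f r)) (x := q)
    (φ.contDiffAt_two hq) (contDiffAt_graph hf) u v
  have hd := hf.differentiableAt (by simp)
  rw [fderiv_graph hd, fderiv_graph hd, fderiv_fderiv_graph hf] at h
  exact h

/-- The first-order relation between a function and its image. -/
lemma MapsGerm.fderiv_eq (h : φ.MapsGerm f q f' q') (v : IndepVar n) :
    (fderiv ℝ φ.map (q, f q) (v, fderiv ℝ f q v)).2 =
      fderiv ℝ f' q' (fderiv ℝ φ.map (q, f q) (v, fderiv ℝ f q v)).1 := by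
  obtain ⟨hf, hf', hq, he, hev⟩ := h
  have hP := (contDiffAt_map_graph (m := 2) hf.two hq).differentiableAt (by simp)
  have h1 := fderiv_clm_comp_apply (ContinuousLinearMap.snd ℝ (IndepVar n) ℂ) hP v
  have h2 := fderiv_clm_comp_apply (ContinuousLinearMap.fst ℝ (IndepVar n) ℂ) hP v
  simp only [ContinuousLinearMap.coe_fst', ContinuousLinearMap.coe_snd'] at h1 h2
  rw [← fderiv_map_graph (hf.two.differentiableAt (by simp)) hq, ← h1, ← h2,
    EventuallyEq.fderiv_eq hev]
  have hY : (φ.map (q, f q)).1 = q' := by simp [he]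
  have h3 := fderiv_comp q (g := f') (f := fun r => (φ.map (r, f r)).1)
    (by rw [hY]; exact hf'.two.differentiableAt (by simp)) hP.fst
  simp only [Function.comp_def, hY] at h3
  rw [h3]
  rfl

/-- The second-order relation between a function and its image. -/
lemma MapsGerm.fderiv_fderiv_eq (h : φ.MapsGerm f q f' q') (u v : IndepVar n) :
    (fderiv ℝ (fderiv ℝ φ.map) (q, f q) (u, fderiv ℝ f q u) (v, fderiv ℝ f q v)
        + fderiv ℝ φ.map (q, f q) (0, fderiv ℝ (fderiv ℝ f) q u v)).2 =
      fderiv ℝ (fderiv ℝ f') q' (fderiv ℝ φ.map (q, f q) (u, fderiv ℝ f q u)).1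
          (fderiv ℝ φ.map (q, f q) (v, fderiv ℝ f q v)).1
        + fderiv ℝ f' q' (fderiv ℝ (fderiv ℝ φ.map) (q, f q) (u, fderiv ℝ f q u)
            (v, fderiv ℝ f q v) + fderiv ℝ φ.map (q, f q) (0, fderiv ℝ (fderiv ℝ f) q u v)).1 := by
  obtain ⟨hf, hf', hq, he, hev⟩ := h
  have hP2 := contDiffAt_map_graph (m := 2) hf.two hq
  have hP := hP2.differentiableAt (by simp)
  have h1 := fderiv_fderiv_clm_comp (ContinuousLinearMap.snd ℝ (IndepVar n) ℂ) hP2 u v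
  have h2 := fderiv_fderiv_clm_comp (ContinuousLinearMap.fst ℝ (IndepVar n) ℂ) hP2 u v
  have h4 := fderiv_clm_comp_apply (ContinuousLinearMap.fst ℝ (IndepVar n) ℂ) hP
  simp only [ContinuousLinearMap.coe_fst', ContinuousLinearMap.coe_snd'] at h1 h2 h4
  have hd := hf.two.differentiableAt (by simp)
  rw [← fderiv_fderiv_map_graph hf.two hq, ← fderiv_map_graph hd hq, ← fderiv_map_graph hd hq,
    ← h1, ← h2, ← h4, ← h4, (EventuallyEq.fderiv hev).fderiv_eq]
  have hY : (φ.map (q, f q)).1 = q' := by simp [he]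
  have h3 := fderiv_fderiv_comp (g := f') (h := fun r => (φ.map (r, f r)).1) (x := q)
    (by rw [hY]; exact hf'.two) hP2.fst u v
  simp only [hY] at h3
  exact h3

/-- A function is transformed locally if the independent variables along its graph are. -/
lemma exists_mapsGerm (hf : ContDiffAt ℝ ∞ f q) (hq : (q, f q) ∈ φ.map.source)
    (hL : Function.Injective fun v => (fderiv ℝ φ.map (q, f q) (v, fderiv ℝ f q v)).1) :
    ∃ f', φ.MapsGerm f q f' (φ.map (q, f q)).1 := by
  have hP : ContDiffAt ℝ ∞ (fun r => φ.map (r, f r)) q := contDiffAt_map_graph hf hq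
  have hY := hP.fst
  have hPd := hP.differentiableAt (by simp)
  have hYd := hPd.fst.hasFDerivAt
  have h4 := fderiv_clm_comp_apply (ContinuousLinearMap.fst ℝ (IndepVar n) ℂ) hPd
  simp only [ContinuousLinearMap.coe_fst'] at h4
  set A := fderiv ℝ (fun r => (φ.map (r, f r)).1) q with hA
  have hAi : Function.Injective A := by
    convert hL using 1
    funext v
    rw [h4, fderiv_map_graph (hf.differentiableAt (by simp)) hq]
  let e : IndepVar n ≃L[ℝ] IndepVar n :=
    (LinearEquiv.ofInjectiveEndo A.toLinearMap hAi).toContinuousLinearEquiv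
  have he : HasFDerivAt (fun r => (φ.map (r, f r)).1) (e : IndepVar n →L[ℝ] IndepVar n) q := by
    have heA : (e : IndepVar n →L[ℝ] IndepVar n) = A :=
      ContinuousLinearMap.ext fun _ => rfl
    rw [heA]; exact hYd
  set g := hY.localInverse he (by simp) with hg
  have hgq : g (φ.map (q, f q)).1 = q := hY.localInverse_apply_image he (by simp)
  have hgs : ContDiffAt ℝ ∞ g (φ.map (q, f q)).1 := hY.to_localInverse he (by simp)
  have hinv : ∀ᶠ r in 𝓝 q, g (φ.map (r, f r)).1 = r :=
    (hY.hasStrictFDerivAt' he (by simp)).eventually_left_inverse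
  -- With `g` a local inverse of the new independent variables along the graph, the image function
  -- is the new `ψ` read off along that graph.
  refine ⟨fun r' => (φ.map (g r', f (g r'))).2, hf, ?_, hq, ?_, ?_⟩
  · exact ContDiffAt.comp (g := fun r => (φ.map (r, f r)).2) _ (by rw [hgq]; exact hP.snd) hgs
  · simp [hgq]
  · filter_upwards [hinv] with r hr
    simp [hr]

end PointTransf

/-! ### Test functions with prescribed first derivatives and Laplacian -/

lemma Eqn.solvedAt_iff {θ : Eqn n} {f : IndepVar n → ℂ} {q : IndepVar n}
    (hf : ContDiffAt ℝ 2 f q) :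
    θ.SolvedAt f q ↔ jet f q ∈ θ.dom ∧ Complex.I * fderiv ℝ f q timeVec
      + θ.G (jet f q) * ∑ a, fderiv ℝ (fderiv ℝ f) q (spaceVec a) (spaceVec a)
      + θ.F (jet f q) = 0 := by
  simp only [Eqn.SolvedAt, spaceDeriv_spaceDeriv hf]
  rfl

lemma jet_eq {f : IndepVar n → ℂ} {q : IndepVar n} :
    jet f q = ((q, f q), fun a => fderiv ℝ f q (spaceVec a)) := rfl

lemma jet_quadratic (c : ℂ) (l : IndepVar n →L[ℝ] ℂ) (B : IndepVar n →L[ℝ] IndepVar n →L[ℝ] ℂ)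
    (q : IndepVar n) (hB : ∀ u v, B u v = B v u) :
    jet (quadratic c l B q) q = ((q, c), fun a => l (spaceVec a)) := by
  rw [jet_eq, quadratic_self, fderiv_quadratic_self c l B q hB]

/-- The quadratic form `u ↦ (l u)² c`. -/
def sqForm (l : IndepVar n →L[ℝ] ℝ) (c : ℂ) : IndepVar n →L[ℝ] IndepVar n →L[ℝ] ℂ :=
  l.smulRight (l.smulRight c)

lemma sqForm_apply (l : IndepVar n →L[ℝ] ℝ) (c : ℂ) (u v : IndepVar n) :
    sqForm l c u v = (l u * l v) • c := by
  simp [sqForm, mul_assoc]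

/-- The coordinate `x_a` as a linear functional. -/
def spaceCoord (a : Fin n) : IndepVar n →L[ℝ] ℝ :=
  (ContinuousLinearMap.proj a).comp (ContinuousLinearMap.snd ℝ ℝ (Fin n → ℝ))

lemma spaceCoord_apply (a : Fin n) (v : IndepVar n) : spaceCoord a v = v.2 a := rfl

/-- The functional on `(t, x)` with given values on the coordinate directions. -/
def linearOfValues (τ : ℂ) (p : Fin n → ℂ) : IndepVar n →L[ℝ] ℂ :=
  (ContinuousLinearMap.fst ℝ ℝ (Fin n → ℝ)).smulRight τ + ∑ a, (spaceCoord a).smulRight (p a)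

lemma linearOfValues_timeVec (τ : ℂ) (p : Fin n → ℂ) : linearOfValues τ p timeVec = τ := by
  simp [linearOfValues, timeVec, spaceCoord_apply, sum_apply]

lemma linearOfValues_spaceVec (τ : ℂ) (p : Fin n → ℂ) (a : Fin n) :
    linearOfValues τ p (spaceVec a) = p a := by
  simp [linearOfValues, spaceVec, spaceCoord_apply, sum_apply, Pi.single_apply]

/-- The quadratic form with given Laplacian. -/
def formOfTrace (a : Fin n) (c : ℂ) : IndepVar n →L[ℝ] IndepVar n →L[ℝ] ℂ :=
  sqForm (spaceCoord a) c

lemma sum_formOfTrace (a : Fin n) (c : ℂ) :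
    ∑ b, formOfTrace a c (spaceVec b) (spaceVec b) = c := by
  simp only [formOfTrace, sqForm_apply, spaceCoord_apply, spaceVec]
  rw [Finset.sum_eq_single a]
  · simp
  · intro b _ hb
    simp [hb.symm]
  · simp

/-! ### Invariance of the second-order part of the equation -/

namespace PointTransf
variable {φ : PointTransf n} {θ θ' : Eqn n}

/-- The differential of the new independent variables along a graph with tangent map `l`. -/
def graphDiff (φ : PointTransf n) (z : VarSpace n) (l : IndepVar n →L[ℝ] ℂ) :
    IndepVar n →L[ℝ] IndepVar n :=
  (ContinuousLinearMap.fst ℝ (IndepVar n) ℂ).comp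
    ((fderiv ℝ φ.map z).comp ((ContinuousLinearMap.id ℝ _).prod l))

lemma graphDiff_apply (z : VarSpace n) (l : IndepVar n →L[ℝ] ℂ) (v : IndepVar n) :
    φ.graphDiff z l v = (fderiv ℝ φ.map z (v, l v)).1 := rfl

/-- The only second-order information an equation sees is the Laplacian. A change of the image
Hessian by the traceless form `(α ⊗ α - β ⊗ β) m` is therefore invisible to the target equation, so
the corresponding change of the original Hessian must also be traceless. -/
lemma sum_sq_graphDiff_eq (h : φ.MapsEqn θ θ') (a₀ : Fin n) {z : VarSpace n}
    {l : IndepVar n →L[ℝ] ℂ} (hj : (z, fun a => l (spaceVec a)) ∈ θ.dom)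
    (hG : θ.G (z, fun a => l (spaceVec a)) ≠ 0)
    (hL : Function.Injective (φ.graphDiff z l)) (α β : IndepVar n →L[ℝ] ℝ)
    (hαβ : ∑ a, α (spaceVec a) ^ 2 = ∑ a, β (spaceVec a) ^ 2) :
    ∑ a, α (φ.graphDiff z l (spaceVec a)) ^ 2 = ∑ a, β (φ.graphDiff z l (spaceVec a)) ^ 2 := by
  obtain ⟨q, c⟩ := z
  have hz : (q, c) ∈ θ.base := ⟨_, hj, rfl⟩
  have hs := h.1 hz
  set L := φ.graphDiff (q, c) l with hLdef
  -- The value of the Laplacian for which the chosen 1-jet satisfies `θ`; dividing by `G` is where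
  -- its nonvanishing is first used.
  set S : ℂ := -(Complex.I * l timeVec + θ.F ((q, c), fun a => l (spaceVec a)))
    / θ.G ((q, c), fun a => l (spaceVec a)) with hS
  set B₀ := formOfTrace a₀ S with hB₀
  set B₁ := B₀ + (sqForm (α.comp L) 1 - sqForm (β.comp L) 1) with hB₁
  have hsymm₀ : ∀ u v, B₀ u v = B₀ v u := by
    intro u v; simp [hB₀, formOfTrace, sqForm_apply, mul_comm]
  have hsymm₁ : ∀ u v, B₁ u v = B₁ v u := by
    intro u v
    rw [hB₁, add_apply, add_apply, add_apply, add_apply, hsymm₀]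
    simp [sqForm_apply, mul_comm]
  have key : ∀ B : IndepVar n →L[ℝ] IndepVar n →L[ℝ] ℂ, (∀ u v, B u v = B v u) →
      ∃ f', φ.MapsGerm (quadratic c l B q) q f' (φ.map (q, c)).1 := by
    intro B hB
    have := exists_mapsGerm (φ := φ) (f := quadratic c l B q) (q := q)
      (contDiff_quadratic c l B q).contDiffAt (by rwa [quadratic_self])
      (by rw [fderiv_quadratic_self c l B q hB, quadratic_self]; exact hL)
    rwa [quadratic_self] at this
  obtain ⟨f₀, h₀⟩ := key B₀ hsymm₀
  obtain ⟨f₁, h₁⟩ := key B₁ hsymm₁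
  have hsurj : Function.Surjective L :=
    LinearMap.injective_iff_surjective (f := L.toLinearMap).1 hL
  have val : ∀ {B : IndepVar n →L[ℝ] IndepVar n →L[ℝ] ℂ} {f'},
      φ.MapsGerm (quadratic c l B q) q f' (φ.map (q, c)).1 →
      f' (φ.map (q, c)).1 = (φ.map (q, c)).2 := by
    intro B f' hm
    have := hm.2.2.2.1
    rw [quadratic_self] at this
    exact (congrArg Prod.snd this).symm
  have d1₀ := h₀.fderiv_eq
  have d1₁ := h₁.fderiv_eq
  have d2₀ := h₀.fderiv_fderiv_eq
  have d2₁ := h₁.fderiv_fderiv_eq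
  rw [fderiv_quadratic_self c l _ q hsymm₀, quadratic_self] at d1₀ d2₀
  rw [fderiv_quadratic_self c l _ q hsymm₁, quadratic_self] at d1₁ d2₁
  rw [fderiv_fderiv_quadratic c l _ q hsymm₀] at d2₀
  rw [fderiv_fderiv_quadratic c l _ q hsymm₁] at d2₁
  have hfd : fderiv ℝ f₁ (φ.map (q, c)).1 = fderiv ℝ f₀ (φ.map (q, c)).1 := by
    refine ContinuousLinearMap.ext fun w => ?_
    obtain ⟨v, rfl⟩ := hsurj w
    exact (d1₁ v).symm.trans (d1₀ v)
  set D := fderiv ℝ φ.map (q, c) with hD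
  -- `m` measures how a real change of the second derivative of `f` is seen by the image: the change
  -- of the new `ψ`, corrected for the induced shift of the new independent variables.
  set m : ℂ := (D (0, 1)).2 - fderiv ℝ f₀ (φ.map (q, c)).1 (D (0, 1)).1 with hm
  have hfdd : ∀ u v, fderiv ℝ (fderiv ℝ f₁) (φ.map (q, c)).1 u v =
      fderiv ℝ (fderiv ℝ f₀) (φ.map (q, c)).1 u v + (α u * α v - β u * β v) • m := by
    intro u v
    obtain ⟨u, rfl⟩ := hsurj u
    obtain ⟨v, rfl⟩ := hsurj v
    have e0 := d2₀ u v
    have e1 := d2₁ u v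
    rw [hfd] at e1
    have hB : B₁ u v = B₀ u v + (α (L u) * α (L v) - β (L u) * β (L v)) • (1 : ℂ) := by
      simp [hB₁, sqForm_apply, sub_smul]
    have hv : ((0, B₁ u v) : VarSpace n) = (0, B₀ u v)
        + (α (L u) * α (L v) - β (L u) * β (L v)) • (0, (1 : ℂ)) := by
      rw [hB]; ext <;> simp
    rw [hv, map_add, map_smul] at e1
    simp only [Prod.snd_add, Prod.fst_add, map_add, Prod.smul_fst, Prod.smul_snd, map_smul]
      at e0 e1
    rw [hm, smul_sub]
    simp only [hLdef, graphDiff_apply, ← hD] at e0 e1 ⊢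
    linear_combination e0 - e1
  have hjet' : jet f₁ (φ.map (q, c)).1 = jet f₀ (φ.map (q, c)).1 := by
    rw [jet_eq, jet_eq, val h₀, val h₁, hfd]
  have i₀ := h.2.2 _ _ _ _ h₀ (by rwa [quadratic_self])
  have i₁ := h.2.2 _ _ _ _ h₁ (by rwa [quadratic_self])
  rw [Eqn.solvedAt_iff (contDiff_quadratic c l _ q).contDiffAt, Eqn.solvedAt_iff h₀.2.1.two,
    jet_quadratic _ _ _ _ hsymm₀, fderiv_quadratic_self c l _ q hsymm₀,
    fderiv_fderiv_quadratic c l _ q hsymm₀, hB₀, sum_formOfTrace] at i₀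
  rw [Eqn.solvedAt_iff (contDiff_quadratic c l _ q).contDiffAt, Eqn.solvedAt_iff h₁.2.1.two,
    jet_quadratic _ _ _ _ hsymm₁, fderiv_quadratic_self c l _ q hsymm₁,
    fderiv_fderiv_quadratic c l _ q hsymm₁, hjet', hfd] at i₁
  have hsum : ∑ a, fderiv ℝ (fderiv ℝ f₁) (φ.map (q, c)).1 (spaceVec a) (spaceVec a) =
      ∑ a, fderiv ℝ (fderiv ℝ f₀) (φ.map (q, c)).1 (spaceVec a) (spaceVec a) := by
    simp only [hfdd, Finset.sum_add_distrib, ← Finset.sum_smul, Finset.sum_sub_distrib, ← pow_two,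
      hαβ, sub_self, zero_smul, add_zero]
  rw [hsum] at i₁
  have hsol₀ : Complex.I * l timeVec + θ.G ((q, c), fun a => l (spaceVec a)) * S
      + θ.F ((q, c), fun a => l (spaceVec a)) = 0 := by
    rw [hS]; field_simp; ring
  have hsol₁ := (i₁.2 (i₀.1 ⟨hj, hsol₀⟩)).2
  have hB₁sum : ∑ a, B₁ (spaceVec a) (spaceVec a) = S +
      ((∑ a, α (L (spaceVec a)) ^ 2 - ∑ a, β (L (spaceVec a)) ^ 2 : ℝ) : ℂ) := by
    simp only [hB₁, add_apply, Finset.sum_add_distrib, hB₀, sum_formOfTrace]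
    simp [sqForm_apply, pow_two, Finset.sum_sub_distrib]
  rw [hB₁sum] at hsol₁
  have h3 : θ.G ((q, c), fun a => l (spaceVec a)) *
      ((∑ a, α (L (spaceVec a)) ^ 2 - ∑ a, β (L (spaceVec a)) ^ 2 : ℝ) : ℂ) = 0 := by
    linear_combination hsol₁ - hsol₀
  have h4 := (mul_eq_zero.1 h3).resolve_left hG
  exact sub_eq_zero.1 (by exact_mod_cast h4)

end PointTransf

namespace PointTransf
variable {φ : PointTransf n} {θ θ' : Eqn n} {H : VarSpace n → ℝ} {z : VarSpace n}

/-! ### Components of a point transformation -/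

lemma fderiv_T (hz : z ∈ φ.map.source) (v : VarSpace n) :
    fderiv ℝ φ.T z v = ((fderiv ℝ φ.map z v).1.1 : ℝ) :=
  fderiv_clm_comp_apply (Complex.ofRealCLM.comp ((ContinuousLinearMap.fst ℝ ℝ (Fin n → ℝ)).comp
    (ContinuousLinearMap.fst ℝ (IndepVar n) ℂ))) (φ.differentiableAt hz) v

/-- The linear map extracting the coordinate `x_a` as a complex number. -/
def coordX (a : Fin n) : VarSpace n →L[ℝ] ℂ :=
  Complex.ofRealCLM.comp ((spaceCoord a).comp (ContinuousLinearMap.fst ℝ (IndepVar n) ℂ))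

lemma fderiv_X (hz : z ∈ φ.map.source) (a : Fin n) (v : VarSpace n) :
    fderiv ℝ (φ.X a) z v = ((fderiv ℝ φ.map z v).1.2 a : ℝ) :=
  fderiv_clm_comp_apply (coordX a) (φ.differentiableAt hz) v

lemma fderiv_Psi (hz : z ∈ φ.map.source) (v : VarSpace n) :
    fderiv ℝ φ.Psi z v = (fderiv ℝ φ.map z v).2 :=
  fderiv_clm_comp_apply (ContinuousLinearMap.snd ℝ (IndepVar n) ℂ) (φ.differentiableAt hz) v

lemma fderiv_fderiv_X (hz : z ∈ φ.map.source) (a : Fin n) (u v : VarSpace n) :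
    fderiv ℝ (fderiv ℝ (φ.X a)) z u v = ((fderiv ℝ (fderiv ℝ φ.map) z u v).1.2 a : ℝ) :=
  fderiv_fderiv_clm_comp (coordX a) (φ.contDiffAt_two hz) u v

lemma fderiv_fderiv_Psi (hz : z ∈ φ.map.source) (u v : VarSpace n) :
    fderiv ℝ (fderiv ℝ φ.Psi) z u v = (fderiv ℝ (fderiv ℝ φ.map) z u v).2 :=
  fderiv_fderiv_clm_comp (ContinuousLinearMap.snd ℝ (IndepVar n) ℂ) (φ.contDiffAt_two hz) u v

lemma contDiffOn_fderiv : ContDiffOn ℝ ∞ (fderiv ℝ φ.map) φ.map.source :=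
  φ.smooth.fderiv_of_isOpen φ.map.open_source (by simp)

/-- If the new independent variables do not depend on `ψ`, neither do their first derivatives. -/
lemma fderiv_fderiv_vertical (h : ∀ z ∈ φ.map.source, ∀ w, (fderiv ℝ φ.map z (0, w)).1 = 0)
    (hz : z ∈ φ.map.source) (u : VarSpace n) (w : ℂ) :
    (fderiv ℝ (fderiv ℝ φ.map) z u (0, w)).1 = 0 := by
  have h1 := fderiv_fderiv_apply (φ.contDiffAt_two hz) u (0, w)
  have h2 : DifferentiableAt ℝ (fun y => fderiv ℝ φ.map y (0, w)) z :=
    (φ.contDiffAt_two hz).differentiableAt_fderiv.clm_apply (differentiableAt_const _)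
  have h3 := fderiv_clm_comp_apply (ContinuousLinearMap.fst ℝ (IndepVar n) ℂ) h2 u
  simp only [ContinuousLinearMap.coe_fst'] at h3
  rw [← h1, ← h3]
  have h4 : (fun y => (fderiv ℝ φ.map y (0, w)).1) =ᶠ[𝓝 z] fun _ => 0 := by
    filter_upwards [φ.map.open_source.mem_nhds hz] with y hy using h y hy w
  rw [h4.fderiv_eq]; simp

/-- The real form of the equations on the new independent variables at a point. -/
structure ConformalAt (φ : PointTransf n) (h : ℝ) (z : VarSpace n) : Prop where
  pos : 0 < h
  vertical : ∀ w, (fderiv ℝ φ.map z (0, w)).1 = 0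
  space_time : ∀ a, (fderiv ℝ φ.map z (spaceVec a, 0)).1.1 = 0
  time_time : (fderiv ℝ φ.map z (timeVec, 0)).1.1 ≠ 0
  orth : ∀ b c, ∑ a, (fderiv ℝ φ.map z (spaceVec a, 0)).1.2 b *
    (fderiv ℝ φ.map z (spaceVec a, 0)).1.2 c = if b = c then h else 0

lemma ConformalEqs.conformalAt (h : φ.ConformalEqs H) (hz : z ∈ φ.map.source) :
    φ.ConformalAt (H z) z := by
  obtain ⟨h1, -, -, h4, h5, h6, h7, h8, h9⟩ := h.2 z hz
  refine ⟨h1, fun w => ?_, fun a => ?_, ?_, fun b c => ?_⟩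
  · ext a
    · have := dpsi_eq_zero_and_dpsiConj_eq_zero_iff.1 ⟨h4, h5⟩ w
      rw [fderiv_T hz] at this
      exact_mod_cast this
    · have := dpsi_eq_zero_and_dpsiConj_eq_zero_iff.1 (h8 a) w
      rw [fderiv_X hz] at this
      exact_mod_cast this
  · have := h6 a
    rw [dx, fderiv_T hz] at this
    exact_mod_cast this
  · rw [dt, fderiv_T hz] at h7
    exact_mod_cast h7
  · have := h9 b c
    simp only [dx, fderiv_X hz] at this
    rw [← Complex.ofReal_inj, apply_ite Complex.ofReal]
    push_cast
    exact this

/-- Smoothness of the factor need not be assumed: `H` is the squared length of the spatial gradient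
of one `X^b`, a polynomial in first derivatives of the map. Existence of one index `b` is the reason
for `0 < n`. -/
lemma conformalEqs_of_conformalAt (hn : 0 < n) (hH : ∀ z ∈ φ.map.source, φ.ConformalAt (H z) z) :
    φ.ConformalEqs H := by
  have hHeq : ∀ z ∈ φ.map.source, H z = ∑ a,
      (fderiv ℝ φ.map z (spaceVec a, 0)).1.2 ⟨0, hn⟩ ^ 2 := by
    intro z hz
    simpa [pow_two] using ((hH z hz).orth ⟨0, hn⟩ ⟨0, hn⟩).symm
  let L (a : Fin n) : (VarSpace n →L[ℝ] VarSpace n) →L[ℝ] ℝ :=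
    ((spaceCoord ⟨0, hn⟩).comp (ContinuousLinearMap.fst ℝ (IndepVar n) ℂ)).comp
      (ContinuousLinearMap.apply ℝ _ (spaceVec a, 0))
  have hHeq' : ∀ z ∈ φ.map.source, H z = ∑ a, L a (fderiv ℝ φ.map z) ^ 2 := hHeq
  have hvert : ∀ z ∈ φ.map.source, ∀ w, (fderiv ℝ φ.map z (0, w)).1 = 0 :=
    fun z hz => (hH z hz).vertical
  refine ⟨?_, fun z hz => ?_⟩
  · refine ContDiffOn.congr ?_ hHeq'
    exact ContDiffOn.sum fun a _ => ((L a).contDiff.comp_contDiffOn contDiffOn_fderiv).pow 2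
  · have hHz := hH z hz
    have hHd : ∀ w, fderiv ℝ (fun y => (H y : ℂ)) z (0, w) = 0 := by
      intro w
      have hd := (φ.contDiffAt_two hz).differentiableAt_fderiv.hasFDerivAt
      have h1 : HasFDerivAt (fun y => ∑ a, L a (fderiv ℝ φ.map y) ^ 2) _ z :=
        HasFDerivAt.fun_sum (u := Finset.univ) fun a _ => ((L a).hasFDerivAt.comp z hd).pow 2
      have h2 : (fun y => (H y : ℂ)) =ᶠ[𝓝 z]
          fun y => Complex.ofRealCLM (∑ a, L a (fderiv ℝ φ.map y) ^ 2) := by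
        filter_upwards [φ.map.open_source.mem_nhds hz] with y hy
        rw [hHeq' y hy]; rfl
      rw [h2.fderiv_eq, fderiv_clm_comp_apply _ h1.differentiableAt, h1.fderiv]
      -- `H` is independent of `ψ` because the derivative of `X^b_a` in `ψ` is, by symmetry, the
      -- derivative in `x_a` of a function that vanishes identically.
      have h3 : ∀ a, L a (fderiv ℝ (fderiv ℝ φ.map) z (0, w)) = 0 := by
        intro a
        change (fderiv ℝ (fderiv ℝ φ.map) z (0, w) (spaceVec a, 0)).1.2 _ = 0
        rw [fderiv_fderiv_symm (φ.contDiffAt_two hz), fderiv_fderiv_vertical hvert hz]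
        rfl
      simp [sum_apply, h3]
    have hT : ∀ w, fderiv ℝ φ.T z (0, w) = 0 := fun w => by
      rw [fderiv_T hz, hHz.vertical]; simp
    have hX : ∀ a w, fderiv ℝ (φ.X a) z (0, w) = 0 := fun a w => by
      rw [fderiv_X hz, hHz.vertical]; simp
    obtain ⟨e1, e2⟩ := dpsi_eq_zero_and_dpsiConj_eq_zero_iff.2 hHd
    obtain ⟨e3, e4⟩ := dpsi_eq_zero_and_dpsiConj_eq_zero_iff.2 hT
    refine ⟨hHz.pos, e1, e2, e3, e4, fun a => ?_, ?_,
      fun a => dpsi_eq_zero_and_dpsiConj_eq_zero_iff.2 (hX a), fun b c => ?_⟩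
    · rw [dx, fderiv_T hz]
      exact_mod_cast hHz.space_time a
    · rw [dt, fderiv_T hz]
      exact_mod_cast hHz.time_time
    · simp only [dx, fderiv_X hz]
      have := hHz.orth b c
      rw [← Complex.ofReal_inj, apply_ite Complex.ofReal] at this
      push_cast at this
      exact this

/-! ### Transformations between equations are conformal in the space variables -/

/-- A continuous condition on `∇ψ` holding wherever the independent variables can be transformed
along some graph holds everywhere. -/
lemma eq_zero_of_generic (hz : z ∈ φ.map.source) {O : Set (Fin n → ℂ)} (hO : IsOpen O)
    {g : (Fin n → ℂ) → ℝ} (hg : Continuous g)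
    (hgen : ∀ l : IndepVar n →L[ℝ] ℂ, (fun a => l (spaceVec a)) ∈ O →
      Function.Injective (φ.graphDiff z l) → g (fun a => l (spaceVec a)) = 0)
    {p : Fin n → ℂ} (hp : p ∈ O) : g p = 0 := by
  set l₀ := linearOfValues 0 p
  set D := fderiv ℝ φ.map z with hD
  let C : ℂ →L[ℝ] IndepVar n := (ContinuousLinearMap.fst ℝ (IndepVar n) ℂ).comp
    (D.comp (ContinuousLinearMap.inr ℝ (IndepVar n) ℂ))
  -- The differential of `φ` is onto, so horizontal directions along the graph and vertical
  -- directions together span the new independent variables. Hence some line of tangent maps through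
  -- `l₀` is nondegenerate away from `l₀` itself, and the identity passes to the limit.
  obtain ⟨l₁, hl₁⟩ := exists_perturbation_bijective (φ.graphDiff z l₀).toLinearMap C.toLinearMap
    (by
      rw [eq_top_iff]
      intro y _
      obtain ⟨⟨v, w⟩, hv⟩ := (φ.fderiv_bijective hz).2 (y, 0)
      rw [Submodule.mem_sup]
      refine ⟨_, ⟨v, rfl⟩, _, ⟨w - l₀ v, rfl⟩, ?_⟩
      change (D (v, l₀ v)).1 + (D (0, w - l₀ v)).1 = y
      rw [← Prod.fst_add, ← map_add]
      simp [hD, hv])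
  let l₁' : IndepVar n →L[ℝ] ℂ := l₁.toContinuousLinearMap
  let l (ε : ℝ) : IndepVar n →L[ℝ] ℂ := l₀ + ε • l₁'
  have hl : ∀ ε ≠ 0, Function.Injective (φ.graphDiff z (l ε)) := by
    intro ε hε
    convert (hl₁ ε hε).1 using 1
    funext v
    change (D (v, l₀ v + ε • l₁ v)).1 = (D (v, l₀ v)).1 + ε • (D (0, l₁ v)).1
    rw [← Prod.smul_fst, ← Prod.fst_add, ← map_smul D, ← map_add D]
    simp
  let P (ε : ℝ) : Fin n → ℂ := fun a => l ε (spaceVec a)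
  have hPc : Continuous P := by
    refine continuous_pi fun a => ?_
    change Continuous fun ε : ℝ => l₀ (spaceVec a) + ε • l₁' (spaceVec a)
    fun_prop
  have hP0 : P 0 = p := by
    funext a
    change l₀ (spaceVec a) + (0 : ℝ) • l₁' (spaceVec a) = p a
    rw [zero_smul, add_zero, linearOfValues_spaceVec]
  have hev : ∀ᶠ ε in 𝓝[≠] (0 : ℝ), g (P ε) = 0 := by
    have h1 : ∀ᶠ ε in 𝓝 (0 : ℝ), P ε ∈ O :=
      hPc.continuousAt.eventually (hO.mem_nhds (by rwa [hP0]))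
    filter_upwards [h1.filter_mono nhdsWithin_le_nhds, self_mem_nhdsWithin] with ε h2 h3
    exact hgen (l ε) h2 (hl ε h3)
  have ht : Tendsto (fun ε => g (P ε)) (𝓝[≠] (0 : ℝ)) (𝓝 (g (P 0))) :=
    (hg.comp hPc).continuousAt.tendsto.mono_left nhdsWithin_le_nhds
  rw [hP0] at ht
  exact tendsto_nhds_unique (ht.congr' hev) tendsto_const_nhds |>.symm ▸ rfl

end PointTransf

lemma sum_update_eq {ι : Type*} [Fintype ι] [DecidableEq ι] (k : ι → ℂ → ℝ) (p : ι → ℂ) (i : ι)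
    (x : ℂ) : ∑ a, k a (Function.update p i x a) = ∑ a, k a (p a) + (k i x - k i (p i)) := by
  rw [← sub_eq_iff_eq_add', ← Finset.sum_sub_distrib, Finset.sum_eq_single i]
  · simp
  · intro b _ hb; simp [hb]
  · simp

namespace PointTransf
variable {φ : PointTransf n} {θ θ' : Eqn n} {H : VarSpace n → ℝ} {z : VarSpace n}

/-- Equality of pulled-back lengths is a quadratic identity in `∇ψ` on an open set. Its second
differences involve only the vertical derivatives of the independent variables and force these to
vanish; the identity then no longer contains `∇ψ`. Choosing `α = dt`, `β = 0` kills `T_a`,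
coordinate covectors give equal lengths of the gradients of the `X^b`, and their sums and
differences give orthogonality. -/
lemma MapsEqn.exists_conformalAt (h : φ.MapsEqn θ θ') (hn : 2 ≤ n) (hdom : IsOpen θ.dom)
    (hG : ∀ j ∈ θ.dom, θ.G j ≠ 0) (hz : z ∈ θ.base) : ∃ c, φ.ConformalAt c z := by
  obtain ⟨⟨z, p⟩, hp, rfl⟩ := hz
  have hzs : z ∈ φ.map.source := h.1 ⟨_, hp, rfl⟩
  set O : Set (Fin n → ℂ) := {p | (z, p) ∈ θ.dom} with hOdef
  have hO : IsOpen O := hdom.preimage (by fun_prop : Continuous fun p : Fin n → ℂ => (z, p))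
  set D := fderiv ℝ φ.map z with hD
  let i₀ : Fin n := ⟨0, by omega⟩
  have gen : ∀ (l : IndepVar n →L[ℝ] ℂ), (fun a => l (spaceVec a)) ∈ O →
      Function.Injective (φ.graphDiff z l) → ∀ (α β : IndepVar n →L[ℝ] ℝ),
      ∑ a, α (spaceVec a) ^ 2 = ∑ a, β (spaceVec a) ^ 2 →
      ∑ a, α (D (spaceVec a, l (spaceVec a))).1 ^ 2 =
        ∑ a, β (D (spaceVec a, l (spaceVec a))).1 ^ 2 :=
    fun l hl hinj α β hαβ => sum_sq_graphDiff_eq h i₀ hl (hG _ hl) hinj α β hαβ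
  have all : ∀ (α β : IndepVar n →L[ℝ] ℝ), ∑ a, α (spaceVec a) ^ 2 = ∑ a, β (spaceVec a) ^ 2 →
      ∀ p ∈ O, ∑ a, α (D (spaceVec a, p a)).1 ^ 2 - ∑ a, β (D (spaceVec a, p a)).1 ^ 2 = 0 := by
    intro α β hαβ p hp
    refine eq_zero_of_generic (φ := φ) hzs hO
      (g := fun p => ∑ a, α (D (spaceVec a, p a)).1 ^ 2 - ∑ a, β (D (spaceVec a, p a)).1 ^ 2)
      (by fun_prop) (fun l hl hinj => sub_eq_zero.2 (gen l hl hinj α β hαβ)) hp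
  -- small variations of one component of `∇ψ`
  have var : ∀ p ∈ O, ∀ (i : Fin n) (w : ℂ), ∃ s : ℝ, s ≠ 0 ∧
      Function.update p i (p i + s • w) ∈ O ∧ Function.update p i (p i + (-s) • w) ∈ O := by
    intro p hp i w
    have hc : Continuous fun s : ℝ => Function.update p i (p i + s • w) :=
      continuous_const.update i (by fun_prop)
    have h0 : (fun s : ℝ => Function.update p i (p i + s • w)) 0 = p := by simp
    have h1 : ∀ᶠ s : ℝ in 𝓝 0, Function.update p i (p i + s • w) ∈ O :=
      hc.continuousAt.eventually (by rw [h0]; exact hO.mem_nhds hp)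
    have h2 : ∀ᶠ s : ℝ in 𝓝 0, Function.update p i (p i + (-s) • w) ∈ O :=
      (continuous_neg.tendsto' (0 : ℝ) 0 (by simp)).eventually h1
    obtain ⟨s, ⟨h3, h4⟩, h5⟩ := (((h1.and h2).filter_mono nhdsWithin_le_nhds).and
      (self_mem_nhdsWithin : ({0}ᶜ : Set ℝ) ∈ 𝓝[≠] 0)).exists
    exact ⟨s, h5, h3, h4⟩
  have expand : ∀ (a : Fin n) (x w : ℂ) (s : ℝ),
      D (spaceVec a, x + s • w) = D (spaceVec a, x) + s • D (0, w) := by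
    intro a x w s
    rw [← map_smul, ← map_add]; simp
  -- second differences
  have second : ∀ (α β : IndepVar n →L[ℝ] ℝ),
      ∑ a, α (spaceVec a) ^ 2 = ∑ a, β (spaceVec a) ^ 2 →
      ∀ w, α (D (0, w)).1 ^ 2 = β (D (0, w)).1 ^ 2 := by
    intro α β hαβ w
    obtain ⟨s, hs, h1, h2⟩ := var p hp i₀ w
    have e0 := all α β hαβ p hp
    have e1 := all α β hαβ _ h1
    have e2 := all α β hαβ _ h2
    rw [sum_update_eq (fun a x => α (D (spaceVec a, x)).1 ^ 2),
      sum_update_eq (fun a x => β (D (spaceVec a, x)).1 ^ 2)] at e1 e2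
    simp only [expand, Prod.fst_add, Prod.smul_fst, map_add, map_smul, smul_eq_mul] at e1 e2
    -- The symmetric second difference with step `s` cancels the constant and linear terms.
    have h3 : s ^ 2 * (α (D (0, w)).1 ^ 2 - β (D (0, w)).1 ^ 2) = 0 := by
      linear_combination (e1 + e2) / 2 - e0
    exact sub_eq_zero.1 ((mul_eq_zero.1 h3).resolve_left (pow_ne_zero 2 hs))
  have normT : ∑ a : Fin n, (ContinuousLinearMap.fst ℝ ℝ (Fin n → ℝ)) (spaceVec a) ^ 2 =
      ∑ a : Fin n, (0 : IndepVar n →L[ℝ] ℝ) (spaceVec a) ^ 2 := by simp [spaceVec]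
  have normX : ∀ b : Fin n, ∑ a, spaceCoord b (spaceVec a) ^ 2 = 1 := by
    intro b
    simp [spaceCoord_apply, spaceVec, Pi.single_apply]
  have normPM : ∀ b c : Fin n, b ≠ c → ∑ a, (spaceCoord b + spaceCoord c) (spaceVec a) ^ 2 =
      ∑ a, (spaceCoord b - spaceCoord c) (spaceVec a) ^ 2 := by
    intro b c hbc
    refine Finset.sum_congr rfl fun a _ => ?_
    have h0 : spaceCoord b (spaceVec a) * spaceCoord c (spaceVec a) = 0 := by
      simp only [spaceCoord_apply, spaceVec, Pi.single_apply]
      split_ifs with h1 h2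
      · exact absurd (h1.trans h2.symm) hbc
      all_goals simp
    rw [add_apply, sub_apply]
    linear_combination 4 * h0
  have vert : ∀ w, (D (0, w)).1 = 0 := by
    intro w
    ext b
    · simpa using second _ _ normT w
    -- A second space index is needed here: the vertical derivatives of `X^b` and `X^c` have equal
    -- squares and product zero, so both vanish.
    · obtain ⟨c, hbc⟩ : ∃ c : Fin n, b ≠ c := by
        have : Nontrivial (Fin n) := Fin.nontrivial_iff_two_le.2 hn
        obtain ⟨c, hc⟩ := exists_ne b
        exact ⟨c, hc.symm⟩
      have h1 := second _ _ ((normX b).trans (normX c).symm) w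
      have h2 := second _ _ (normPM b c hbc) w
      rw [add_apply, sub_apply] at h2
      simp only [spaceCoord_apply] at h1 h2
      have h3 : (D (0, w)).1.2 b ^ 4 = 0 := by
        linear_combination ((D (0, w)).1.2 b) ^ 2 * h1 +
          (D (0, w)).1.2 b * (D (0, w)).1.2 c * h2 / 4
      simpa using h3
  have noP : ∀ (v : IndepVar n) (w : ℂ), (D (v, w)).1 = (D (v, 0)).1 := by
    intro v w
    have : ((v, w) : VarSpace n) = (v, 0) + (0, w) := by simp
    rw [this, map_add, Prod.fst_add, vert, add_zero]
  have all' : ∀ (α β : IndepVar n →L[ℝ] ℝ),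
      ∑ a, α (spaceVec a) ^ 2 = ∑ a, β (spaceVec a) ^ 2 →
      ∑ a, α (D (spaceVec a, 0)).1 ^ 2 = ∑ a, β (D (spaceVec a, 0)).1 ^ 2 := by
    intro α β hαβ
    have := all α β hαβ p hp
    simp only [noP _ (p _)] at this
    exact sub_eq_zero.1 this
  have hT : ∀ a, (D (spaceVec a, 0)).1.1 = 0 := by
    have h1 := all' _ _ normT
    simp only [zero_apply, ne_eq, OfNat.ofNat_ne_zero, not_false_eq_true, zero_pow,
      Finset.sum_const_zero] at h1
    rw [Finset.sum_eq_zero_iff_of_nonneg (fun _ _ => sq_nonneg _)] at h1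
    intro a
    simpa using h1 a (Finset.mem_univ a)
  have hinj : ∀ v, (D (v, 0)).1 = 0 → v = 0 := by
    have hsurj : Function.Surjective (φ.graphDiff z 0) := by
      intro y
      obtain ⟨⟨v, w⟩, hv⟩ := (φ.fderiv_bijective hzs).2 (y, 0)
      refine ⟨v, ?_⟩
      have := congrArg Prod.fst hv
      rwa [← hD, noP] at this
    have := LinearMap.injective_iff_surjective (f := (φ.graphDiff z 0).toLinearMap).2 hsurj
    intro v hv
    exact this (show φ.graphDiff z 0 v = φ.graphDiff z 0 0 by rw [map_zero]; exact hv)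
  set c := ∑ a, (D (spaceVec a, 0)).1.2 i₀ ^ 2 with hc
  have hdiag : ∀ b, ∑ a, (D (spaceVec a, 0)).1.2 b ^ 2 = c := fun b =>
    all' _ _ ((normX b).trans (normX i₀).symm)
  refine ⟨c, ?_, vert, hT, ?_, ?_⟩
  -- If the common length were zero, all `X^b_a` would vanish and the direction of `x_a` would be in
  -- the kernel of the restricted, still invertible, differential.
  · refine lt_of_le_of_ne (Finset.sum_nonneg fun _ _ => sq_nonneg _) fun h0 => ?_
    have h1 : spaceVec i₀ = (0 : IndepVar n) := by
      refine hinj _ (Prod.ext (hT i₀) (funext fun b => ?_))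
      have h2 := hdiag b
      rw [← h0, Finset.sum_eq_zero_iff_of_nonneg (fun _ _ => sq_nonneg _)] at h2
      simpa using h2 i₀ (Finset.mem_univ _)
    have h2 := congrFun (congrArg Prod.snd h1) i₀
    simp [spaceVec] at h2
  · change (D (timeVec, 0)).1.1 ≠ 0
    -- With `T_a = 0`, vanishing of `T_t` would keep the time direction out of the range of the
    -- differential.
    intro h0
    obtain ⟨⟨v, w⟩, hv⟩ := (φ.fderiv_bijective hzs).2 (timeVec, 0)
    have h1 := congrArg Prod.fst hv
    rw [← hD, noP] at h1
    have h2 : ((v, 0) : VarSpace n) = v.1 • (timeVec, 0) + ∑ a, v.2 a • (spaceVec a, (0 : ℂ)) := by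
      ext1
      · simpa [Prod.fst_sum] using sum_spaceVec v
      · simp [Prod.snd_sum]
    rw [h2, map_add, map_smul, map_sum] at h1
    simp_rw [map_smul D] at h1
    have h3 := congrArg Prod.fst h1
    simp only [Prod.fst_add, Prod.smul_fst, Prod.fst_sum, h0, hT, smul_zero,
      Finset.sum_const_zero, add_zero] at h3
    simp [timeVec] at h3
  · intro b c
    split_ifs with hbc
    · subst hbc
      simpa [pow_two] using hdiag b
    · have h1 := all' _ _ (normPM b c hbc)
      simp only [add_apply, sub_apply, spaceCoord_apply, add_sq, sub_sq,
        Finset.sum_add_distrib, Finset.sum_sub_distrib, mul_assoc, ← Finset.mul_sum] at h1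
      linarith

/-- The factor is chosen point by point; equality of the source of `φ` with the base of `θ` makes
the pointwise result available on the whole source. -/
lemma MapsEqn.exists_conformalEqs (h : φ.MapsEqn θ θ') (hn : 2 ≤ n) (hθ : θ ∈ classN n)
    (hs : φ.map.source = θ.base) : ∃ H, φ.ConformalEqs H := by
  have h1 : ∀ z : VarSpace n, ∃ c, z ∈ φ.map.source → φ.ConformalAt c z := by
    intro z
    by_cases hz : z ∈ φ.map.source
    · obtain ⟨c, hc⟩ := h.exists_conformalAt hn hθ.1 hθ.2.2.2.2 (hs ▸ hz)
      exact ⟨c, fun _ => hc⟩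
    · exact ⟨0, fun h => absurd h hz⟩
  choose H hH using h1
  exact ⟨H, conformalEqs_of_conformalAt (by omega) hH⟩

end PointTransf

namespace PointTransf
variable {φ : PointTransf n} {θ θ' : Eqn n} {H : VarSpace n → ℝ} {z : VarSpace n}
  {f f' : IndepVar n → ℂ} {q q' : IndepVar n}

/-! ### Prolongation of conformal transformations -/

/-- The first prolongation of a transformation with conformal space part. -/
def prolongJet (φ : PointTransf n) (H : VarSpace n → ℝ) (j : JetSpace n) : JetSpace n :=
  (φ.map j.1, fun b => ∑ a, dx a (φ.X b) j.1 / H j.1 * totalDx a φ.Psi j)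

/-- The part of the `F`-component that does not depend on `F`. -/
def lowerTerms (φ : PointTransf n) (H : VarSpace n → ℝ) (j : JetSpace n) (g : ℂ) : ℂ :=
  - (hatLaplacian φ.Psi j
      + ((n : ℂ) - 2) / 2 * ∑ a, dx a (fun w => (H w : ℂ)) j.1 / H j.1 * totalDx a φ.Psi j)
      * (g / H j.1)
    - Complex.I / dt φ.T j.1 *
      (dt φ.Psi j.1
        - ∑ b, ∑ a, dt (φ.X b) j.1 * (dx a (φ.X b) j.1 / H j.1) * totalDx a φ.Psi j)

lemma contDiffAt_X (hz : z ∈ φ.map.source) (b : Fin n) : ContDiffAt ℝ 2 (φ.X b) z :=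
  (coordX b).contDiff.contDiffAt.comp z (φ.contDiffAt_two hz)

lemma ConformalEqs.ne_zero (h : φ.ConformalEqs H) (hz : z ∈ φ.map.source) : (H z : ℂ) ≠ 0 :=
  Complex.ofReal_ne_zero.2 (h.2 z hz).1.ne'

lemma ConformalEqs.dt_ne_zero (h : φ.ConformalEqs H) (hz : z ∈ φ.map.source) : dt φ.T z ≠ 0 :=
  (h.2 z hz).2.2.2.2.2.2.1

lemma ConformalEqs.orth (h : φ.ConformalEqs H) (hz : z ∈ φ.map.source) (b c : Fin n) :
    ∑ a, dx a (φ.X b) z * dx a (φ.X c) z = if b = c then (H z : ℂ) else 0 :=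
  (h.2 z hz).2.2.2.2.2.2.2.2 b c

/-- The spatial Jacobian divided by the square root of `H` is orthogonal, so its columns are
orthonormal as well as its rows. The argument avoids the root by using that a right inverse of a
square matrix is a left inverse. -/
lemma ConformalEqs.orth' (h : φ.ConformalEqs H) (hz : z ∈ φ.map.source) (a c : Fin n) :
    ∑ b, dx a (φ.X b) z * dx c (φ.X b) z = if a = c then (H z : ℂ) else 0 := by
  let M : Matrix (Fin n) (Fin n) ℂ := Matrix.of fun b a => dx a (φ.X b) z
  have hH := h.ne_zero hz
  have h1 : M * ((H z : ℂ)⁻¹ • M.transpose) = 1 := by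
    ext b c
    rw [Matrix.mul_smul, Matrix.smul_apply, Matrix.mul_apply]
    simp only [M, Matrix.of_apply, Matrix.transpose_apply, h.orth hz, Matrix.one_apply]
    split_ifs <;> simp [hH]
  have h2 := congrArg (fun N : Matrix (Fin n) (Fin n) ℂ => N a c) (mul_eq_one_comm.1 h1)
  rw [Matrix.smul_mul, Matrix.smul_apply, Matrix.mul_apply] at h2
  simp only [M, Matrix.of_apply, Matrix.transpose_apply, Matrix.one_apply, smul_eq_mul] at h2
  rw [inv_mul_eq_iff_eq_mul₀ hH] at h2
  rw [h2]; simp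

lemma ConformalEqs.fst_fderiv (h : φ.ConformalEqs H) (hz : z ∈ φ.map.source)
    (v : IndepVar n) (w : ℂ) :
    (fderiv ℝ φ.map z (v, w)).1 = (fderiv ℝ φ.map z (v, 0)).1 := by
  have : ((v, w) : VarSpace n) = (v, 0) + (0, w) := by simp
  rw [this, map_add, Prod.fst_add, (h.conformalAt hz).vertical, add_zero]

lemma ConformalEqs.fderiv_space (h : φ.ConformalEqs H) (hz : z ∈ φ.map.source) (a : Fin n) :
    (fderiv ℝ φ.map z (spaceVec a, 0)).1 =
      ∑ b, (fderiv ℝ φ.map z (spaceVec a, 0)).1.2 b • spaceVec b := by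
  conv_lhs => rw [sum_spaceVec (fderiv ℝ φ.map z (spaceVec a, 0)).1]
  rw [(h.conformalAt hz).space_time, zero_smul, zero_add]

lemma ConformalEqs.totalDx_eq_sum (h : φ.ConformalEqs H) (hm : φ.MapsGerm f q f' q') (a : Fin n) :
    totalDx a φ.Psi (jet f q) = ∑ b, dx a (φ.X b) (q, f q) * spaceDeriv b f' q' := by
  have hz := hm.2.2.1
  rw [totalDx_eq, fderiv_Psi (z := (jet f q).1) hz]
  change (fderiv ℝ φ.map (q, f q) (spaceVec a, fderiv ℝ f q (spaceVec a))).2 = _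
  rw [hm.fderiv_eq, h.fst_fderiv hz, h.fderiv_space hz, map_sum]
  refine Finset.sum_congr rfl fun b _ => ?_
  rw [map_smul, dx, fderiv_X hz, Complex.real_smul]
  rfl

lemma ConformalEqs.dt_eq_sum (h : φ.ConformalEqs H) (hm : φ.MapsGerm f q f' q') :
    dt φ.Psi (q, f q) + (dpsi φ.Psi (q, f q) * timeDeriv f q
        + dpsiConj φ.Psi (q, f q) * conj (timeDeriv f q)) =
      dt φ.T (q, f q) * timeDeriv f' q' + ∑ b, dt (φ.X b) (q, f q) * spaceDeriv b f' q' := by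
  have hz := hm.2.2.1
  have h1 : ((timeVec, fderiv ℝ f q timeVec) : VarSpace n) = (timeVec, 0)
    + (0, fderiv ℝ f q timeVec) := by simp
  have h2 := hm.fderiv_eq timeVec
  rw [← fderiv_Psi hz, h.fst_fderiv hz, h1, map_add, fderiv_vertical,
    sum_spaceVec (fderiv ℝ φ.map (q, f q) (timeVec, 0)).1, map_add, map_sum, map_smul] at h2
  simp only [map_smul, Complex.real_smul, ← fderiv_T hz, ← fderiv_X hz] at h2
  exact h2

/-- The chain rule `D_aΨ = X^b_a ψ̃_b` is inverted by orthogonality: the inverse of the spatial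
Jacobian is its transpose divided by `H`. -/
lemma ConformalEqs.spaceDeriv_eq (h : φ.ConformalEqs H) (hm : φ.MapsGerm f q f' q') (b : Fin n) :
    spaceDeriv b f' q' =
      ∑ a, dx a (φ.X b) (q, f q) / H (q, f q) * totalDx a φ.Psi (jet f q) := by
  have hz := hm.2.2.1
  have hH := h.ne_zero hz
  have h1 : ∑ a, dx a (φ.X b) (q, f q) * totalDx a φ.Psi (jet f q) =
      H (q, f q) * spaceDeriv b f' q' := by
    simp only [h.totalDx_eq_sum hm, Finset.mul_sum]
    rw [Finset.sum_comm]
    simp only [← mul_assoc, ← Finset.sum_mul, h.orth hz]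
    simp
  calc spaceDeriv b f' q' = (H (q, f q) * spaceDeriv b f' q') / H (q, f q) := by field_simp
    _ = _ := by
      rw [← h1, Finset.sum_div]
      exact Finset.sum_congr rfl fun a _ => by ring

lemma ConformalEqs.jet_eq (h : φ.ConformalEqs H) (hm : φ.MapsGerm f q f' q') :
    jet f' q' = φ.prolongJet H (jet f q) := by
  have h1 : φ.map (q, f q) = (q', f' q') := hm.2.2.2.1
  refine Prod.ext h1.symm (funext fun b => ?_)
  exact h.spaceDeriv_eq hm b

lemma ConformalEqs.fst_fderiv_fderiv (h : φ.ConformalEqs H) (hz : z ∈ φ.map.source)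
    (v : IndepVar n) (w : ℂ) :
    (fderiv ℝ (fderiv ℝ φ.map) z (v, w) (v, w)).1 =
      (fderiv ℝ (fderiv ℝ φ.map) z (v, 0) (v, 0)).1 := by
  have hv : ∀ z ∈ φ.map.source, ∀ w, (fderiv ℝ φ.map z (0, w)).1 = 0 :=
    fun z hz => (h.conformalAt hz).vertical
  have h1 : ((v, w) : VarSpace n) = (v, 0) + (0, w) := by simp
  have h2 := fderiv_fderiv_symm (φ.contDiffAt_two hz)
  rw [h1, map_add (fderiv ℝ (fderiv ℝ φ.map) z), add_apply, map_add, map_add, h2 (0, w) (v, 0)]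
  simp only [Prod.fst_add, fderiv_fderiv_vertical hv hz, add_zero]

lemma ConformalEqs.fst_fderiv_time (h : φ.ConformalEqs H) (hz : z ∈ φ.map.source)
    (a : Fin n) (u : VarSpace n) :
    (fderiv ℝ (fderiv ℝ φ.map) z u (spaceVec a, 0)).1.1 = 0 := by
  have h1 := fderiv_fderiv_apply (φ.contDiffAt_two hz) u (spaceVec a, 0)
  have h2 : DifferentiableAt ℝ (fun y => fderiv ℝ φ.map y (spaceVec a, 0)) z :=
    (φ.contDiffAt_two hz).differentiableAt_fderiv.clm_apply (differentiableAt_const _)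
  have h3 := fderiv_clm_comp_apply ((ContinuousLinearMap.fst ℝ ℝ (Fin n → ℝ)).comp
    (ContinuousLinearMap.fst ℝ (IndepVar n) ℂ)) h2 u
  simp only [ContinuousLinearMap.coe_fst', ContinuousLinearMap.comp_apply] at h3
  rw [← h1, ← h3]
  have h4 : (fun y => (fderiv ℝ φ.map y (spaceVec a, 0)).1.1) =ᶠ[𝓝 z] fun _ => 0 := by
    filter_upwards [φ.map.open_source.mem_nhds hz] with y hy using (h.conformalAt hy).space_time a
  rw [h4.fderiv_eq]; simp

/-- The second-order chain rule along each `x_a`, summed over `a`: orthogonality collapses the full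
Hessian of the image to `H` times its Laplacian, and the second derivatives of `X` contribute
first-order terms. -/
lemma ConformalEqs.hatLaplacian_eq_sum (h : φ.ConformalEqs H) (hm : φ.MapsGerm f q f' q') :
    hatLaplacian φ.Psi (jet f q)
        + (dpsi φ.Psi (q, f q) * ∑ a, spaceDeriv a (spaceDeriv a f) q
          + dpsiConj φ.Psi (q, f q) * conj (∑ a, spaceDeriv a (spaceDeriv a f) q)) =
      H (q, f q) * ∑ b, spaceDeriv b (spaceDeriv b f') q'
        + ∑ a, ∑ b, dx a (dx a (φ.X b)) (q, f q) * spaceDeriv b f' q' := by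
  have hz := hm.2.2.1
  have hPsi : ContDiffAt ℝ 2 φ.Psi (q, f q) :=
    (ContinuousLinearMap.snd ℝ (IndepVar n) ℂ).contDiff.contDiffAt.comp _ (φ.contDiffAt_two hz)
  simp only [spaceDeriv_spaceDeriv hm.1.two, spaceDeriv_spaceDeriv hm.2.1.two]
  have h1 : ∀ a, (fderiv ℝ (fderiv ℝ φ.Psi) (q, f q) (spaceVec a, fderiv ℝ f q (spaceVec a))
        (spaceVec a, fderiv ℝ f q (spaceVec a)))
      + (dpsi φ.Psi (q, f q) * fderiv ℝ (fderiv ℝ f) q (spaceVec a) (spaceVec a)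
        + dpsiConj φ.Psi (q, f q) * conj (fderiv ℝ (fderiv ℝ f) q (spaceVec a) (spaceVec a))) =
      ∑ b, ∑ c, dx a (φ.X b) (q, f q) * dx a (φ.X c) (q, f q)
          * fderiv ℝ (fderiv ℝ f') q' (spaceVec b) (spaceVec c)
        + ∑ b, dx a (dx a (φ.X b)) (q, f q) * spaceDeriv b f' q' := by
    intro a
    have e := hm.fderiv_fderiv_eq (spaceVec a) (spaceVec a)
    have hX2 : ∀ b, dx a (dx a (φ.X b)) (q, f q) =
        ((fderiv ℝ (fderiv ℝ φ.map) (q, f q) (spaceVec a, 0) (spaceVec a, 0)).1.2 b : ℝ) := by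
      intro b
      rw [← fderiv_fderiv_X hz]
      exact fderiv_dx (contDiffAt_X hz b) a _
    rw [Prod.snd_add, ← fderiv_Psi hz, fderiv_vertical, ← fderiv_fderiv_Psi hz, Prod.fst_add,
      (h.conformalAt hz).vertical, add_zero, h.fst_fderiv hz, h.fderiv_space hz,
      h.fst_fderiv_fderiv hz,
      sum_spaceVec (fderiv ℝ (fderiv ℝ φ.map) (q, f q) (spaceVec a, 0) (spaceVec a, 0)).1,
      h.fst_fderiv_time hz, zero_smul, zero_add] at e
    rw [e]
    simp only [map_sum, map_smul, sum_apply, smul_apply, Complex.real_smul, ← hX2, ← fderiv_X hz]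
    congr 1
    rw [Finset.sum_comm]
    refine Finset.sum_congr rfl fun b _ => ?_
    rw [Finset.mul_sum]
    refine Finset.sum_congr rfl fun c _ => ?_
    rw [dx, dx, spaceVec]
    ring
  have h2 : hatLaplacian φ.Psi (jet f q) = ∑ a, fderiv ℝ (fderiv ℝ φ.Psi) (q, f q)
      (spaceVec a, fderiv ℝ f q (spaceVec a)) (spaceVec a, fderiv ℝ f q (spaceVec a)) :=
    hatLaplacian_eq hPsi _
  rw [h2, map_sum, Finset.mul_sum, Finset.mul_sum, ← Finset.sum_add_distrib,
    ← Finset.sum_add_distrib, Finset.sum_congr rfl fun a _ => h1 a, Finset.sum_add_distrib]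
  congr 1
  rw [Finset.sum_comm, Finset.mul_sum]
  refine Finset.sum_congr rfl fun b _ => ?_
  rw [Finset.sum_comm]
  simp only [← Finset.sum_mul, h.orth hz]
  simp

/-- Two contractions of the derivative of `X^b_a X^b_c = H δ_ac` suffice. The divergence gives
`H_c`, the gradient of the trace gives `n H_c`; they share the mixed term `X^b_a X^b_ac`, once and
twice respectively, and eliminating it leaves `(1 - n/2) H_c`. -/
lemma ConformalEqs.sum_dx_dx (h : φ.ConformalEqs H) (hz : z ∈ φ.map.source) (c : Fin n) :
    ∑ a, ∑ b, dx a (dx a (φ.X b)) z * dx c (φ.X b) z =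
      -(((n : ℂ) - 2) / 2 * dx c (fun w => (H w : ℂ)) z) := by
  have hd : ∀ a b, HasFDerivAt (dx a (φ.X b)) (fderiv ℝ (dx a (φ.X b)) z) z := fun a b =>
    ((contDiffAt_X hz b).differentiableAt_fderiv.clm_apply
      (differentiableAt_const _)).hasFDerivAt
  have hsymm : ∀ a c b, dx a (dx c (φ.X b)) z = dx c (dx a (φ.X b)) z := by
    intro a c b
    have e1 := fderiv_dx (contDiffAt_X hz b) c (spaceVec a, 0)
    have e2 := fderiv_dx (contDiffAt_X hz b) a (spaceVec c, 0)
    exact e1.trans ((fderiv_fderiv_symm (contDiffAt_X hz b) _ _).trans e2.symm)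
  have hprod : ∀ a c d, dx d (fun y => ∑ b, dx a (φ.X b) y * dx c (φ.X b) y) z =
      ∑ b, (dx a (φ.X b) z * dx d (dx c (φ.X b)) z
        + dx c (φ.X b) z * dx d (dx a (φ.X b)) z) := by
    intro a c d
    have h1 := HasFDerivAt.fun_sum (u := Finset.univ) fun b (_ : b ∈ Finset.univ) =>
      (hd a b).mul (hd c b)
    simp only [Pi.mul_apply] at h1
    rw [dx, h1.fderiv, sum_apply]
    rfl
  have hloc : ∀ a c d, dx d (fun y => ∑ b, dx a (φ.X b) y * dx c (φ.X b) y) z =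
      if a = c then dx d (fun w => (H w : ℂ)) z else 0 := by
    intro a c d
    have h1 : (fun y => ∑ b, dx a (φ.X b) y * dx c (φ.X b) y) =ᶠ[𝓝 z]
        fun y => if a = c then (H y : ℂ) else 0 := by
      filter_upwards [φ.map.open_source.mem_nhds hz] with y hy using h.orth' hy a c
    rw [dx, h1.fderiv_eq]
    split_ifs
    · rfl
    · simp
  have e1 : ∑ a, ∑ b, (dx a (φ.X b) z * dx a (dx c (φ.X b)) z
        + dx c (φ.X b) z * dx a (dx a (φ.X b)) z) = dx c (fun w => (H w : ℂ)) z := by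
    simp only [← hprod, hloc]
    simp
  have e2 : ∑ a, ∑ b, (dx a (φ.X b) z * dx c (dx a (φ.X b)) z
        + dx a (φ.X b) z * dx c (dx a (φ.X b)) z) = n * dx c (fun w => (H w : ℂ)) z := by
    simp only [← hprod, hloc]
    simp
  simp only [Finset.sum_add_distrib, hsymm _ c] at e1 e2
  have e3 : ∑ a, ∑ b, dx a (dx a (φ.X b)) z * dx c (φ.X b) z =
      ∑ a, ∑ b, dx c (φ.X b) z * dx a (dx a (φ.X b)) z :=
    Finset.sum_congr rfl fun a _ => Finset.sum_congr rfl fun b _ => mul_comm _ _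
  rw [e3]
  linear_combination e1 - e2 / 2

lemma ConformalEqs.laplacian_eq (h : φ.ConformalEqs H) (hm : φ.MapsGerm f q f' q') :
    H (q, f q) * ∑ b, spaceDeriv b (spaceDeriv b f') q' =
      hatLaplacian φ.Psi (jet f q)
        + ((n : ℂ) - 2) / 2 * ∑ a, dx a (fun w => (H w : ℂ)) (q, f q) / H (q, f q)
            * totalDx a φ.Psi (jet f q)
        + (dpsi φ.Psi (q, f q) * ∑ a, spaceDeriv a (spaceDeriv a f) q
          + dpsiConj φ.Psi (q, f q) * conj (∑ a, spaceDeriv a (spaceDeriv a f) q)) := by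
  have hz := hm.2.2.1
  have hH := h.ne_zero hz
  have h1 := h.hatLaplacian_eq_sum hm
  have h2 : ∑ a, ∑ b, dx a (dx a (φ.X b)) (q, f q) * spaceDeriv b f' q' =
      -(((n : ℂ) - 2) / 2 * ∑ a, dx a (fun w => (H w : ℂ)) (q, f q) / H (q, f q)
            * totalDx a φ.Psi (jet f q)) := by
    calc _ = ∑ a, ∑ b, ∑ c, dx a (dx a (φ.X b)) (q, f q) * dx c (φ.X b) (q, f q) *
          (totalDx c φ.Psi (jet f q) / H (q, f q)) := by
          refine Finset.sum_congr rfl fun a _ => Finset.sum_congr rfl fun b _ => ?_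
          rw [h.spaceDeriv_eq hm, Finset.mul_sum]
          exact Finset.sum_congr rfl fun c _ => by ring
      _ = ∑ c, (∑ a, ∑ b, dx a (dx a (φ.X b)) (q, f q) * dx c (φ.X b) (q, f q)) *
          (totalDx c φ.Psi (jet f q) / H (q, f q)) := by
          simp only [Finset.sum_mul]
          rw [Finset.sum_congr rfl fun a _ => Finset.sum_comm, Finset.sum_comm]
      _ = _ := by
          simp only [h.sum_dx_dx hz]
          rw [Finset.mul_sum, ← Finset.sum_neg_distrib]
          exact Finset.sum_congr rfl fun c _ => by ring
  rw [h2] at h1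
  linear_combination -h1

/-- The left-hand side of an equation on the transformed function. -/
lemma ConformalEqs.residual_eq (h : φ.ConformalEqs H) (hm : φ.MapsGerm f q f' q') (g k : ℂ) :
    Complex.I * timeDeriv f' q' + g * ∑ b, spaceDeriv b (spaceDeriv b f') q' + k =
      Complex.I / dt φ.T (q, f q) * (dpsi φ.Psi (q, f q) * timeDeriv f q
        + dpsiConj φ.Psi (q, f q) * conj (timeDeriv f q))
      + g / H (q, f q) * (dpsi φ.Psi (q, f q) * ∑ a, spaceDeriv a (spaceDeriv a f) q
          + dpsiConj φ.Psi (q, f q) * conj (∑ a, spaceDeriv a (spaceDeriv a f) q))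
      + (k - φ.lowerTerms H (jet f q) g) := by
  have hz := hm.2.2.1
  have hH := h.ne_zero hz
  have hT := h.dt_ne_zero hz
  have h1 := h.laplacian_eq hm
  have h2 := h.dt_eq_sum hm
  have h3 : ∑ b, dt (φ.X b) (q, f q) * spaceDeriv b f' q' = ∑ b, ∑ a, dt (φ.X b) (q, f q) *
      (dx a (φ.X b) (q, f q) / H (q, f q)) * totalDx a φ.Psi (jet f q) := by
    refine Finset.sum_congr rfl fun b _ => ?_
    rw [h.spaceDeriv_eq hm, Finset.mul_sum]
    exact Finset.sum_congr rfl fun c _ => by ring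
  rw [h3] at h2
  rw [lowerTerms]
  change _ = _ + _ + (k - (-_ * (g / H (q, f q)) - Complex.I / dt φ.T (q, f q) *
    (dt φ.Psi (q, f q) - ∑ b, ∑ a, dt (φ.X b) (q, f q) *
      (dx a (φ.X b) (q, f q) / H (q, f q)) * totalDx a φ.Psi (jet f q))))
  have h4 : timeDeriv f' q' = (dt φ.T (q, f q))⁻¹ * (dt φ.T (q, f q) * timeDeriv f' q') := by
    field_simp
  have h5 : ∑ b, spaceDeriv b (spaceDeriv b f') q' =
      (H (q, f q) : ℂ)⁻¹ * (H (q, f q) * ∑ b, spaceDeriv b (spaceDeriv b f') q') := by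
    field_simp
  rw [h4, h5, h1, eq_sub_of_add_eq h2.symm]
  change _ = _ + _ + (k - (-(hatLaplacian φ.Psi (jet f q) + ((n : ℂ) - 2) / 2 *
    ∑ a, dx a (fun w => (H w : ℂ)) (q, f q) / H (q, f q) * totalDx a φ.Psi (jet f q)) * _ - _))
  ring

end PointTransf

/-! ### Action of conformal transformations on equations -/

namespace PointTransf
variable {φ : PointTransf n} {θ θ' : Eqn n} {H : VarSpace n → ℝ} {z : VarSpace n}
  {f f' : IndepVar n → ℂ} {q q' : IndepVar n}

/-- The Jacobian `|Ψ_ψ|² - |Ψ_{ψ*}|²`. -/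
def psiJac (φ : PointTransf n) (z : VarSpace n) : ℂ :=
  dpsi φ.Psi z * conj (dpsi φ.Psi z) - dpsiConj φ.Psi z * conj (dpsiConj φ.Psi z)

lemma ConformalEqs.vertical_injective (h : φ.ConformalEqs H) (hz : z ∈ φ.map.source) {w : ℂ}
    (hw : dpsi φ.Psi z * w + dpsiConj φ.Psi z * conj w = 0) : w = 0 := by
  rw [← fderiv_vertical, fderiv_Psi hz] at hw
  have h1 : fderiv ℝ φ.map z (0, w) = fderiv ℝ φ.map z 0 := by
    rw [map_zero]
    exact Prod.ext ((h.conformalAt hz).vertical w) hw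
  exact congrArg Prod.snd ((φ.fderiv_bijective hz).1 h1)

/-- The new independent variables do not depend on `ψ`, so invertibility of `φ` forces `w ↦ Ψ_ψ w +
Ψ_{ψ*} w*` to be injective, and the Jacobian is its real determinant. -/
lemma ConformalEqs.psiJac_ne_zero (h : φ.ConformalEqs H) (hz : z ∈ φ.map.source) :
    φ.psiJac z ≠ 0 := by
  intro h0
  rw [psiJac] at h0
  -- With zero determinant the adjugate map takes values in the kernel, hence vanishes; then both
  -- Wirtinger derivatives vanish.
  have h1 : ∀ c : ℂ, conj (dpsi φ.Psi z) * c - dpsiConj φ.Psi z * conj c = 0 := by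
    intro c
    refine h.vertical_injective hz ?_
    simp only [map_sub, map_mul, Complex.conj_conj]
    linear_combination c * h0
  have h2 := h1 1
  have h3 := h1 Complex.I
  simp only [map_one, mul_one, Complex.conj_I] at h2 h3
  have h4 : dpsiConj φ.Psi z = 0 := by
    have : 2 * Complex.I * dpsiConj φ.Psi z = 0 := by linear_combination h3 - Complex.I * h2
    simpa using this
  have h5 : dpsi φ.Psi z = 0 := by simpa [h4] using h2
  have h6 := h.vertical_injective hz (w := 1) (by simp [h4, h5])
  exact one_ne_zero h6

lemma ConformalEqs.dpsi_ne_zero_or (h : φ.ConformalEqs H) (hz : z ∈ φ.map.source) :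
    dpsi φ.Psi z ≠ 0 ∨ dpsiConj φ.Psi z ≠ 0 := by
  by_contra! h0
  exact h.psiJac_ne_zero hz (by simp [psiJac, h0.1, h0.2])

/-- A point of the jet space over the domain, together with values of `ψ_t` and `ψ_aa`, comes from
a function with an image under a conformal transformation. -/
lemma ConformalEqs.exists_mapsGerm (h : φ.ConformalEqs H) (a₀ : Fin n) {j : JetSpace n}
    (hj : j.1 ∈ φ.map.source) (τ S : ℂ) :
    ∃ f f', φ.MapsGerm f j.1.1 f' (φ.map j.1).1 ∧ jet f j.1.1 = j ∧
      timeDeriv f j.1.1 = τ ∧ ∑ a, spaceDeriv a (spaceDeriv a f) j.1.1 = S := by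
  obtain ⟨⟨q, c⟩, p⟩ := j
  set l := linearOfValues τ p with hl
  set B := formOfTrace a₀ S with hB
  have hsymm : ∀ u v, B u v = B v u := by
    intro u v; simp [hB, formOfTrace, sqForm_apply, mul_comm]
  -- For a conformal transformation the differential along a graph does not depend on its tangent
  -- map, so no genericity is needed here.
  have hL : Function.Injective fun v => (fderiv ℝ φ.map (q, c) (v, l v)).1 := by
    have h1 : Function.Surjective (φ.graphDiff (q, c) l) := by
      intro y
      obtain ⟨⟨v, w⟩, hv⟩ := (φ.fderiv_bijective hj).2 (y, 0)
      refine ⟨v, ?_⟩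
      have := congrArg Prod.fst hv
      rw [h.fst_fderiv hj] at this
      rw [graphDiff_apply, h.fst_fderiv hj]
      exact this
    exact LinearMap.injective_iff_surjective (f := (φ.graphDiff (q, c) l).toLinearMap).2 h1
  obtain ⟨f', hf'⟩ := PointTransf.exists_mapsGerm (φ := φ) (f := quadratic c l B q) (q := q)
    (contDiff_quadratic c l B q).contDiffAt (by rwa [quadratic_self])
    (by rw [fderiv_quadratic_self c l B q hsymm, quadratic_self]; exact hL)
  rw [quadratic_self] at hf'
  refine ⟨_, f', hf', ?_, ?_, ?_⟩
  · change jet (quadratic c l B q) q = _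
    rw [jet_quadratic c l B q hsymm]
    simp only [hl, linearOfValues_spaceVec]
  · change fderiv ℝ (quadratic c l B q) q timeVec = τ
    rw [fderiv_quadratic_self c l B q hsymm, hl, linearOfValues_timeVec]
  · simp only [spaceDeriv_spaceDeriv (contDiff_quadratic c l B q).contDiffAt]
    rw [fderiv_fderiv_quadratic c l B q hsymm, hB, sum_formOfTrace]

/-- The relation between the values `G`, `F` of the arbitrary elements of an equation at a jet and
the values `G'`, `F'` for its image. -/
def ArbRel (φ : PointTransf n) (H : VarSpace n → ℝ) (j : JetSpace n) (G F G' F' : ℂ) : Prop :=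
  (dpsi φ.Psi j.1 ≠ 0 → G' = H j.1 / dt φ.T j.1 * G) ∧
  (dpsiConj φ.Psi j.1 ≠ 0 → G' = H j.1 / dt φ.T j.1 * (-conj G)) ∧
  F' = dpsi φ.Psi j.1 / dt φ.T j.1 * F - dpsiConj φ.Psi j.1 / dt φ.T j.1 * conj F
    + φ.lowerTerms H j G'

lemma conj_dt_T (hz : z ∈ φ.map.source) : conj (dt φ.T z) = dt φ.T z := by
  rw [dt, fderiv_T hz, Complex.conj_ofReal]

/-- The arbitrary elements of equations related by a conformal transformation. -/
lemma MapsEqn.arbRel (hm : φ.MapsEqn θ θ') (h : φ.ConformalEqs H) (a₀ : Fin n) {j : JetSpace n}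
    (hj : j ∈ θ.dom) : φ.prolongJet H j ∈ θ'.dom ∧
      φ.ArbRel H j (θ.G j) (θ.F j) (θ'.G (φ.prolongJet H j)) (θ'.F (φ.prolongJet H j)) := by
  have hb : j.1 ∈ θ.base := ⟨j, hj, rfl⟩
  have hs := hm.1 hb
  have hT := h.dt_ne_zero hs
  have hH := h.ne_zero hs
  -- The test solution has Laplacian `S` and `ψ_t = i (G S + F)`, the value dictated by `θ`. The
  -- resulting identity is real-affine in the free number `S`.
  have key : ∀ S : ℂ, φ.prolongJet H j ∈ θ'.dom ∧
      Complex.I / dt φ.T j.1 * (dpsi φ.Psi j.1 * (Complex.I * (θ.G j * S + θ.F j))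
        + dpsiConj φ.Psi j.1 * conj (Complex.I * (θ.G j * S + θ.F j)))
      + θ'.G (φ.prolongJet H j) / H j.1 * (dpsi φ.Psi j.1 * S + dpsiConj φ.Psi j.1 * conj S)
      + (θ'.F (φ.prolongJet H j) - φ.lowerTerms H j (θ'.G (φ.prolongJet H j))) = 0 := by
    intro S
    obtain ⟨f, f', hg, hjet, hτ, hS⟩ := h.exists_mapsGerm a₀ hs
      (Complex.I * (θ.G j * S + θ.F j)) S
    have hf : (j.1.1, f j.1.1) = j.1 := congrArg Prod.fst hjet
    have hsol : θ.SolvedAt f j.1.1 := by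
      refine ⟨hjet ▸ hj, ?_⟩
      rw [hjet, hτ, hS]
      linear_combination (θ.G j * S + θ.F j) * Complex.I_sq
    have hsol' := (hm.2.2 _ _ _ _ hg (by rw [hf]; exact hb)).1 hsol
    have hres := h.residual_eq hg (θ'.G (φ.prolongJet H j)) (θ'.F (φ.prolongJet H j))
    rw [Eqn.SolvedAt, h.jet_eq hg, hjet] at hsol'
    refine ⟨hsol'.1, ?_⟩
    rw [hsol'.2, hf, hτ, hS, hjet] at hres
    exact hres.symm
  refine ⟨(key 0).1, ?_⟩
  have k0 := (key 0).2
  have k1 := (key 1).2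
  have kI := (key Complex.I).2
  simp only [map_mul, map_add, Complex.conj_I, map_zero, map_one] at k0 k1 kI
  set A := dpsi φ.Psi j.1
  set B := dpsiConj φ.Psi j.1
  set T := dt φ.T j.1
  set h' : ℂ := (H j.1 : ℂ)
  set G' := θ'.G (φ.prolongJet H j)
  set G := θ.G j
  -- Subtracting the case `S = 0` from `S = 1` and `S = i` separates the coefficients of `S` and
  -- `S*`; the case `S = 0` itself gives the formula for `F`.
  have e1 : A * (G' / h' - G / T) + B * (G' / h' + conj G / T) = 0 := by
    linear_combination k1 - k0 + (B * conj G / T - A * G / T) * Complex.I_sq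
  have e2 : A * (G' / h' - G / T) - B * (G' / h' + conj G / T) = 0 := by
    linear_combination -Complex.I * (kI - k0) + (A * (G' / h' - G / T) - B * (G' / h' + conj G / T)
      + (A * G / T + B * conj G / T) * Complex.I ^ 2) * Complex.I_sq
  have e3 : A * (G' / h' - G / T) = 0 := by linear_combination (e1 + e2) / 2
  have e4 : B * (G' / h' + conj G / T) = 0 := by linear_combination (e1 - e2) / 2
  refine ⟨fun hA => ?_, fun hB => ?_, ?_⟩
  · have := (mul_eq_zero.1 e3).resolve_left hA
    have h1 : G' / h' = G / T := sub_eq_zero.1 this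
    rw [div_eq_iff hH] at h1
    rw [h1]; ring
  · have := (mul_eq_zero.1 e4).resolve_left hB
    have h1 : G' / h' = -(conj G / T) := eq_neg_of_add_eq_zero_left this
    rw [div_eq_iff hH] at h1
    rw [h1]; ring
  · linear_combination k0 - (A / T * θ.F j - B / T * conj (θ.F j)) * Complex.I_sq

/-- The domains of equations related by a conformal transformation. -/
lemma MapsEqn.mem_dom (hm : φ.MapsEqn θ θ') (h : φ.ConformalEqs H) (a₀ : Fin n) {j : JetSpace n}
    (hb : j.1 ∈ θ.base) (hj : φ.prolongJet H j ∈ θ'.dom) : j ∈ θ.dom := by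
  have hs := hm.1 hb
  have hT := h.dt_ne_zero hs
  have hJ := h.psiJac_ne_zero hs
  set G' := θ'.G (φ.prolongJet H j)
  set F' := θ'.F (φ.prolongJet H j)
  set A := dpsi φ.Psi j.1 with hA
  set B := dpsiConj φ.Psi j.1 with hB
  set T := dt φ.T j.1
  -- With Laplacian zero, `ψ_t` is chosen by solving `Ψ_ψ τ + Ψ_{ψ*} τ* = r` so that the image
  -- satisfies `θ'`. The original then satisfies `θ`, and satisfying it includes lying in the
  -- domain.
  set r : ℂ := Complex.I * T * (F' - φ.lowerTerms H j G') with hr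
  obtain ⟨f, f', hg, hjet, hτ, hS⟩ := h.exists_mapsGerm a₀ hs
    ((conj A * r - B * conj r) / φ.psiJac j.1) 0
  have hf : (j.1.1, f j.1.1) = j.1 := congrArg Prod.fst hjet
  have hres := h.residual_eq hg G' F'
  rw [hf, hτ, hS, hjet] at hres
  have hJr : conj (φ.psiJac j.1) = φ.psiJac j.1 := by
    simp only [psiJac, map_sub, map_mul, Complex.conj_conj]; ring
  have e1 : A * ((conj A * r - B * conj r) / φ.psiJac j.1)
      + B * conj ((conj A * r - B * conj r) / φ.psiJac j.1) = r := by
    rw [map_div₀, hJr]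
    simp only [map_sub, map_mul, Complex.conj_conj]
    field_simp
    rw [psiJac, ← hA, ← hB]
    ring
  have hsol' : θ'.SolvedAt f' (φ.map j.1).1 := by
    rw [Eqn.SolvedAt, h.jet_eq hg, hjet]
    refine ⟨hj, ?_⟩
    rw [hres, e1, hr]
    simp only [map_zero, mul_zero, add_zero]
    change Complex.I / T * _ + _ = 0
    field_simp
    linear_combination (F' - φ.lowerTerms H j G') * Complex.I_sq
  have hsol := (hm.2.2 _ _ _ _ hg (by rw [hf]; exact hb)).2 hsol'
  exact hjet ▸ hsol.1

/-- A conformal transformation maps an equation to an equation whose arbitrary elements are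
suitably related to the initial ones. -/
lemma ConformalEqs.mapsEqn (h : φ.ConformalEqs H) (hb : θ.base ⊆ φ.map.source)
    (hinj : ∀ j ∈ Prod.fst ⁻¹' φ.map.source, ∀ j' ∈ Prod.fst ⁻¹' φ.map.source,
      φ.prolongJet H j = φ.prolongJet H j' → j = j')
    (hdom : θ'.dom = φ.prolongJet H '' θ.dom)
    (hrel : ∀ j ∈ θ.dom,
      φ.ArbRel H j (θ.G j) (θ.F j) (θ'.G (φ.prolongJet H j)) (θ'.F (φ.prolongJet H j))) :
    φ.MapsEqn θ θ' := by
  refine ⟨hb, ?_, ?_⟩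
  · rw [Eqn.base, Eqn.base, hdom, image_image, image_image]
    rfl
  · intro f q f' q' hg hq
    have hs := hb hq
    have hT := h.dt_ne_zero hs
    have hH := h.ne_zero hs
    have hdom' : jet f' q' ∈ θ'.dom ↔ jet f q ∈ θ.dom := by
      rw [h.jet_eq hg, hdom]
      constructor
      · rintro ⟨j, hj, hje⟩
        rwa [← hinj j (hb ⟨j, hj, rfl⟩) (jet f q) hs hje]
      · exact fun hj => ⟨_, hj, rfl⟩
    rw [Eqn.SolvedAt, Eqn.SolvedAt, hdom']
    refine and_congr_right fun hj => ?_
    have hrel := hrel _ hj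
    have hres := h.residual_eq hg (θ'.G (φ.prolongJet H (jet f q)))
      (θ'.F (φ.prolongJet H (jet f q)))
    rw [h.jet_eq hg, hres]
    obtain ⟨r1, r2, r3⟩ := hrel
    set G' := θ'.G (φ.prolongJet H (jet f q))
    set F' := θ'.F (φ.prolongJet H (jet f q))
    set G := θ.G (jet f q)
    set F := θ.F (jet f q)
    change dpsi φ.Psi (q, f q) ≠ 0 → G' = H (q, f q) / dt φ.T (q, f q) * G at r1
    change dpsiConj φ.Psi (q, f q) ≠ 0 → G' = H (q, f q) / dt φ.T (q, f q) * (-conj G) at r2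
    change F' = dpsi φ.Psi (q, f q) / dt φ.T (q, f q) * F
      - dpsiConj φ.Psi (q, f q) / dt φ.T (q, f q) * conj F + _ at r3
    set A := dpsi φ.Psi (q, f q)
    set B := dpsiConj φ.Psi (q, f q)
    set T := dt φ.T (q, f q)
    set h' : ℂ := (H (q, f q) : ℂ)
    set τ := timeDeriv f q
    set S := ∑ a, spaceDeriv a (spaceDeriv a f) q
    have e1 : A * (G' / h') = A * (G / T) := by
      by_cases hA : A = 0
      · simp [hA]
      · rw [r1 hA]; field_simp
    have e2 : B * (G' / h') = -(B * (conj G / T)) := by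
      by_cases hB : B = 0
      · simp [hB]
      · rw [r2 hB]; field_simp
    -- The new left-hand side is a nonzero multiple of the vertical differential of `Ψ` applied to
    -- `i` times the old one, so they vanish together.
    have e3 : Complex.I / T * (A * τ + B * conj τ) + G' / h' * (A * S + B * conj S)
        + (F' - φ.lowerTerms H (jet f q) G') = -(Complex.I / T) *
        (A * (Complex.I * (Complex.I * τ + G * S + F))
          + B * conj (Complex.I * (Complex.I * τ + G * S + F))) := by
      rw [r3]
      simp only [map_mul, map_add, Complex.conj_I]
      linear_combination S * e1 + conj S * e2 + ((A * F - B * conj F) / T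
        + (A * G * S - B * conj G * conj S) / T
        + (A * τ + B * conj τ) * Complex.I / T) * Complex.I_sq
    rw [e3]
    constructor
    · intro h0; rw [h0]; simp
    · intro h0
      have hI : -(Complex.I / T) ≠ 0 := by simpa using hT
      have := h.vertical_injective hs ((mul_eq_zero.1 h0).resolve_left hI)
      exact (mul_eq_zero.1 this).resolve_left Complex.I_ne_zero

end PointTransf

/-- A smooth family of diffeomorphisms of an open subset of the fibre over a diffeomorphism of the
base gives a diffeomorphism of the total space. -/
lemma exists_skewProduct {E V : Type*} [NormedAddCommGroup E] [NormedSpace ℝ E]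
    [NormedAddCommGroup V] [NormedSpace ℝ V] (φ : OpenPartialHomeomorph E E)
    (hφ : ContDiffOn ℝ ∞ φ φ.source) (hφ' : ContDiffOn ℝ ∞ φ.symm φ.target)
    {U : Set V} (hU : IsOpen U) (a b : E → V → V)
    (ha : ContDiffOn ℝ ∞ (fun x : E × V => a x.1 x.2) (φ.source ×ˢ U))
    (hb : ContDiffOn ℝ ∞ (fun x : E × V => b x.1 x.2) (φ.source ×ˢ U))
    (haU : ∀ z ∈ φ.source, ∀ v ∈ U, a z v ∈ U) (hbU : ∀ z ∈ φ.source, ∀ v ∈ U, b z v ∈ U)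
    (hab : ∀ z ∈ φ.source, ∀ v ∈ U, b z (a z v) = v)
    (hba : ∀ z ∈ φ.source, ∀ v ∈ U, a z (b z v) = v) :
    ∃ Φ : OpenPartialHomeomorph (E × V) (E × V), Φ.source = φ.source ×ˢ U ∧
      Φ.target = φ.target ×ˢ U ∧ (∀ x, Φ x = (φ x.1, a x.1 x.2)) ∧
      ContDiffOn ℝ ∞ Φ Φ.source ∧ ContDiffOn ℝ ∞ Φ.symm Φ.target := by
  have h1 : ContDiffOn ℝ ∞ (fun x : E × V => (φ x.1, a x.1 x.2)) (φ.source ×ˢ U) :=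
    (hφ.comp contDiff_fst.contDiffOn fun x hx => hx.1).prodMk ha
  have h2 : ContDiffOn ℝ ∞ (fun x : E × V => (φ.symm x.1, b (φ.symm x.1) x.2))
      (φ.target ×ˢ U) := by
    have h3 : ContDiffOn ℝ ∞ (fun x : E × V => φ.symm x.1) (φ.target ×ˢ U) :=
      hφ'.comp contDiff_fst.contDiffOn fun x hx => hx.1
    refine h3.prodMk ?_
    exact hb.comp (h3.prodMk contDiff_snd.contDiffOn)
      fun x hx => ⟨φ.map_target hx.1, hx.2⟩
  exact ⟨{ toFun := fun x => (φ x.1, a x.1 x.2)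
           invFun := fun x => (φ.symm x.1, b (φ.symm x.1) x.2)
           source := φ.source ×ˢ U
           target := φ.target ×ˢ U
           map_source' := fun x hx => ⟨φ.map_source hx.1, haU _ hx.1 _ hx.2⟩
           map_target' := fun x hx => ⟨φ.map_target hx.1, hbU _ (φ.map_target hx.1) _ hx.2⟩
           left_inv' := fun x hx => by
             simp only [φ.left_inv hx.1, hab _ hx.1 _ hx.2]
           right_inv' := fun x hx => by
             simp only [φ.right_inv hx.1, hba _ (φ.map_target hx.1) _ hx.2]
           open_source := φ.open_source.prod hU
           open_target := φ.open_target.prod hU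
           continuousOn_toFun := h1.continuousOn
           continuousOn_invFun := h2.continuousOn }, rfl, rfl, fun _ => rfl, h1, h2⟩

/-! ### Smoothness of the coefficients -/

section Smooth
variable {f : VarSpace n → ℂ} {s : Set (VarSpace n)}

lemma contDiffOn_fderiv_apply (hs : IsOpen s) (hf : ContDiffOn ℝ ∞ f s) (v : VarSpace n) :
    ContDiffOn ℝ ∞ (fun z => fderiv ℝ f z v) s :=
  (hf.fderiv_of_isOpen hs (by simp)).clm_apply contDiffOn_const

lemma contDiffOn_dt (hs : IsOpen s) (hf : ContDiffOn ℝ ∞ f s) : ContDiffOn ℝ ∞ (dt f) s :=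
  contDiffOn_fderiv_apply hs hf _

lemma contDiffOn_dx (hs : IsOpen s) (hf : ContDiffOn ℝ ∞ f s) (a : Fin n) :
    ContDiffOn ℝ ∞ (dx a f) s :=
  contDiffOn_fderiv_apply hs hf _

lemma contDiffOn_dpsi (hs : IsOpen s) (hf : ContDiffOn ℝ ∞ f s) : ContDiffOn ℝ ∞ (dpsi f) s :=
  ((contDiffOn_fderiv_apply hs hf _).sub
    (contDiffOn_const.mul (contDiffOn_fderiv_apply hs hf _))).div_const 2

lemma contDiffOn_dpsiConj (hs : IsOpen s) (hf : ContDiffOn ℝ ∞ f s) :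
    ContDiffOn ℝ ∞ (dpsiConj f) s :=
  ((contDiffOn_fderiv_apply hs hf _).add
    (contDiffOn_const.mul (contDiffOn_fderiv_apply hs hf _))).div_const 2

lemma _root_.ContDiffOn.conj {E : Type*} [NormedAddCommGroup E] [NormedSpace ℝ E] {f : E → ℂ}
    {s : Set E} (hf : ContDiffOn ℝ ∞ f s) : ContDiffOn ℝ ∞ (fun x => conj (f x)) s :=
  Complex.conjCLE.contDiff.comp_contDiffOn hf

lemma _root_.ContDiffOn.div_complex {E : Type*} [NormedAddCommGroup E] [NormedSpace ℝ E]
    {f g : E → ℂ} {s : Set E} (hf : ContDiffOn ℝ ∞ f s) (hg : ContDiffOn ℝ ∞ g s)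
    (h0 : ∀ x ∈ s, g x ≠ 0) : ContDiffOn ℝ ∞ (fun x => f x / g x) s := by
  simp only [div_eq_mul_inv]
  exact hf.mul (hg.inv h0)

variable {E : Type*} [NormedAddCommGroup E] [NormedSpace ℝ E] {S : Set E} {j : E → JetSpace n}

lemma contDiffOn_totalDx (hs : IsOpen s) (hf : ContDiffOn ℝ ∞ f s) (hj : ContDiffOn ℝ ∞ j S)
    (hjs : ∀ x ∈ S, (j x).1 ∈ s) (a : Fin n) : ContDiffOn ℝ ∞ (fun x => totalDx a f (j x)) S := by
  have c : ∀ {g : VarSpace n → ℂ}, ContDiffOn ℝ ∞ g s → ContDiffOn ℝ ∞ (fun x => g (j x).1) S :=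
    fun hg => hg.comp hj.fst hjs
  have hp : ContDiffOn ℝ ∞ (fun x => (j x).2 a) S :=
    (ContinuousLinearMap.proj (R := ℝ) (φ := fun _ : Fin n => ℂ) a).contDiff.comp_contDiffOn hj.snd
  exact ((c (contDiffOn_dx hs hf a)).add (hp.mul (c (contDiffOn_dpsi hs hf)))).add
    (hp.conj.mul (c (contDiffOn_dpsiConj hs hf)))

lemma contDiffOn_hatLaplacian (hs : IsOpen s) (hf : ContDiffOn ℝ ∞ f s) (hj : ContDiffOn ℝ ∞ j S)
    (hjs : ∀ x ∈ S, (j x).1 ∈ s) : ContDiffOn ℝ ∞ (fun x => hatLaplacian f (j x)) S := by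
  have c : ∀ {g : VarSpace n → ℂ}, ContDiffOn ℝ ∞ g s → ContDiffOn ℝ ∞ (fun x => g (j x).1) S :=
    fun hg => hg.comp hj.fst hjs
  have hp : ∀ a, ContDiffOn ℝ ∞ (fun x => (j x).2 a) S := fun a =>
    (ContinuousLinearMap.proj (R := ℝ) (φ := fun _ : Fin n => ℂ) a).contDiff.comp_contDiffOn hj.snd
  have h1 := contDiffOn_dpsi hs hf
  have h2 := contDiffOn_dpsiConj hs hf
  refine ContDiffOn.sum fun a _ => ?_
  have h3 := contDiffOn_dx hs (contDiffOn_dx hs hf a) a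
  exact (((((c h3).add ((contDiffOn_const.mul (hp a)).mul (c (contDiffOn_dx hs h1 a)))).add
    ((contDiffOn_const.mul (hp a).conj).mul (c (contDiffOn_dx hs h2 a)))).add
    (((hp a).pow 2).mul (c (contDiffOn_dpsi hs h1)))).add
    (((contDiffOn_const.mul (hp a)).mul (hp a).conj).mul (c (contDiffOn_dpsi hs h2)))).add
    (((hp a).conj.pow 2).mul (c (contDiffOn_dpsiConj hs h2)))

end Smooth

/-! ### Lifting conformal transformations to jets and arbitrary elements -/

namespace PointTransf
variable {φ : PointTransf n} {H : VarSpace n → ℝ} {z : VarSpace n}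

lemma contDiffOn_Psi : ContDiffOn ℝ ∞ φ.Psi φ.map.source := φ.smooth.snd

lemma contDiffOn_X (b : Fin n) : ContDiffOn ℝ ∞ (φ.X b) φ.map.source :=
  (coordX b).contDiff.comp_contDiffOn φ.smooth

lemma contDiffOn_T : ContDiffOn ℝ ∞ φ.T φ.map.source :=
  Complex.ofRealCLM.contDiff.comp_contDiffOn φ.smooth.fst.fst

lemma ConformalEqs.contDiffOn (h : φ.ConformalEqs H) :
    ContDiffOn ℝ ∞ (fun z => (H z : ℂ)) φ.map.source :=
  Complex.ofRealCLM.contDiff.comp_contDiffOn h.1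

lemma contDiffOn_psiJac : ContDiffOn ℝ ∞ φ.psiJac φ.map.source := by
  have h1 := contDiffOn_dpsi φ.map.open_source (contDiffOn_Psi (φ := φ))
  have h2 := contDiffOn_dpsiConj φ.map.open_source (contDiffOn_Psi (φ := φ))
  exact (h1.mul h1.conj).sub (h2.mul h2.conj)

lemma conj_psiJac (z : VarSpace n) : conj (φ.psiJac z) = φ.psiJac z := by
  simp only [psiJac, map_sub, map_mul, Complex.conj_conj]; ring

/-- The inverse of `w ↦ Ψ_ψ w + Ψ_{ψ*} w*`. -/
lemma ConformalEqs.vertical_inverse (h : φ.ConformalEqs H) (hz : z ∈ φ.map.source) (r : ℂ) :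
    let w := (conj (dpsi φ.Psi z) * r - dpsiConj φ.Psi z * conj r) / φ.psiJac z
    dpsi φ.Psi z * w + dpsiConj φ.Psi z * conj w = r := by
  have hJ := h.psiJac_ne_zero hz
  simp only [map_div₀, conj_psiJac, map_sub, map_mul, Complex.conj_conj]
  field_simp
  rw [psiJac]
  ring

/-- The first prolongation of a conformal transformation is a diffeomorphism. -/
lemma ConformalEqs.exists_prolongJet (h : φ.ConformalEqs H) :
    ∃ J : OpenPartialHomeomorph (JetSpace n) (JetSpace n),
      J.source = Prod.fst ⁻¹' φ.map.source ∧ J.target = Prod.fst ⁻¹' φ.map.target ∧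
      (∀ j, J j = φ.prolongJet H j) ∧
      ContDiffOn ℝ ∞ J J.source ∧ ContDiffOn ℝ ∞ J.symm J.target := by
  set s := φ.map.source with hs
  have hso : IsOpen s := φ.map.open_source
  have hPsi : ContDiffOn ℝ ∞ φ.Psi s := contDiffOn_Psi
  let a : VarSpace n → (Fin n → ℂ) → (Fin n → ℂ) := fun z p b =>
    ∑ a, dx a (φ.X b) z / H z * totalDx a φ.Psi (z, p)
  -- The old gradient is recovered from `Ψ_ψ ψ_a + Ψ_{ψ*} ψ*_a = r_a`, which is the chain rule `D_aΨ
  -- = X^b_a ψ̃_b` with `Ψ_a` moved to the right.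
  let r : VarSpace n → (Fin n → ℂ) → Fin n → ℂ := fun z p a =>
    ∑ b, dx a (φ.X b) z * p b - dx a φ.Psi z
  let b : VarSpace n → (Fin n → ℂ) → (Fin n → ℂ) := fun z p a =>
    (conj (dpsi φ.Psi z) * r z p a - dpsiConj φ.Psi z * conj (r z p a)) / φ.psiJac z
  have c : ∀ {g : VarSpace n → ℂ}, ContDiffOn ℝ ∞ g s →
      ContDiffOn ℝ ∞ (fun x : JetSpace n => g x.1) (s ×ˢ univ) :=
    fun hg => hg.comp contDiff_fst.contDiffOn fun x hx => hx.1
  have ha : ContDiffOn ℝ ∞ (fun x : JetSpace n => a x.1 x.2) (s ×ˢ univ) := by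
    refine contDiffOn_pi.2 fun b => ContDiffOn.sum fun a _ => ?_
    exact ((c (contDiffOn_dx hso (contDiffOn_X b) a)).div_complex (c h.contDiffOn)
      fun x hx => h.ne_zero hx.1).mul
      (contDiffOn_totalDx (j := fun x => x) hso hPsi contDiffOn_id (fun x hx => hx.1) a)
  have hr : ∀ a, ContDiffOn ℝ ∞ (fun x : JetSpace n => r x.1 x.2 a) (s ×ˢ univ) := by
    intro a
    refine ContDiffOn.sub (ContDiffOn.sum fun b _ => ?_) (c (contDiffOn_dx hso hPsi a))
    exact (c (contDiffOn_dx hso (contDiffOn_X b) a)).mul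
      ((ContinuousLinearMap.proj (R := ℝ) (φ := fun _ : Fin n => ℂ) b).contDiff.comp
        contDiff_snd).contDiffOn
  have hb : ContDiffOn ℝ ∞ (fun x : JetSpace n => b x.1 x.2) (s ×ˢ univ) := by
    refine contDiffOn_pi.2 fun a => ?_
    exact (((c (contDiffOn_dpsi hso hPsi)).conj.mul (hr a)).sub
      ((c (contDiffOn_dpsiConj hso hPsi)).mul (hr a).conj)).div_complex (c contDiffOn_psiJac)
      fun x hx => h.psiJac_ne_zero hx.1
  have hab : ∀ z ∈ s, ∀ p ∈ univ, b z (a z p) = p := by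
    intro z hz p _
    have hH := h.ne_zero hz
    have hJ := h.psiJac_ne_zero hz
    funext i
    have e1 : ∑ b, dx i (φ.X b) z * a z p b = totalDx i φ.Psi (z, p) := by
      simp only [a, Finset.mul_sum]
      rw [Finset.sum_comm]
      have : ∀ k, ∑ b, dx i (φ.X b) z * (dx k (φ.X b) z / H z * totalDx k φ.Psi (z, p)) =
          (if i = k then (H z : ℂ) else 0) * (totalDx k φ.Psi (z, p) / H z) := by
        intro k
        rw [← h.orth' hz, Finset.sum_mul]
        exact Finset.sum_congr rfl fun b _ => by ring
      simp only [this]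
      simp [mul_div_cancel₀ _ hH]
    have e2 : r z (a z p) i = dpsi φ.Psi z * p i + dpsiConj φ.Psi z * conj (p i) := by
      simp only [r, e1, totalDx]; ring
    simp only [b, e2, map_add, map_mul, Complex.conj_conj]
    rw [div_eq_iff hJ, psiJac]
    ring
  have hba : ∀ z ∈ s, ∀ p ∈ univ, a z (b z p) = p := by
    intro z hz p _
    have hH := h.ne_zero hz
    funext i
    have e1 : ∀ k, totalDx k φ.Psi (z, b z p) = ∑ b, dx k (φ.X b) z * p b := by
      intro k
      have := h.vertical_inverse hz (r z p k)
      simp only [totalDx]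
      change dpsi φ.Psi z * b z p k + dpsiConj φ.Psi z * conj (b z p k) = r z p k at this
      have h6 : r z p k = ∑ b, dx k (φ.X b) z * p b - dx k φ.Psi z := rfl
      linear_combination this + h6
    simp only [a, e1, Finset.mul_sum]
    rw [Finset.sum_comm]
    have : ∀ k, ∑ c, dx c (φ.X i) z / H z * (dx c (φ.X k) z * p k) =
        (if i = k then (H z : ℂ) else 0) * (p k / H z) := by
      intro k
      rw [← h.orth hz, Finset.sum_mul]
      exact Finset.sum_congr rfl fun b _ => by ring
    simp only [this]
    simp [mul_div_cancel₀ _ hH]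
  obtain ⟨J, h1, h2, h3, h4, h5⟩ := exists_skewProduct φ.map φ.smooth φ.smooth_symm isOpen_univ a b
    ha hb (fun _ _ _ _ => mem_univ _) (fun _ _ _ _ => mem_univ _) hab hba
  refine ⟨J, ?_, ?_, h3, h4, h5⟩
  · rw [h1]; ext; simp [hs]
  · rw [h2]; ext; simp

/-- The action on the arbitrary elements; `χ = 1` corresponds to `G̃ = (H / T_t) G` and `χ = 0` to
`G̃ = -(H / T_t) G*`. -/
def arbMap (φ : PointTransf n) (H : VarSpace n → ℝ) (χ : VarSpace n → ℂ) (j : JetSpace n)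
    (g : ℂ × ℂ) : ℂ × ℂ :=
  let G' := H j.1 / dt φ.T j.1 * (χ j.1 * g.1 - (1 - χ j.1) * conj g.1)
  (G', dpsi φ.Psi j.1 / dt φ.T j.1 * g.2 - dpsiConj φ.Psi j.1 / dt φ.T j.1 * conj g.2
    + φ.lowerTerms H j G')

lemma ConformalEqs.contDiffOn_lowerTerms (h : φ.ConformalEqs H) {E : Type*} [NormedAddCommGroup E]
    [NormedSpace ℝ E] {S : Set E} {j : E → JetSpace n} {g : E → ℂ} (hj : ContDiffOn ℝ ∞ j S)
    (hg : ContDiffOn ℝ ∞ g S) (hjs : ∀ x ∈ S, (j x).1 ∈ φ.map.source) :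
    ContDiffOn ℝ ∞ (fun x => φ.lowerTerms H (j x) (g x)) S := by
  have hso : IsOpen φ.map.source := φ.map.open_source
  have hPsi : ContDiffOn ℝ ∞ φ.Psi φ.map.source := contDiffOn_Psi
  have c : ∀ {g : VarSpace n → ℂ}, ContDiffOn ℝ ∞ g φ.map.source →
      ContDiffOn ℝ ∞ (fun x => g (j x).1) S := fun hg => hg.comp hj.fst hjs
  have hH := c h.contDiffOn
  have hH0 : ∀ x ∈ S, (H (j x).1 : ℂ) ≠ 0 := fun x hx => h.ne_zero (hjs x hx)
  have hD := contDiffOn_totalDx hso hPsi hj hjs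
  refine ContDiffOn.sub (ContDiffOn.mul (ContDiffOn.neg (ContDiffOn.add
    (contDiffOn_hatLaplacian hso hPsi hj hjs) (contDiffOn_const.mul
      (ContDiffOn.sum fun a _ => ?_)))) (hg.div_complex hH hH0))
    (ContDiffOn.mul (contDiffOn_const.div_complex (c (contDiffOn_dt hso contDiffOn_T))
      fun x hx => h.dt_ne_zero (hjs x hx)) (ContDiffOn.sub (c (contDiffOn_dt hso hPsi))
      (ContDiffOn.sum fun b _ => ContDiffOn.sum fun a _ => ?_)))
  · exact ((c (contDiffOn_dx hso h.contDiffOn a)).div_complex hH hH0).mul (hD a)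
  · exact ((c (contDiffOn_dt hso (contDiffOn_X b))).mul
      ((c (contDiffOn_dx hso (contDiffOn_X b) a)).div_complex hH hH0)).mul (hD a)

/-- Existence of transformations of arbitrary elements over a conformal transformation. -/
lemma ConformalEqs.exists_totalTransf (h : φ.ConformalEqs H) {χ : VarSpace n → ℂ}
    (hχ : ContDiffOn ℝ ∞ χ φ.map.source) (hχ01 : ∀ z ∈ φ.map.source, χ z = 0 ∨ χ z = 1) :
    ∃ Φ : TotalTransf n, Φ.base = φ ∧
      ∀ e, Φ.map e = (φ.prolongJet H e.1, φ.arbMap H χ e.1 e.2) := by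
  obtain ⟨J, hJs, hJt, hJ, hJ1, hJ2⟩ := h.exists_prolongJet
  have hso : IsOpen φ.map.source := φ.map.open_source
  have hPsi : ContDiffOn ℝ ∞ φ.Psi φ.map.source := contDiffOn_Psi
  set U : Set (ℂ × ℂ) := {g | g.1 ≠ 0} with hUdef
  have hU : IsOpen U := isOpen_ne_fun continuous_fst continuous_const
  have hsrc : ∀ {j : JetSpace n}, j ∈ J.source → j.1 ∈ φ.map.source := by
    intro j hj; rwa [hJs] at hj
  have c : ∀ {g : VarSpace n → ℂ}, ContDiffOn ℝ ∞ g φ.map.source →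
      ContDiffOn ℝ ∞ (fun x : TotalSpace n => g x.1.1) (J.source ×ˢ U) :=
    fun hg => hg.comp (contDiff_fst.comp contDiff_fst).contDiffOn fun x hx => hsrc hx.1
  have cT := c (contDiffOn_dt hso (contDiffOn_T (φ := φ)))
  have cT0 : ∀ x ∈ (J.source ×ˢ U : Set (TotalSpace n)), dt φ.T x.1.1 ≠ 0 :=
    fun x hx => h.dt_ne_zero (hsrc hx.1)
  have cH := c h.contDiffOn
  have cH0 : ∀ x ∈ (J.source ×ˢ U : Set (TotalSpace n)), (H x.1.1 : ℂ) ≠ 0 :=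
    fun x hx => h.ne_zero (hsrc hx.1)
  have cχ := c hχ
  have cA := c (contDiffOn_dpsi hso hPsi)
  have cB := c (contDiffOn_dpsiConj hso hPsi)
  have cj : ContDiffOn ℝ ∞ (fun x : TotalSpace n => x.1) (J.source ×ˢ U) := contDiff_fst.contDiffOn
  have cG : ContDiffOn ℝ ∞ (fun x : TotalSpace n => x.2.1) (J.source ×ˢ U) :=
    (contDiff_fst.comp contDiff_snd).contDiffOn
  have cF : ContDiffOn ℝ ∞ (fun x : TotalSpace n => x.2.2) (J.source ×ˢ U) :=
    (contDiff_snd.comp contDiff_snd).contDiffOn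
  -- The fibre inverse: the new `G` fixes the lower-order terms, and `F` then solves `Ψ_ψ F - Ψ_{ψ*}
  -- F* = r`. The minus sign there explains the plus sign in the numerator.
  let b : JetSpace n → ℂ × ℂ → ℂ × ℂ := fun j g =>
    (dt φ.T j.1 / H j.1 * (χ j.1 * g.1 - (1 - χ j.1) * conj g.1),
      (conj (dpsi φ.Psi j.1) * (dt φ.T j.1 * (g.2 - φ.lowerTerms H j g.1))
        + dpsiConj φ.Psi j.1 * conj (dt φ.T j.1 * (g.2 - φ.lowerTerms H j g.1))) / φ.psiJac j.1)
  have cχG := (cχ.mul cG).sub ((contDiffOn_const (c := (1 : ℂ)).sub cχ).mul cG.conj)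
  have cG' := (cH.div_complex cT cT0).mul cχG
  have ha : ContDiffOn ℝ ∞ (fun x : TotalSpace n => φ.arbMap H χ x.1 x.2) (J.source ×ˢ U) :=
    cG'.prodMk ((((cA.div_complex cT cT0).mul cF).sub ((cB.div_complex cT cT0).mul cF.conj)).add
      (h.contDiffOn_lowerTerms cj cG' fun x hx => hsrc hx.1))
  have cr := cT.mul (cF.sub (h.contDiffOn_lowerTerms cj cG fun x hx => hsrc hx.1))
  have hb : ContDiffOn ℝ ∞ (fun x : TotalSpace n => b x.1 x.2) (J.source ×ˢ U) :=
    ((cT.div_complex cH cH0).mul cχG).prodMk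
      (((cA.conj.mul cr).add (cB.mul cr.conj)).div_complex (c contDiffOn_psiJac)
        fun x hx => h.psiJac_ne_zero (hsrc hx.1))
  have hne : ∀ z ∈ φ.map.source, ∀ G : ℂ, G ≠ 0 → χ z * G - (1 - χ z) * conj G ≠ 0 := by
    intro z hz G hG
    rcases hχ01 z hz with h0 | h0 <;> simpa [h0] using hG
  -- Both `G ↦ G` and `G ↦ -G*` are involutions commuting with multiplication by reals, so the same
  -- `χ` serves for the inverse.
  have hinv : ∀ z ∈ φ.map.source, ∀ k G : ℂ, conj k = k →
      χ z * (k * (χ z * G - (1 - χ z) * conj G))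
        - (1 - χ z) * conj (k * (χ z * G - (1 - χ z) * conj G)) = k * G := by
    intro z hz k G hk
    rcases hχ01 z hz with h0 | h0 <;> simp [h0, hk]
  have hkc : ∀ z ∈ φ.map.source, conj ((H z : ℂ) / dt φ.T z) = (H z : ℂ) / dt φ.T z := by
    intro z hz; rw [map_div₀, Complex.conj_ofReal, conj_dt_T hz]
  have hkc' : ∀ z ∈ φ.map.source, conj (dt φ.T z / (H z : ℂ)) = dt φ.T z / (H z : ℂ) := by
    intro z hz; rw [map_div₀, Complex.conj_ofReal, conj_dt_T hz]
  have haU : ∀ j ∈ J.source, ∀ g ∈ U, φ.arbMap H χ j g ∈ U := by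
    intro j hj g hg
    have hz := hsrc hj
    exact mul_ne_zero (div_ne_zero (h.ne_zero hz) (h.dt_ne_zero hz)) (hne _ hz _ hg)
  have hbU : ∀ j ∈ J.source, ∀ g ∈ U, b j g ∈ U := by
    intro j hj g hg
    have hz := hsrc hj
    exact mul_ne_zero (div_ne_zero (h.dt_ne_zero hz) (h.ne_zero hz)) (hne _ hz _ hg)
  have hab : ∀ j ∈ J.source, ∀ g ∈ U, b j (φ.arbMap H χ j g) = g := by
    rintro j hj ⟨G, F⟩ hg
    have hz := hsrc hj
    have hT := h.dt_ne_zero hz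
    have hH := h.ne_zero hz
    have hJ0 := h.psiJac_ne_zero hz
    ext1
    · simp only [b, arbMap]
      rw [hinv _ hz _ _ (hkc _ hz)]
      field_simp
    · simp only [b, arbMap, add_sub_cancel_right]
      rw [div_eq_iff hJ0, psiJac]
      simp only [map_mul, map_sub, map_div₀, Complex.conj_conj, conj_dt_T hz]
      field_simp
      ring
  have hba : ∀ j ∈ J.source, ∀ g ∈ U, φ.arbMap H χ j (b j g) = g := by
    rintro j hj ⟨G, F⟩ hg
    have hz := hsrc hj
    have hT := h.dt_ne_zero hz
    have hH := h.ne_zero hz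
    have hJ0 := h.psiJac_ne_zero hz
    have e1 : (φ.arbMap H χ j (b j (G, F))).1 = G := by
      simp only [b, arbMap]
      rw [hinv _ hz _ _ (hkc' _ hz)]
      field_simp
    ext1
    · exact e1
    · have e2 : (φ.arbMap H χ j (b j (G, F))).2 = dpsi φ.Psi j.1 / dt φ.T j.1 * (b j (G, F)).2
          - dpsiConj φ.Psi j.1 / dt φ.T j.1 * conj (b j (G, F)).2
          + φ.lowerTerms H j (φ.arbMap H χ j (b j (G, F))).1 := rfl
      rw [e2, e1]
      simp only [b, map_div₀, conj_psiJac, map_add, map_mul, Complex.conj_conj, conj_dt_T hz]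
      rw [← eq_sub_iff_add_eq]
      field_simp
      rw [psiJac]
      ring
  obtain ⟨Φ, h1, h2, h3, h4, h5⟩ := exists_skewProduct J hJ1 hJ2 hU (φ.arbMap H χ) b ha hb
    haU hbU hab hba
  refine ⟨⟨φ, Φ, h4, h5, ?_, ?_, ?_, ?_, ?_⟩, rfl, fun e => ?_⟩
  · rw [h1, hJs]; rfl
  · rw [h2, hJt]; rfl
  · intro e _; rw [h3, hJ]; rfl
  · intro e _ e' _ hee; rw [h3, h3, hee]
  · intro f q f' q' hm G F _
    rw [h3, hJ, h.jet_eq hm]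
  · rw [← hJ]; exact h3 e

end PointTransf

/-! ### The relation between old and new arbitrary elements -/

namespace PointTransf
variable {φ : PointTransf n} {H : VarSpace n → ℝ} {j : JetSpace n} {G F G' F' G'' F'' : ℂ}

lemma ArbRel.unique (h₁ : φ.ArbRel H j G F G' F') (h₂ : φ.ArbRel H j G F G'' F'')
    (h : φ.ConformalEqs H) (hj : j.1 ∈ φ.map.source) : G' = G'' ∧ F' = F'' := by
  have hG : G' = G'' := by
    rcases h.dpsi_ne_zero_or hj with h0 | h0
    · rw [h₁.1 h0, h₂.1 h0]
    · rw [h₁.2.1 h0, h₂.2.1 h0]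
  exact ⟨hG, by rw [h₁.2.2, h₂.2.2, hG]⟩

/-- Multiplication by the nonzero real `H / T_t` and the reflection `G ↦ -G*` both preserve the
imaginary axis and its complement. -/
lemma ArbRel.conj_eq_neg_iff (hr : φ.ArbRel H j G F G' F') (h : φ.ConformalEqs H)
    (hj : j.1 ∈ φ.map.source) : conj G' = -G' ↔ conj G = -G := by
  have hT := h.dt_ne_zero hj
  have hH := h.ne_zero hj
  have hk : (H j.1 : ℂ) / dt φ.T j.1 ≠ 0 := div_ne_zero hH hT
  have hkc : conj ((H j.1 : ℂ) / dt φ.T j.1) = (H j.1 : ℂ) / dt φ.T j.1 := by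
    rw [map_div₀, Complex.conj_ofReal, conj_dt_T hj]
  rcases h.dpsi_ne_zero_or hj with h0 | h0
  · rw [hr.1 h0, map_mul, hkc, ← mul_neg]
    exact mul_right_inj' hk
  · rw [hr.2.1 h0, map_mul, hkc, ← mul_neg, mul_right_inj' hk, map_neg, Complex.conj_conj, neg_neg]
    exact eq_comm

/-- The transformations `arbMap` have the required form where `χ` is compatible with the
derivatives of `Ψ`, or `G` is imaginary. -/
lemma arbRel_arbMap {χ : VarSpace n → ℂ}
    (h1 : dpsi φ.Psi j.1 ≠ 0 → χ j.1 = 1 ∨ conj G = -G)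
    (h2 : dpsiConj φ.Psi j.1 ≠ 0 → χ j.1 = 0 ∨ conj G = -G) :
    φ.ArbRel H j G F (φ.arbMap H χ j (G, F)).1 (φ.arbMap H χ j (G, F)).2 := by
  refine ⟨fun h0 => ?_, fun h0 => ?_, rfl⟩
  · rcases h1 h0 with h3 | h3 <;> simp [arbMap, h3]
    left; ring
  · rcases h2 h0 with h3 | h3 <;> simp [arbMap, h3]
    left; ring

lemma continuous_lowerTerms (φ : PointTransf n) (H : VarSpace n → ℝ) (j : JetSpace n) :
    Continuous (φ.lowerTerms H j) := by
  unfold lowerTerms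
  fun_prop

/-- Used to extend the formulas from non-imaginary `G` to imaginary `G` by continuity. The
conditions on `Ψ_ψ` and `Ψ_{ψ*}` do not involve the varying values, so at a fixed jet each
implication is either vacuous or a closed equation. -/
lemma isClosed_arbRel (φ : PointTransf n) (H : VarSpace n → ℝ) (j : JetSpace n) (F : ℂ) :
    IsClosed {x : ℂ × ℂ × ℂ | φ.ArbRel H j x.1 F x.2.1 x.2.2} := by
  have himp : ∀ {p : Prop} {f g : ℂ × ℂ × ℂ → ℂ}, Continuous f → Continuous g →
      IsClosed {x | p → f x = g x} := by
    intro p f g hf hg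
    by_cases hp : p
    · simpa [hp] using isClosed_eq hf hg
    · simp [hp]
  have hc := φ.continuous_lowerTerms H j
  have hconj : Continuous fun x : ℂ × ℂ × ℂ => conj x.1 :=
    Complex.continuous_conj.comp continuous_fst
  refine (himp ?_ ?_).inter ((himp ?_ ?_).inter (isClosed_eq ?_ ?_))
  all_goals fun_prop

end PointTransf

/-! ### Images of equations under transformations of the total space -/

namespace TotalTransf
variable {Φ : TotalTransf n} {H : VarSpace n → ℝ} {e : TotalSpace n} {θ θ' : Eqn n}

open PointTransf

lemma formAt_iff : (Φ.GFormAt H e ∧ Φ.FFormAt H e) ↔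
    Φ.base.ArbRel H e.1 e.2.1 e.2.2 (Φ.map e).2.1 (Φ.map e).2.2 := by
  rw [GFormAt, FFormAt, ArbRel, and_assoc, lowerTerms]
  refine and_congr_right fun _ => and_congr_right fun _ => ?_
  constructor <;> intro h0 <;> rw [h0] <;> ring

lemma mem_source : e ∈ Φ.map.source ↔ e.1.1 ∈ Φ.base.map.source ∧ e.2.1 ≠ 0 := by
  rw [Φ.source_eq]; rfl

/-- Every jet over the source is the jet of a function with an image, so compatibility with
prolongation on graphs determines the jet component everywhere. -/
lemma map_fst (h : Φ.base.ConformalEqs H) (a₀ : Fin n) (he : e ∈ Φ.map.source) :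
    (Φ.map e).1 = Φ.base.prolongJet H e.1 := by
  obtain ⟨h1, h2⟩ := mem_source.1 he
  obtain ⟨f, f', hm, hjet, -, -⟩ := h.exists_mapsGerm a₀ h1 0 0
  have := Φ.prolong _ _ _ _ hm e.2.1 e.2.2 h2
  rwa [h.jet_eq hm, hjet] at this

lemma map_ne_zero (he : e ∈ Φ.map.source) : (Φ.map e).2.1 ≠ 0 := by
  have := Φ.map.map_source he
  rw [Φ.target_eq] at this
  exact this.2

/-- The image of an equation under a transformation of the required form. -/
lemma exists_image (h : Φ.base.ConformalEqs H) (a₀ : Fin n) (hθ : θ ∈ classN n)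
    (hb : θ.base ⊆ Φ.base.map.source)
    (hrel : ∀ j ∈ θ.dom, Φ.base.ArbRel H j (θ.G j) (θ.F j)
      (Φ.map (j, (θ.G j, θ.F j))).2.1 (Φ.map (j, (θ.G j, θ.F j))).2.2) :
    ∃ θ' ∈ classN n, Φ.MapsArb θ θ' ∧ Φ.base.MapsEqn θ θ' ∧
      ∀ j' ∈ θ'.dom, ∃ j ∈ θ.dom, Φ.base.ArbRel H j (θ.G j) (θ.F j) (θ'.G j') (θ'.F j') := by
  obtain ⟨J, hJs, hJt, hJ, hJ1, hJ2⟩ := h.exists_prolongJet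
  obtain ⟨ho, hne, hG, hF, hG0⟩ := hθ
  have hJe : (J : JetSpace n → JetSpace n) = Φ.base.prolongJet H := funext hJ
  have hsub : θ.dom ⊆ J.source := by
    rw [hJs]; exact fun j hj => hb ⟨j, hj, rfl⟩
  let E : JetSpace n → TotalSpace n := fun j => Φ.map (j, (θ.G j, θ.F j))
  have hsrc : ∀ j ∈ θ.dom, (j, (θ.G j, θ.F j)) ∈ Φ.map.source := fun j hj =>
    mem_source.2 ⟨hb ⟨j, hj, rfl⟩, hG0 j hj⟩
  have hE : ContDiffOn ℝ ∞ E θ.dom :=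
    Φ.smooth.comp (contDiffOn_id.prodMk (hG.prodMk hF)) hsrc
  have hsymm : ∀ j ∈ θ.dom, J.symm (Φ.base.prolongJet H j) = j := by
    intro j hj
    rw [← hJ]; exact J.left_inv (hsub hj)
  have hEs : ContDiffOn ℝ ∞ (fun j' => E (J.symm j')) (J '' θ.dom) := by
    refine hE.comp (hJ2.mono ?_) ?_
    · rintro _ ⟨j, hj, rfl⟩
      exact J.map_source (hsub hj)
    · rintro _ ⟨j, hj, rfl⟩
      rw [J.left_inv (hsub hj)]; exact hj
  let θ' : Eqn n := ⟨J '' θ.dom, fun j' => (E (J.symm j')).2.1, fun j' => (E (J.symm j')).2.2⟩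
  have hG' : ∀ j ∈ θ.dom, θ'.G (Φ.base.prolongJet H j) = (E j).2.1 := by
    intro j hj
    change (E (J.symm _)).2.1 = _
    rw [hsymm j hj]
  have hF' : ∀ j ∈ θ.dom, θ'.F (Φ.base.prolongJet H j) = (E j).2.2 := by
    intro j hj
    change (E (J.symm _)).2.2 = _
    rw [hsymm j hj]
  refine ⟨θ', ⟨J.isOpen_image_of_subset_source ho hsub, hne.image _, hEs.snd.fst, hEs.snd.snd, ?_⟩,
    ?_, ?_, ?_⟩
  · rintro _ ⟨j, hj, rfl⟩
    rw [hJ, hG' j hj]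
    exact map_ne_zero (hsrc j hj)
  · rw [MapsArb, Eqn.graph, Eqn.graph]
    change _ = (fun j => (j, (θ'.G j, θ'.F j))) '' (J '' θ.dom)
    rw [image_image, image_image]
    refine image_congr fun j hj => ?_
    rw [hJ, hG' j hj, hF' j hj, ← map_fst h a₀ (hsrc j hj)]
  · refine h.mapsEqn hb ?_ (by rw [← hJe]) ?_
    · intro j hj j' hj' hjj
      rw [← hJ, ← hJ] at hjj
      exact J.injOn (by rwa [hJs]) (by rwa [hJs]) hjj
    · intro j hj
      rw [hG' j hj, hF' j hj]
      exact hrel j hj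
  · rintro _ ⟨j, hj, rfl⟩
    refine ⟨j, hj, ?_⟩
    rw [hJ, hG' j hj, hF' j hj]
    exact hrel j hj

/-- A transformation of the required form induces each admissible transformation with the same
projection. -/
lemma mapsArb (h : Φ.base.ConformalEqs H) (a₀ : Fin n) (hm : Φ.base.MapsEqn θ θ')
    (hG0 : ∀ j ∈ θ.dom, θ.G j ≠ 0)
    (hrel : ∀ j ∈ θ.dom, Φ.base.ArbRel H j (θ.G j) (θ.F j)
      (Φ.map (j, (θ.G j, θ.F j))).2.1 (Φ.map (j, (θ.G j, θ.F j))).2.2) :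
    Φ.MapsArb θ θ' := by
  obtain ⟨J, hJs, hJt, hJ, hJ1, hJ2⟩ := h.exists_prolongJet
  have hval : ∀ j ∈ θ.dom, Φ.map (j, (θ.G j, θ.F j)) = (Φ.base.prolongJet H j,
      (θ'.G (Φ.base.prolongJet H j), θ'.F (Φ.base.prolongJet H j))) := by
    intro j hj
    have hs : j.1 ∈ Φ.base.map.source := hm.1 ⟨j, hj, rfl⟩
    obtain ⟨h1, h2⟩ := (hrel j hj).unique (hm.arbRel h a₀ hj).2 h hs
    exact Prod.ext (map_fst h a₀ (mem_source.2 ⟨hs, hG0 j hj⟩)) (Prod.ext h1 h2)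
  apply Subset.antisymm
  · rintro _ ⟨_, ⟨j, hj, rfl⟩, rfl⟩
    exact ⟨_, (hm.arbRel h a₀ hj).1, (hval j hj).symm⟩
  · rintro _ ⟨j', hj', rfl⟩
    have hb : j'.1 ∈ Φ.base.map '' θ.base := by
      rw [hm.2.1]; exact ⟨j', hj', rfl⟩
    obtain ⟨z, hz, hzj⟩ := hb
    have ht : j' ∈ J.target := by
      rw [hJt]
      change j'.1 ∈ Φ.base.map.target
      rw [← hzj]; exact Φ.base.map.map_source (hm.1 hz)
    have hjs : (J.symm j').1 ∈ Φ.base.map.source := by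
      have := J.map_target ht
      rwa [hJs] at this
    have hJj : Φ.base.prolongJet H (J.symm j') = j' := by rw [← hJ, J.right_inv ht]
    have hz' : (J.symm j').1 = z := by
      refine Φ.base.map.injOn hjs (hm.1 hz) ?_
      rw [hzj]; exact congrArg Prod.fst hJj
    -- `MapsEqn` gives equality of the projected domains only; that the jet itself lies in the
    -- domain requires the solution test behind `mem_dom`.
    have hj : J.symm j' ∈ θ.dom :=
      hm.mem_dom h a₀ (by rw [hz']; exact hz) (by rwa [hJj])
    refine ⟨_, ⟨_, hj, rfl⟩, ?_⟩
    rw [hval _ hj, hJj]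

end TotalTransf

/-! ### Equations with constant arbitrary elements -/

/-- The equation with constant `G` and `F` over the set `s`. -/
def constEqn (s : Set (VarSpace n)) (G F : ℂ) : Eqn n := ⟨Prod.fst ⁻¹' s, fun _ => G, fun _ => F⟩

lemma base_constEqn (s : Set (VarSpace n)) (G F : ℂ) : (constEqn s G F).base = s :=
  image_preimage_eq s Prod.fst_surjective

lemma constEqn_mem_classN {s : Set (VarSpace n)} (hs : IsOpen s) (hne : s.Nonempty) {G F : ℂ}
    (hG : G ≠ 0) : constEqn s G F ∈ classN n :=
  ⟨hs.preimage continuous_fst, hne.preimage Prod.fst_surjective, contDiffOn_const, contDiffOn_const,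
    fun _ _ => hG⟩

lemma constEqn_mem_classN0 {s : Set (VarSpace n)} (hs : IsOpen s) (hne : s.Nonempty) {G F : ℂ}
    (hG : conj G ≠ -G) : constEqn s G F ∈ classN0 n :=
  ⟨constEqn_mem_classN hs hne (by rintro rfl; simp at hG), fun _ _ => hG⟩

lemma constEqn_mem_classN0bar {s : Set (VarSpace n)} (hs : IsOpen s) (hne : s.Nonempty) {G F : ℂ}
    (h0 : G ≠ 0) (hG : conj G = -G) : constEqn s G F ∈ classN0bar n :=
  ⟨constEqn_mem_classN hs hne h0, fun _ _ => hG⟩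

/-! ### Equivalence groups -/

section EquivGroup
variable {C : Set (Eqn n)} {Φ : TotalTransf n} {G F : ℂ}

lemma exists_conformalEqs_of_mem_equivGroup (hn : 2 ≤ n) (hC : C ⊆ classN n)
    (hΦ : Φ ∈ equivGroup C) (hc : constEqn Φ.base.map.source G F ∈ C) :
    ∃ H, Φ.base.ConformalEqs H := by
  obtain ⟨θ', -, -, hm⟩ := hΦ _ hc (base_constEqn _ _ _).le
  exact hm.exists_conformalEqs hn (hC hc) (base_constEqn _ _ _).symm

/-- A constant equation over the whole source has a graph containing the point `(j, G, F)`. Its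
image equation is related to it by `ArbRel`, and `MapsArb` identifies the values of the image
equation with those of `Φ`. -/
lemma arbRel_of_mem_equivGroup {H : VarSpace n → ℝ} (a₀ : Fin n) (h : Φ.base.ConformalEqs H)
    (hΦ : Φ ∈ equivGroup C) (hG : G ≠ 0)
    (hc : constEqn Φ.base.map.source G F ∈ C) {j : JetSpace n}
    (hj : j.1 ∈ Φ.base.map.source) :
    Φ.base.ArbRel H j G F (Φ.map (j, (G, F))).2.1 (Φ.map (j, (G, F))).2.2 := by
  obtain ⟨θ', -, ha, hm⟩ := hΦ _ hc (base_constEqn _ _ _).le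
  have hjd : j ∈ (constEqn Φ.base.map.source G F).dom := hj
  have h1 := (hm.arbRel h a₀ hjd).2
  have h2 : Φ.map (j, (G, F)) ∈ θ'.graph := by
    rw [← ha]; exact ⟨_, ⟨j, hjd, rfl⟩, rfl⟩
  obtain ⟨j', hj', he⟩ := h2
  have h3 : j' = Φ.base.prolongJet H j := by
    rw [← TotalTransf.map_fst (e := (j, (G, F))) h a₀ (TotalTransf.mem_source.2 ⟨hj, hG⟩), ← he]
  rw [← he]
  subst h3
  exact h1

/-- The equivalence groups of classes between `𝒩₀` and `𝒩`. -/
lemma forms_of_mem_equivGroup (hn : 2 ≤ n) (hC : C ⊆ classN n) (hC0 : classN0 n ⊆ C)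
    (hΦ : Φ ∈ equivGroup C) : ∃ H, Φ.base.ConformalEqs H ∧ Φ.base.IsUnmixed ∧
      ∀ e ∈ Φ.map.source, Φ.GFormAt H e ∧ Φ.FFormAt H e := by
  let a₀ : Fin n := ⟨0, by omega⟩
  -- Over an empty source there is no test equation, as domains are nonempty; all conditions are
  -- vacuous and any `H` serves.
  rcases Φ.base.map.source.eq_empty_or_nonempty with hs | hs
  · have hs' : ∀ z, z ∉ Φ.base.map.source := fun z hz => by simp [hs] at hz
    refine ⟨fun _ => 0, ⟨contDiffOn_const, fun z hz => (hs' z hz).elim⟩,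
      fun z hz => (hs' z hz).elim, fun e he => ?_⟩
    exact (hs' _ (TotalTransf.mem_source.1 he).1).elim
  have hc : ∀ G F : ℂ, conj G ≠ -G → constEqn Φ.base.map.source G F ∈ C := fun G F hG =>
    hC0 (constEqn_mem_classN0 Φ.base.map.open_source hs hG)
  have h1 : conj (1 : ℂ) ≠ -1 := by
    rw [map_one]; norm_num
  obtain ⟨H, h⟩ := exists_conformalEqs_of_mem_equivGroup hn hC hΦ (hc 1 0 h1)
  have hrel : ∀ (j : JetSpace n), j.1 ∈ Φ.base.map.source → ∀ G F : ℂ, conj G ≠ -G →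
      Φ.base.ArbRel H j G F (Φ.map (j, (G, F))).2.1 (Φ.map (j, (G, F))).2.2 :=
    fun j hj G F hG =>
      arbRel_of_mem_equivGroup a₀ h hΦ (by rintro rfl; simp at hG) (hc G F hG) hj
  refine ⟨H, h, fun z hz => ?_, fun e he => TotalTransf.formAt_iff.2 ?_⟩
  · by_contra h0
    obtain ⟨hA, hB⟩ := mul_ne_zero_iff.1 h0
    -- If both derivatives of `Ψ` were nonzero, the two formulas applied to `G = 1` would give `1 =
    -- -1`.
    have hr := hrel (z, 0) hz 1 0 h1
    have h2 := (hr.1 hA).symm.trans (hr.2.1 hB)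
    rw [mul_right_inj' (div_ne_zero (h.ne_zero hz) (h.dt_ne_zero hz))] at h2
    norm_num at h2
  · obtain ⟨j, G, F⟩ := e
    obtain ⟨hj, hG⟩ := TotalTransf.mem_source.1 he
    by_cases hGc : conj G = -G
    -- An imaginary `G` is the limit of `G + s` with real `s ≠ 0`, for which constant equations in
    -- `𝒩₀` are available; continuity of `Φ` and closedness of the relation finish.
    · have hlim : Tendsto (fun s : ℝ => ((G + s : ℂ), (Φ.map (j, ((G + s : ℂ), F))).2))
          (𝓝[≠] 0) (𝓝 (G, (Φ.map (j, (G, F))).2)) := by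
        have h2 : Tendsto (fun s : ℝ => (G + s : ℂ)) (𝓝[≠] 0) (𝓝 G) := by
          have : Continuous fun s : ℝ => (G + s : ℂ) := by fun_prop
          exact (this.tendsto' 0 G (by simp)).mono_left nhdsWithin_le_nhds
        refine h2.prodMk_nhds ?_
        have h3 : ContinuousAt Φ.map (j, (G, F)) := Φ.map.continuousAt he
        exact (h3.snd.tendsto).comp
          (tendsto_const_nhds.prodMk_nhds (h2.prodMk_nhds tendsto_const_nhds))
      refine (Φ.base.isClosed_arbRel H j F).mem_of_tendsto hlim ?_
      filter_upwards [self_mem_nhdsWithin] with s hs0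
      refine hrel j hj _ _ fun h4 => hs0 ?_
      rw [map_add, hGc, Complex.conj_ofReal] at h4
      have h5 : (s : ℂ) = 0 := by linear_combination h4 / 2
      exact_mod_cast h5
    · exact hrel j hj G F hGc

lemma mem_equivGroup_classN {H : VarSpace n → ℝ} (a₀ : Fin n) (h : Φ.base.ConformalEqs H)
    (hf : ∀ e ∈ Φ.map.source, Φ.GFormAt H e ∧ Φ.FFormAt H e) : Φ ∈ equivGroup (classN n) := by
  intro θ hθ hb
  obtain ⟨θ', hθ', ha, hm, -⟩ := TotalTransf.exists_image h a₀ hθ hb fun j hj =>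
    TotalTransf.formAt_iff.1 (hf (j, (θ.G j, θ.F j))
      (TotalTransf.mem_source.2 ⟨hb ⟨j, hj, rfl⟩, hθ.2.2.2.2 j hj⟩))
  exact ⟨θ', hθ', ha, hm⟩

lemma mem_equivGroup_classN0 {H : VarSpace n → ℝ} (a₀ : Fin n) (h : Φ.base.ConformalEqs H)
    (hf : ∀ e ∈ Φ.map.source, Φ.GFormAt H e ∧ Φ.FFormAt H e) : Φ ∈ equivGroup (classN0 n) := by
  intro θ hθ hb
  obtain ⟨θ', hθ', ha, hm, hr⟩ := TotalTransf.exists_image h a₀ hθ.1 hb fun j hj =>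
    TotalTransf.formAt_iff.1 (hf (j, (θ.G j, θ.F j))
      (TotalTransf.mem_source.2 ⟨hb ⟨j, hj, rfl⟩, hθ.1.2.2.2.2 j hj⟩))
  refine ⟨θ', ⟨hθ', fun j' hj' => ?_⟩, ha, hm⟩
  obtain ⟨j, hj, hr⟩ := hr j' hj'
  rw [Ne, hr.conj_eq_neg_iff h (hb ⟨j, hj, rfl⟩)]
  exact hθ.2 j hj

/-- Equations of `𝒩̄₀` only visit imaginary `G`, so the form of `Φ` elsewhere is irrelevant; the
image stays in `𝒩̄₀` because `ArbRel` preserves imaginary values. -/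
lemma mem_equivGroup_classN0bar {H : VarSpace n → ℝ} (a₀ : Fin n) (h : Φ.base.ConformalEqs H)
    (hf : ∀ e ∈ Φ.map.source, conj e.2.1 = -e.2.1 → Φ.GFormAt H e ∧ Φ.FFormAt H e) :
    Φ ∈ equivGroup (classN0bar n) := by
  intro θ hθ hb
  obtain ⟨θ', hθ', ha, hm, hr⟩ := TotalTransf.exists_image h a₀ hθ.1 hb fun j hj =>
    TotalTransf.formAt_iff.1 (hf (j, (θ.G j, θ.F j))
      (TotalTransf.mem_source.2 ⟨hb ⟨j, hj, rfl⟩, hθ.1.2.2.2.2 j hj⟩) (hθ.2 j hj))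
  refine ⟨θ', ⟨hθ', fun j' hj' => ?_⟩, ha, hm⟩
  obtain ⟨j, hj, hr⟩ := hr j' hj'
  rw [hr.conj_eq_neg_iff h (hb ⟨j, hj, rfl⟩)]
  exact hθ.2 j hj

lemma forms_of_mem_equivGroup_classN0bar (hn : 2 ≤ n) (hΦ : Φ ∈ equivGroup (classN0bar n)) :
    ∃ H, Φ.base.ConformalEqs H ∧
      ∀ e ∈ Φ.map.source, conj e.2.1 = -e.2.1 → Φ.GFormAt H e ∧ Φ.FFormAt H e := by
  let a₀ : Fin n := ⟨0, by omega⟩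
  rcases Φ.base.map.source.eq_empty_or_nonempty with hs | hs
  · have hs' : ∀ z, z ∉ Φ.base.map.source := fun z hz => by simp [hs] at hz
    refine ⟨fun _ => 0, ⟨contDiffOn_const, fun z hz => (hs' z hz).elim⟩, fun e he => ?_⟩
    exact (hs' _ (TotalTransf.mem_source.1 he).1).elim
  have hc : ∀ G F : ℂ, G ≠ 0 → conj G = -G →
      constEqn Φ.base.map.source G F ∈ classN0bar n := fun G F h0 hG =>
    constEqn_mem_classN0bar Φ.base.map.open_source hs h0 hG
  obtain ⟨H, h⟩ := exists_conformalEqs_of_mem_equivGroup hn (fun _ h => h.1) hΦ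
    (hc Complex.I 0 Complex.I_ne_zero Complex.conj_I)
  refine ⟨H, h, fun e he hG => TotalTransf.formAt_iff.2 ?_⟩
  obtain ⟨h1, h2⟩ := TotalTransf.mem_source.1 he
  exact arbRel_of_mem_equivGroup a₀ h hΦ h2 (hc _ _ h2 hG) h1

/-- An unmixed conformal transformation is the projection of an equivalence transformation. -/
lemma PointTransf.ConformalEqs.exists_forms {φ : PointTransf n} {H : VarSpace n → ℝ}
    (h : φ.ConformalEqs H) (hu : φ.IsUnmixed) : ∃ Φ : TotalTransf n, Φ.base = φ ∧
      ∀ e ∈ Φ.map.source, Φ.GFormAt H e ∧ Φ.FFormAt H e := by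
  have hPsi : ContDiffOn ℝ ∞ φ.Psi φ.map.source := PointTransf.contDiffOn_Psi
  have hA := contDiffOn_dpsi φ.map.open_source hPsi
  have h1 : ∀ z ∈ φ.map.source, dpsi φ.Psi z ≠ 0 →
      dpsi φ.Psi z * conj (dpsi φ.Psi z) / φ.psiJac z = 1 := by
    intro z hz h0
    have hJ := h.psiJac_ne_zero hz
    have hB : dpsiConj φ.Psi z = 0 := (mul_eq_zero.1 (hu z hz)).resolve_left h0
    rw [div_eq_one_iff_eq hJ]
    simp [PointTransf.psiJac, hB]
  have h2 : ∀ z ∈ φ.map.source, dpsiConj φ.Psi z ≠ 0 →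
      dpsi φ.Psi z * conj (dpsi φ.Psi z) / φ.psiJac z = 0 := by
    intro z hz h0
    have hA : dpsi φ.Psi z = 0 := (mul_eq_zero.1 (hu z hz)).resolve_right h0
    simp [hA]
  -- The selector is `χ = |Ψ_ψ|² / (|Ψ_ψ|² - |Ψ_{ψ*}|²)`: a smooth function that, for unmixed `φ`,
  -- is 1 where `Ψ_ψ ≠ 0` and 0 where `Ψ_{ψ*} ≠ 0`.
  obtain ⟨Φ, rfl, hΦ⟩ := h.exists_totalTransf
    ((hA.mul hA.conj).div_complex PointTransf.contDiffOn_psiJac fun z hz => h.psiJac_ne_zero hz)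
    (fun z hz => (h.dpsi_ne_zero_or hz).symm.imp (h2 z hz) (h1 z hz))
  refine ⟨Φ, rfl, fun e he => TotalTransf.formAt_iff.2 ?_⟩
  have hz := (TotalTransf.mem_source.1 he).1
  rw [hΦ]
  exact PointTransf.arbRel_arbMap (fun h0 => Or.inl (h1 _ hz h0)) (fun h0 => Or.inl (h2 _ hz h0))

/-- A conformal transformation is the projection of a transformation that has the required form
for imaginary `G`. -/
lemma PointTransf.ConformalEqs.exists_forms_of_conj_eq_neg {φ : PointTransf n}
    {H : VarSpace n → ℝ} (h : φ.ConformalEqs H) : ∃ Φ : TotalTransf n, Φ.base = φ ∧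
      ∀ e ∈ Φ.map.source, conj e.2.1 = -e.2.1 → Φ.GFormAt H e ∧ Φ.FFormAt H e := by
  -- For imaginary `G` the two formulas in (B) agree, so the constant selector 1 works for every
  -- conformal `φ`, mixed or not; it is only one of the possible continuations to other `G`.
  obtain ⟨Φ, rfl, hΦ⟩ := h.exists_totalTransf (χ := fun _ => 1) contDiffOn_const
    (fun _ _ => Or.inr rfl)
  refine ⟨Φ, rfl, fun e he hG => TotalTransf.formAt_iff.2 ?_⟩
  rw [hΦ]
  exact PointTransf.arbRel_arbMap (fun _ => Or.inr hG) (fun _ => Or.inr hG)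

end EquivGroup

/-! ### Normalization -/

/-- A single admissible transformation already has to be unmixed: at a point where both derivatives
of `Ψ` are nonzero, equating the formulas for the new `G` gives `G = -G*`. It then lifts to the
total space, and uniqueness in `ArbRel` makes the lift induce the given triple. -/
lemma isNormalized_classN0 (hn : 2 ≤ n) : IsNormalized (classN0 n) := by
  let a₀ : Fin n := ⟨0, by omega⟩
  rintro θ hθ θ' hθ' φ ⟨hs, hm⟩
  obtain ⟨H, h⟩ := hm.exists_conformalEqs hn hθ.1 hs
  have hu : φ.IsUnmixed := by
    intro z hz
    by_contra h0
    obtain ⟨hA, hB⟩ := mul_ne_zero_iff.1 h0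
    rw [hs] at hz
    obtain ⟨j, hj, rfl⟩ := hz
    have hz : j.1 ∈ φ.map.source := hm.1 ⟨j, hj, rfl⟩
    have hr := (hm.arbRel h a₀ hj).2
    have h2 := (hr.1 hA).symm.trans (hr.2.1 hB)
    rw [mul_right_inj' (div_ne_zero (h.ne_zero hz) (h.dt_ne_zero hz))] at h2
    exact hθ.2 j hj (neg_eq_iff_eq_neg.1 h2.symm)
  obtain ⟨Φ, rfl, hf⟩ := h.exists_forms hu
  refine ⟨Φ, mem_equivGroup_classN0 a₀ h hf, rfl,
    TotalTransf.mapsArb h a₀ hm hθ.1.2.2.2.2 fun j hj => ?_⟩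
  exact TotalTransf.formAt_iff.1 (hf (j, (θ.G j, θ.F j))
    (TotalTransf.mem_source.2 ⟨hm.1 ⟨j, hj, rfl⟩, hθ.1.2.2.2.2 j hj⟩))

lemma isNormalized_classN0bar (hn : 2 ≤ n) : IsNormalized (classN0bar n) := by
  let a₀ : Fin n := ⟨0, by omega⟩
  rintro θ hθ θ' hθ' φ ⟨hs, hm⟩
  obtain ⟨H, h⟩ := hm.exists_conformalEqs hn hθ.1 hs
  obtain ⟨Φ, rfl, hf⟩ := h.exists_forms_of_conj_eq_neg
  refine ⟨Φ, mem_equivGroup_classN0bar a₀ h hf, rfl,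
    TotalTransf.mapsArb h a₀ hm hθ.1.2.2.2.2 fun j hj => ?_⟩
  exact TotalTransf.formAt_iff.1 (hf (j, (θ.G j, θ.F j))
    (TotalTransf.mem_source.2 ⟨hm.1 ⟨j, hj, rfl⟩, hθ.1.2.2.2.2 j hj⟩) (hθ.2 j hj))

/-- Admissible transformations preserve the condition `G* = -G`. -/
lemma PointTransf.IsAdmissible.exists_conj_eq_neg_iff {φ : PointTransf n} {θ θ' : Eqn n}
    (ha : φ.IsAdmissible θ θ') (hn : 2 ≤ n) (hθ : θ ∈ classN n) : ∃ j ∈ θ.dom, ∃ j' ∈ θ'.dom,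
      (conj (θ'.G j') = -θ'.G j' ↔ conj (θ.G j) = -θ.G j) := by
  obtain ⟨hs, hm⟩ := ha
  obtain ⟨H, h⟩ := hm.exists_conformalEqs hn hθ hs
  obtain ⟨j, hj⟩ := hθ.2.1
  obtain ⟨h1, h2⟩ := hm.arbRel h ⟨0, by omega⟩ hj
  exact ⟨j, hj, _, h1, h2.conj_eq_neg_iff h (hm.1 ⟨j, hj, rfl⟩)⟩

/-! ### A transformation mixing `ψ` and `ψ*` -/

/-- The linear map `(t, x, ψ) ↦ (t, x, 2ψ + ψ*)`. -/
def mixingCLM (n : ℕ) : VarSpace n →L[ℝ] VarSpace n :=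
  (ContinuousLinearMap.fst ℝ (IndepVar n) ℂ).prod
    ((2 : ℝ) • ContinuousLinearMap.snd ℝ (IndepVar n) ℂ
      + (Complex.conjCLE : ℂ →L[ℝ] ℂ).comp (ContinuousLinearMap.snd ℝ (IndepVar n) ℂ))

lemma mixingCLM_apply (z : VarSpace n) : mixingCLM n z = (z.1, 2 * z.2 + conj z.2) := by
  simp [mixingCLM]

/-- The inverse of `mixingCLM`. -/
def mixingInv (n : ℕ) : VarSpace n →L[ℝ] VarSpace n :=
  (ContinuousLinearMap.fst ℝ (IndepVar n) ℂ).prod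
    ((2 / 3 : ℝ) • ContinuousLinearMap.snd ℝ (IndepVar n) ℂ
      - (1 / 3 : ℝ) • (Complex.conjCLE : ℂ →L[ℝ] ℂ).comp (ContinuousLinearMap.snd ℝ (IndepVar n) ℂ))

lemma mixingInv_apply (z : VarSpace n) :
    mixingInv n z = (z.1, 2 / 3 * z.2 - 1 / 3 * conj z.2) := by
  simp [mixingInv]

/-- The point transformation `(t, x, ψ) ↦ (t, x, 2ψ + ψ*)`. -/
def mixing (n : ℕ) : PointTransf n where
  map := (Homeomorph.mk
    ⟨mixingCLM n, mixingInv n,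
      fun z => by
        rw [mixingCLM_apply, mixingInv_apply]
        ext1
        · rfl
        · simp only [map_add, map_mul, Complex.conj_conj, map_ofNat]; ring,
      fun z => by
        rw [mixingInv_apply, mixingCLM_apply]
        ext1
        · rfl
        · simp only [map_sub, map_mul, map_div₀, Complex.conj_conj, map_ofNat, map_one]; ring⟩
    (mixingCLM n).continuous (mixingInv n).continuous).toOpenPartialHomeomorph
  smooth := (mixingCLM n).contDiff.contDiffOn
  smooth_symm := (mixingInv n).contDiff.contDiffOn

lemma source_mixing : (mixing n).map.source = univ := rfl

lemma fderiv_mixing (z : VarSpace n) : fderiv ℝ (mixing n).map z = mixingCLM n :=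
  (mixingCLM n).fderiv

lemma conformalEqs_mixing (hn : 0 < n) : (mixing n).ConformalEqs fun _ => 1 := by
  refine PointTransf.conformalEqs_of_conformalAt hn fun z _ => ⟨one_pos, ?_, ?_, ?_, ?_⟩
  all_goals simp only [fderiv_mixing, mixingCLM_apply]
  · simp
  · simp [spaceVec]
  · simp [timeVec]
  · intro b c
    simp [spaceVec, Pi.single_apply]

lemma not_isUnmixed_mixing : ¬ (mixing n).IsUnmixed := by
  intro h
  have h0 := h 0 (by rw [source_mixing]; trivial)
  have h1 : ∀ w, fderiv ℝ (mixing n).Psi 0 (0, w) = 2 * w + conj w := by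
    intro w
    rw [PointTransf.fderiv_Psi (by rw [source_mixing]; trivial), fderiv_mixing, mixingCLM_apply]
  rw [dpsi, dpsiConj, h1, h1] at h0
  simp only [map_one, Complex.conj_I] at h0
  have h2 : (2 : ℂ) = 0 := by
    linear_combination h0 + (Complex.I ^ 2 - 1) / 4 * Complex.I_sq
  norm_num at h2

/-- The equation `i ψ_t + i ψ_aa = 0` is tested: the map to `2ψ + ψ*` sends it to another equation
of `𝒩̄₀`, hence of `𝒩`. This triple cannot be induced, as the projections of equivalence
transformations of `𝒩` are unmixed. -/
lemma not_isNormalized_classN (hn : 2 ≤ n) : ¬ IsNormalized (classN n) := by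
  intro hN
  have h := conformalEqs_mixing (n := n) (by omega)
  obtain ⟨Φ₀, hΦ₀, hf⟩ := h.exists_forms_of_conj_eq_neg
  have hmem := mem_equivGroup_classN0bar ⟨0, by omega⟩ (by rw [hΦ₀]; exact h) hf
  have hθ : constEqn (univ : Set (VarSpace n)) Complex.I 0 ∈ classN0bar n :=
    constEqn_mem_classN0bar isOpen_univ univ_nonempty Complex.I_ne_zero Complex.conj_I
  obtain ⟨θ', hθ', -, hm⟩ := hmem _ hθ (by rw [hΦ₀, source_mixing]; exact subset_univ _)
  rw [hΦ₀] at hm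
  obtain ⟨Φ, hΦ, hΦφ, -⟩ := hN _ hθ.1 θ' hθ'.1 (mixing n) ⟨by rw [base_constEqn]; rfl, hm⟩
  obtain ⟨H, -, hu, -⟩ := forms_of_mem_equivGroup hn Subset.rfl (fun _ h => h.1) hΦ
  rw [hΦφ] at hu
  exact not_isUnmixed_mixing hu

/-! ### Partition -/

/-- `U₀` is the open set where `G* ≠ -G`, and `U₁` is the part of the domain outside its closure.
Only boundary points of `U₀` are lost, so the union is dense. -/
lemma exists_partition {θ : Eqn n} (hθ : θ ∈ classN n) :
    ∃ U₀ U₁ : Set (JetSpace n), IsOpen U₀ ∧ IsOpen U₁ ∧ Disjoint U₀ U₁ ∧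
      U₀ ⊆ θ.dom ∧ U₁ ⊆ θ.dom ∧ θ.dom ⊆ closure (U₀ ∪ U₁) ∧
      (U₀.Nonempty → θ.restrict U₀ ∈ classN0 n) ∧
      (U₁.Nonempty → θ.restrict U₁ ∈ classN0bar n) := by
  obtain ⟨ho, -, hG, hF, hG0⟩ := hθ
  set U₀ := θ.dom ∩ θ.G ⁻¹' {g | conj g ≠ -g} with hU₀
  have h0 : IsOpen U₀ := hG.continuousOn.isOpen_inter_preimage ho
    (isOpen_ne_fun Complex.continuous_conj continuous_neg)
  have hsub₁ : θ.dom ∩ (closure U₀)ᶜ ⊆ {j | conj (θ.G j) = -θ.G j} := by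
    rintro j ⟨hj, hj'⟩
    by_contra h1
    exact hj' (subset_closure ⟨hj, h1⟩)
  refine ⟨U₀, θ.dom ∩ (closure U₀)ᶜ, h0, ho.inter isClosed_closure.isOpen_compl, ?_,
    inter_subset_left, inter_subset_left, ?_, fun hne => ?_, fun hne => ?_⟩
  · exact disjoint_left.2 fun j hj hj' => hj'.2 (subset_closure hj)
  · intro j hj
    by_cases h1 : j ∈ closure U₀
    · exact closure_mono subset_union_left h1
    · exact subset_closure (Or.inr ⟨hj, h1⟩)
  · exact ⟨⟨h0, hne, hG.mono inter_subset_left, hF.mono inter_subset_left,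
      fun j hj => hG0 j hj.1⟩, fun j hj => hj.2⟩
  · exact ⟨⟨ho.inter isClosed_closure.isOpen_compl, hne, hG.mono inter_subset_left,
      hF.mono inter_subset_left, fun j hj => hG0 j hj.1⟩, fun j hj => hsub₁ hj⟩

end GenSchr
end

/-! ### The theorem -/

open GenSchr in
theorem mainTheorem2 (n : ℕ) (hn : 2 ≤ n) :
    -- the class is not normalized
    ¬ IsNormalized (classN n) ∧
    -- its equivalence group
    (∀ Φ : TotalTransf n, Φ ∈ equivGroup (classN n) ↔
      ∃ H, Φ.base.ConformalEqs H ∧ Φ.base.IsUnmixed ∧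
        ∀ e ∈ Φ.map.source, Φ.GFormAt H e ∧ Φ.FFormAt H e) ∧
    (∀ φ : PointTransf n, (∃ H, φ.ConformalEqs H) → φ.IsUnmixed →
      ∃ Φ ∈ equivGroup (classN n), Φ.base = φ) ∧
    -- partition into two disjoint subclasses, up to a nowhere dense part of each domain
    classN0 n ⊆ classN n ∧ classN0bar n ⊆ classN n ∧ Disjoint (classN0 n) (classN0bar n) ∧
    (∀ θ ∈ classN n, ∃ U₀ U₁ : Set (JetSpace n), IsOpen U₀ ∧ IsOpen U₁ ∧ Disjoint U₀ U₁ ∧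
      U₀ ⊆ θ.dom ∧ U₁ ⊆ θ.dom ∧ θ.dom ⊆ closure (U₀ ∪ U₁) ∧
      (U₀.Nonempty → θ.restrict U₀ ∈ classN0 n) ∧
      (U₁.Nonempty → θ.restrict U₁ ∈ classN0bar n)) ∧
    -- the subclasses are normalized and not related by point transformations
    IsNormalized (classN0 n) ∧ IsNormalized (classN0bar n) ∧
    (∀ θ ∈ classN0 n, ∀ θ' ∈ classN0bar n, ∀ φ : PointTransf n,
      ¬ φ.IsAdmissible θ θ' ∧ ¬ φ.IsAdmissible θ' θ) ∧
    -- their equivalence groups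
    equivGroup (classN0 n) = equivGroup (classN n) ∧
    (∀ Φ : TotalTransf n, Φ ∈ equivGroup (classN0bar n) ↔
      ∃ H, Φ.base.ConformalEqs H ∧
        ∀ e ∈ Φ.map.source, conj e.2.1 = -e.2.1 → Φ.GFormAt H e ∧ Φ.FFormAt H e) ∧
    (∀ φ : PointTransf n, (∃ H, φ.ConformalEqs H) →
      ∃ Φ ∈ equivGroup (classN0bar n), Φ.base = φ) := by
  let a₀ : Fin n := ⟨0, by omega⟩
  have hN : ∀ Φ : TotalTransf n, Φ ∈ equivGroup (classN n) ↔
      ∃ H, Φ.base.ConformalEqs H ∧ Φ.base.IsUnmixed ∧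
        ∀ e ∈ Φ.map.source, Φ.GFormAt H e ∧ Φ.FFormAt H e := fun Φ =>
    ⟨forms_of_mem_equivGroup hn Subset.rfl fun _ h => h.1,
      fun ⟨_, h, _, hf⟩ => mem_equivGroup_classN a₀ h hf⟩
  refine ⟨not_isNormalized_classN hn, hN, ?_, fun _ h => h.1, fun _ h => h.1, ?_,
    fun θ hθ => exists_partition hθ, isNormalized_classN0 hn, isNormalized_classN0bar hn, ?_, ?_,
    fun Φ => ⟨forms_of_mem_equivGroup_classN0bar hn,
      fun ⟨_, h, hf⟩ => mem_equivGroup_classN0bar a₀ h hf⟩, ?_⟩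
  · rintro φ ⟨H, h⟩ hu
    obtain ⟨Φ, rfl, hf⟩ := h.exists_forms hu
    exact ⟨Φ, mem_equivGroup_classN a₀ h hf, rfl⟩
  · refine disjoint_left.2 fun θ h1 h2 => ?_
    obtain ⟨j, hj⟩ := h1.1.2.1
    exact h1.2 j hj (h2.2 j hj)
  · intro θ hθ θ' hθ' φ
    constructor
    · intro ha
      obtain ⟨j, hj, j', hj', hi⟩ := ha.exists_conj_eq_neg_iff hn hθ.1
      exact hθ.2 j hj (hi.1 (hθ'.2 j' hj'))
    · intro ha
      obtain ⟨j, hj, j', hj', hi⟩ := ha.exists_conj_eq_neg_iff hn hθ'.1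
      exact hθ.2 j' hj' (hi.2 (hθ'.2 j hj))
  -- The description of the group was derived for any class between `𝒩₀` and `𝒩`, so both extremes
  -- have the same one.
  · ext Φ
    rw [hN]
    exact ⟨forms_of_mem_equivGroup hn (fun _ h => h.1) Subset.rfl,
      fun ⟨_, h, _, hf⟩ => mem_equivGroup_classN0 a₀ h hf⟩
  · rintro φ ⟨H, h⟩
    obtain ⟨Φ, rfl, hf⟩ := h.exists_forms_of_conj_eq_neg
    exact ⟨Φ, mem_equivGroup_classN0bar a₀ h hf, rfl⟩
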